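/- Let $N\in\mathbb N$, $T>0$, $\alpha\in(0,1)$. Let $H:\mathbb R^N\times\mathbb R^N\to\mathbb R$ be continuous and $\mathbb Z^N$-periodic in its first variable, with $\lim_{r\to\infty}\inf\{H(y,p): y\in\mathbb R^N,\ |p|\ge r\}=\infty$, and assume that there is $C_H>0$ such that $|H(x,p)-H(y,q)|\le C_H(|x-y|+|p-q|)$ and $H(x,p)\ge C_H^{-1}|p|-C_H$ for all $x,y,p,q\in\mathbb R^N$. Let $u_0:\mathbb R^N\to\mathbb R$ be bounded and Lipschitz continuous. For $t\in(0,T]$ and $0\le a<b\le t$ put $$J[f](t)=\frac{f(t)-f(0)}{t^\alpha\,\Gamma(1-\alpha)},\qquad K_{(a,b)}[f](t)=\frac{\alpha}{\Gamma(1-\alpha)}\int_a^b\frac{f(t)-f(t-\tau)}{\tau^{\alpha+1}}\,d\tau,$$ and for functions $f$ of $(x,t)$ let $J[f](x,t)$, $K_{(a,b)}[f](x,t)$ be these expressions for $f(x,\cdot)$. For a function $F:\mathbb R^N\times\mathbb R^N\to\mathbb R$, a viscosity subsolution of $\partial_t^\alpha w+F(x,Dw)=0$, $w(\cdot,0)=u_0$,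 is an upper semicontinuous $w:\mathbb R^N\times[0,T]\to\mathbb R$ with $w(\cdot,0)\le u_0$ such that $J[\varphi](x_1,t_1)+K_{(0,t_1)}[\varphi](x_1,t_1)+F(x_1,D\varphi(x_1,t_1))\le 0$ whenever $\varphi\in C^1(\mathbb R^N\times(0,T])\cap C(\mathbb R^N\times[0,T])$ and $w-\varphi$ attains its maximum over $\mathbb R^N\times[0,T]$ at $(x_1,t_1)$ with $t_1\in(0,T]$. Supersolutions are defined symmetrically (lower semicontinuous, minimum, reversed inequalities), and a viscosity solution is a bounded continuous function that is both. Viscosity solutions of stationary equations are continuous and are defined as usual, by $C^1$ test functions touching at local extrema. For $p\in\mathbb R^N$ let $\overline H(p)$ be the unique constant for which $H(y,p+Dv)=\overline H(p)$ has a continuous $\mathbb Z^N$-periodic viscosity solution $v$. Let $u^\varepsilon$ ($\varepsilon>0$) be the viscosity solution of $\partial_t^\alpha u^\varepsilon+H(x/\varepsilon,Du^\varepsilon)=0$, $u^\varepsilon(\cdot,0)=u_0$; let $\overline u$ be the viscosity solution of $\partial_t^\alpha\overline u+\overline H(D\overline u)=0$, $\overline u(\cdot,0)=u_0$; and for $\lambda>0$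 and $P\in\mathbb R^N$ let $v^\lambda(\cdot,P)$ be the bounded viscosity solution of $\lambda v^\lambda+H(y,P+Dv^\lambda)=0$ in $\mathbb R^N$. Let $\theta,\beta\in(0,1)$. For $\varepsilon>0$, $\delta\in(0,1)$, $R>0$ and $\lambda=\varepsilon^\theta$, define on $\mathbb R^{2N}\times[0,T]$ $$\Phi(x,y,t)=u^\varepsilon(x,t)-\overline u(y,t)-\varepsilon v^{\lambda}\Big(\frac x\varepsilon,\frac{x-y}{\varepsilon^\beta}\Big)-\frac{|x-y|^2}{2\varepsilon^\beta}-\frac{\delta|y|^2}{2}-\frac{Rt^\alpha}{\Gamma(1+\alpha)}.$$ Then there is $\varepsilon_0\in(0,1)$ such that for each $\nu\in(0,1)$ there is a constant $C>0$, independent of $\varepsilon$, $\delta$, $R$ and of the maximum point below, with the following property. For all $\varepsilon\in(0,\varepsilon_0)$, $\delta\in(0,1)$ with $\delta^{1/2}<\lambda$, and $R>0$: if $\Phi$ attains its maximum over $\mathbb R^{2N}\times[0,T]$ at $(\hat x,\hat y,\hat t)$ with $\hat t\in(0,T]$, then $$J[u^\varepsilon](\hat x,\hat t)-J[\overline u](\hat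 y,\hat t)+K_{(0,\hat t)}[u^\varepsilon](\hat x,\hat t)-K_{(0,\hat t)}[\overline u](\hat y,\hat t)\le C\Big(\varepsilon^{\theta-\frac{\beta(1-\nu)}{2-\nu}}+\varepsilon^{1-\theta-\beta}\Big).$$ Here the difference of the two $K$-terms is understood as $K_{(0,\hat t)}[u^\varepsilon(\hat x,\cdot)-\overline u(\hat y,\cdot)](\hat t)$, whose integral converges absolutely (this is part of the assertion); it equals the difference of the two terms whenever these converge separately, so that the inequality then also holds literally. -/

import Mathlib

open Set Filter Topology MeasureTheory

noncomputable section

namespace TFHJ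

/-- The Euclidean space of dimension `N`. -/
abbrev Space (N : ℕ) : Type := EuclideanSpace ℝ (Fin N)

/-- The vector of `Space N` with integer coordinates `k`. -/
def latticeVec {N : ℕ} (k : Fin N → ℤ) : Space N := WithLp.toLp 2 (fun i => (k i : ℝ))

/-! ### The two parts of the Caputo derivative -/

/-- `J[f](t) = (f(t) - f(0)) / (t ^ α Γ(1 - α))`. -/
def J (α : ℝ) (f : ℝ → ℝ) (t : ℝ) : ℝ :=
  (f t - f 0) / (t ^ α * Real.Gamma (1 - α))

/-- `K_{(a,b)}[f](t) = α / Γ(1 - α) * ∫_a^b (f(t) - f(t - τ)) / τ ^ (α + 1) dτ`. -/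
def K (α a b : ℝ) (f : ℝ → ℝ) (t : ℝ) : ℝ :=
  α / Real.Gamma (1 - α) * ∫ τ in a..b, (f t - f (t - τ)) / τ ^ (α + 1)

/-- The integral in `K_{(a,b)}[f](t)` converges (absolutely). -/
def KExists (α a b : ℝ) (f : ℝ → ℝ) (t : ℝ) : Prop :=
  IntervalIntegrable (fun τ => (f t - f (t - τ)) / τ ^ (α + 1)) volume a b

/-! ### Viscosity solutions of the time-fractional problem

The problem is `∂_t^α u + F(x, Du) = 0` in `Space N × (0, T)` with `u(·, 0) = u₀`. -/

/-- Test functions: of class `C¹` on `Space N × (0, T]`, continuous on `Space N × [0, T]`. -/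
def IsTest {N : ℕ} (T : ℝ) (φ : Space N → ℝ → ℝ) : Prop :=
  ContDiffOn ℝ 1 (Function.uncurry φ) (univ ×ˢ Ioc 0 T) ∧
    ContinuousOn (Function.uncurry φ) (univ ×ˢ Icc 0 T)

/-- Viscosity subsolutions; the gradient is the one in the space variable. -/
def IsSubsolution {N : ℕ} (α T : ℝ) (F : Space N → Space N → ℝ) (u₀ : Space N → ℝ)
    (u : Space N → ℝ → ℝ) : Prop :=
  UpperSemicontinuousOn (Function.uncurry u) (univ ×ˢ Icc 0 T) ∧
  (∀ x, u x 0 ≤ u₀ x) ∧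
  ∀ φ : Space N → ℝ → ℝ, IsTest T φ → ∀ x₁ : Space N, ∀ t₁ ∈ Ioc 0 T,
    (∀ x, ∀ t ∈ Icc 0 T, u x t - φ x t ≤ u x₁ t₁ - φ x₁ t₁) →
      J α (φ x₁) t₁ + K α 0 t₁ (φ x₁) t₁ + F x₁ (gradient (fun x => φ x t₁) x₁) ≤ 0

/-- Viscosity supersolutions. -/
def IsSupersolution {N : ℕ} (α T : ℝ) (F : Space N → Space N → ℝ) (u₀ : Space N → ℝ)
    (u : Space N → ℝ → ℝ) : Prop :=
  LowerSemicontinuousOn (Function.uncurry u) (univ ×ˢ Icc 0 T) ∧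
  (∀ x, u₀ x ≤ u x 0) ∧
  ∀ φ : Space N → ℝ → ℝ, IsTest T φ → ∀ x₁ : Space N, ∀ t₁ ∈ Ioc 0 T,
    (∀ x, ∀ t ∈ Icc 0 T, u x₁ t₁ - φ x₁ t₁ ≤ u x t - φ x t) →
      0 ≤ J α (φ x₁) t₁ + K α 0 t₁ (φ x₁) t₁ + F x₁ (gradient (fun x => φ x t₁) x₁)

/-- Viscosity solutions, in the class of bounded functions, in which they are unique. -/
def IsSolution {N : ℕ} (α T : ℝ) (F : Space N → Space N → ℝ) (u₀ : Space N → ℝ)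
    (u : Space N → ℝ → ℝ) : Prop :=
  ContinuousOn (Function.uncurry u) (univ ×ˢ Icc 0 T) ∧
  (∃ M : ℝ, ∀ x, ∀ t ∈ Icc 0 T, |u x t| ≤ M) ∧
  IsSubsolution α T F u₀ u ∧ IsSupersolution α T F u₀ u

/-! ### Stationary problems -/

/-- Continuous viscosity solutions of `G(y, v(y), Dv(y)) = 0` in the whole space. -/
def IsStationarySolution {N : ℕ} (G : Space N → ℝ → Space N → ℝ) (v : Space N → ℝ) : Prop :=
  Continuous v ∧
  (∀ φ : Space N → ℝ, ContDiff ℝ 1 φ → ∀ y, IsLocalMax (fun z => v z - φ z) y →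
    G y (v y) (gradient φ y) ≤ 0) ∧
  (∀ φ : Space N → ℝ, ContDiff ℝ 1 φ → ∀ y, IsLocalMin (fun z => v z - φ z) y →
    0 ≤ G y (v y) (gradient φ y))

/-- The cell problem `H(y, p + Dv) = c` on the torus has a continuous viscosity solution. -/
def CellSolvable {N : ℕ} (H : Space N → Space N → ℝ) (p : Space N) (c : ℝ) : Prop :=
  ∃ v : Space N → ℝ, (∀ y (k : Fin N → ℤ), v (y + latticeVec k) = v y) ∧
    IsStationarySolution (fun y _ q => H y (p + q) - c) v

/-- The effective Hamiltonian at `p`: the constant for which the cell problem is solvable. -/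
def effectiveHamiltonian {N : ℕ} (H : Space N → Space N → ℝ) (p : Space N) : ℝ :=
  Classical.epsilon (CellSolvable H p)

/-- `v` is the bounded viscosity solution of `l v + H(y, P + Dv) = 0` in the whole space. -/
def IsDiscountedSolution {N : ℕ} (H : Space N → Space N → ℝ) (l : ℝ) (P : Space N)
    (v : Space N → ℝ) : Prop :=
  (∃ M : ℝ, ∀ y, |v y| ≤ M) ∧
    IsStationarySolution (fun y r q => l * r + H y (P + q)) v

/-! ### The data and the auxiliary function -/

/-- Assumptions on the Hamiltonian and the initial value. -/
structure Assumptions {N : ℕ} (H : Space N → Space N → ℝ) (u₀ : Space N → ℝ) : Prop where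
  continuous : Continuous (Function.uncurry H)
  coercive : ∀ M : ℝ, ∃ r : ℝ, ∀ y p : Space N, r ≤ ‖p‖ → M ≤ H y p
  periodic : ∀ (y p : Space N) (k : Fin N → ℤ), H (y + latticeVec k) p = H y p
  initial_lipschitz : ∃ L : NNReal, LipschitzWith L u₀
  initial_bounded : ∃ M : ℝ, ∀ x, |u₀ x| ≤ M
  lipschitz : ∃ C > 0, ∀ x y p q : Space N, |H x p - H y q| ≤ C * (‖x - y‖ + ‖p - q‖)
  linear_growth : ∃ C > 0, ∀ x p : Space N, C⁻¹ * ‖p‖ - C ≤ H x p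

/-- The function `Φ(x, y, t)`, for `w = u^ε`, `ubar` and `v = v^λ` (a function of `(y, P)`). -/
def Phi {N : ℕ} (α ε β δ R : ℝ) (w ubar : Space N → ℝ → ℝ) (v : Space N → Space N → ℝ)
    (x y : Space N) (t : ℝ) : ℝ :=
  w x t - ubar y t - ε * v (ε⁻¹ • x) ((ε ^ β)⁻¹ • (x - y)) - ‖x - y‖ ^ 2 / (2 * ε ^ β)
    - δ * ‖y‖ ^ 2 / 2 - R * t ^ α / Real.Gamma (1 + α)

end TFHJ

end

/-!
At a maximum point of `Φ`, freeze the slope of the corrector. By comparison, `v^λ(y, ·)` is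
Lipschitz with constant `C / λ`, so the freezing costs at most a multiple of `ε / (λ ε^β)` times
`|x - y - (x̂ - ŷ)|`, and the maximum persists after subtracting this penalty. Doubling the
variables and substituting the frozen corrector's equation turns the viscosity inequalities for
`u^ε` and `ū` into an upper bound for the difference of their Caputo derivatives, up to errors
`λ v^λ + H̄`, the gradient of the penalty `C ε / (λ ε^β)` and that of the `δ`-term.

The Caputo derivative is treated as the single integral over `τ > 0` of the increments of the
function extended by its initial value to negative times. At maximum points in time these increments
are bounded below by those of the smooth penalty, so Fatou's lemma lets the doubling parameter tend
to infinity and yields the absolute convergence as well as the bound.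

The cell error `λ v^λ(·, P) + H̄(P)` is at most a multiple of `λ (1 + |P|)`, because coercivity
bounds the oscillation of the correctors. Finally `ū` is Lipschitz, by comparison with its
translates, which bounds the slope `P = (x̂ - ŷ) / ε^β`; the total error is `λ + ε / (λ ε^β)`.
-/

namespace TFHJ

/-! ### The Caputo derivative as a singular integral -/

lemma integrable_and_integral_le_of_tendsto_of_nonneg {X : Type*} [MeasurableSpace X]
    {μ : Measure X} {f : ℕ → X → ℝ} {g : X → ℝ} {c : ℕ → ℝ} {C : ℝ}
    (hf : ∀ n, Integrable (f n) μ) (hf₀ : ∀ n, 0 ≤ᵐ[μ] f n)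
    (hlim : ∀ᵐ x ∂μ, Tendsto (fun n => f n x) atTop (𝓝 (g x)))
    (hc : ∀ n, ∫ x, f n x ∂μ ≤ c n) (hcC : Tendsto c atTop (𝓝 C)) :
    Integrable g μ ∧ ∫ x, g x ∂μ ≤ C := by
  have hC : 0 ≤ C := ge_of_tendsto' hcC fun n => (integral_nonneg_of_ae (hf₀ n)).trans (hc n)
  have hg : AEStronglyMeasurable g μ :=
    aestronglyMeasurable_of_tendsto_ae _ (fun n => (hf n).aestronglyMeasurable) hlim
  have hg₀ : 0 ≤ᵐ[μ] g := by
    filter_upwards [hlim, ae_all_iff.2 hf₀] with x hx hx₀ using ge_of_tendsto' hx hx₀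
  have hfatou : ∫⁻ x, ENNReal.ofReal (g x) ∂μ ≤ ENNReal.ofReal C :=
    calc ∫⁻ x, ENNReal.ofReal (g x) ∂μ
        = ∫⁻ x, liminf (fun n => ENNReal.ofReal (f n x)) atTop ∂μ := by
          refine lintegral_congr_ae ?_
          filter_upwards [hlim] with x hx
          exact ((ENNReal.continuous_ofReal.tendsto _).comp hx).liminf_eq.symm
      _ ≤ liminf (fun n => ∫⁻ x, ENNReal.ofReal (f n x) ∂μ) atTop :=
          lintegral_liminf_le' fun n => (hf n).aestronglyMeasurable.aemeasurable.ennreal_ofReal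
      _ ≤ liminf (fun n => ENNReal.ofReal (c n)) atTop := by
          refine liminf_le_liminf (Eventually.of_forall fun n => ?_)
          rw [← ofReal_integral_eq_lintegral_ofReal (hf n) (hf₀ n)]
          exact ENNReal.ofReal_le_ofReal (hc n)
      _ = ENNReal.ofReal C := ((ENNReal.continuous_ofReal.tendsto _).comp hcC).liminf_eq
  refine ⟨⟨hg, (hasFiniteIntegral_iff_ofReal hg₀).2 (hfatou.trans_lt ENNReal.ofReal_lt_top)⟩, ?_⟩
  rw [integral_eq_lintegral_of_nonneg_ae hg₀ hg]
  exact ENNReal.toReal_le_of_le_ofReal hC hfatou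

lemma integrable_and_integral_le_of_tendsto {X : Type*} [MeasurableSpace X] {μ : Measure X}
    {f : ℕ → X → ℝ} {g h : X → ℝ} {c : ℕ → ℝ} {C : ℝ}
    (hf : ∀ᶠ n in atTop, Integrable (f n) μ) (hh : Integrable h μ)
    (hlow : ∀ᶠ n in atTop, ∀ᵐ x ∂μ, -h x ≤ f n x)
    (hlim : ∀ᵐ x ∂μ, Tendsto (fun n => f n x) atTop (𝓝 (g x)))
    (hc : ∀ᶠ n in atTop, ∫ x, f n x ∂μ ≤ c n) (hcC : Tendsto c atTop (𝓝 C)) :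
    Integrable g μ ∧ ∫ x, g x ∂μ ≤ C := by
  obtain ⟨m, hm⟩ := eventually_atTop.1 (hf.and (hlow.and hc))
  have hshift (n : ℕ) := hm (n + m) (Nat.le_add_left m n)
  obtain ⟨hsum, hle⟩ := integrable_and_integral_le_of_tendsto_of_nonneg
    (f := fun n x => f (n + m) x + h x) (g := fun x => g x + h x)
    (c := fun n => c (n + m) + ∫ x, h x ∂μ) (C := C + ∫ x, h x ∂μ)
    (fun n => (hshift n).1.add hh)
    (fun n => by
      filter_upwards [(hshift n).2.1] with x hx
      simp only [Pi.zero_apply]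
      linarith)
    (by
      filter_upwards [hlim] with x hx
      exact ((tendsto_add_atTop_iff_nat m).2 hx).add_const _)
    (fun n => by
      rw [integral_add (hshift n).1 hh]
      linarith [(hshift n).2.2])
    (((tendsto_add_atTop_iff_nat m).2 hcC).add_const _)
  have hg : Integrable g μ := (hsum.sub hh).congr (Eventually.of_forall fun x => by simp)
  rw [integral_add hg hh] at hle
  exact ⟨hg, by linarith⟩

/-- The Caputo derivative `∂_t^α f (t)`, split as in the equation into the memory of the initial
value and the integral over the past. -/
noncomputable def caputo (α : ℝ) (f : ℝ → ℝ) (t : ℝ) : ℝ :=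
  J α f t + K α 0 t f t

/-- The increment `f t - f (t - τ)` of `f`, extended by `f 0` to negative times. With this
extension `caputo α f t` is a single integral over `τ > 0`, in which `J` is the part `τ > t`. -/
def increment (f : ℝ → ℝ) (t τ : ℝ) : ℝ :=
  f t - f (max (t - τ) 0)

lemma increment_sub (f g : ℝ → ℝ) (t τ : ℝ) :
    increment (fun s => f s - g s) t τ = increment f t τ - increment g t τ := by
  simp only [increment]
  ring

lemma J_neg (α : ℝ) (f : ℝ → ℝ) (t : ℝ) : J α (fun s => -f s) t = -J α f t := by
  simp only [J]
  ring

lemma J_sub (α : ℝ) (f g : ℝ → ℝ) (t : ℝ) :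
    J α (fun s => f s - g s) t = J α f t - J α g t := by
  simp only [J]
  ring

lemma K_neg (α a b : ℝ) (f : ℝ → ℝ) (t : ℝ) : K α a b (fun s => -f s) t = -K α a b f t := by
  simp only [K]
  rw [← mul_neg, ← intervalIntegral.integral_neg]
  congr 2
  ext τ
  ring

lemma K_sub {α a b t : ℝ} {f g : ℝ → ℝ} (hf : KExists α a b f t) (hg : KExists α a b g t) :
    K α a b (fun s => f s - g s) t = K α a b f t - K α a b g t := by
  simp only [K]
  rw [← mul_sub, ← intervalIntegral.integral_sub hf hg]
  congr 2
  ext τ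
  ring

lemma caputo_neg (α : ℝ) (f : ℝ → ℝ) (t : ℝ) : caputo α (fun s => -f s) t = -caputo α f t := by
  rw [caputo, J_neg, K_neg, caputo, neg_add]

lemma integrableOn_Ioc_rpow_neg {α t : ℝ} (hα : α < 1) (ht : 0 ≤ t) :
    IntegrableOn (fun τ : ℝ => τ ^ (-α)) (Ioc 0 t) := by
  rw [← intervalIntegrable_iff_integrableOn_Ioc_of_le ht]
  exact intervalIntegral.intervalIntegrable_rpow' (by linarith)

lemma integrableOn_Ioi_inv_rpow {α t : ℝ} (hα : 0 < α) (ht : 0 < t) :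
    IntegrableOn (fun τ : ℝ => (τ ^ (α + 1))⁻¹) (Ioi t) :=
  (integrableOn_Ioi_rpow_of_lt (by linarith : -(α + 1) < -1) ht).congr_fun
    (fun τ hτ => Real.rpow_neg (ht.trans hτ).le _) measurableSet_Ioi

lemma integral_Ioi_inv_rpow {α t : ℝ} (hα : 0 < α) (ht : 0 < t) :
    ∫ τ in Ioi t, (τ ^ (α + 1))⁻¹ = (α * t ^ α)⁻¹ := by
  rw [setIntegral_congr_fun measurableSet_Ioi
      fun τ hτ => (Real.rpow_neg (ht.trans hτ).le (α + 1)).symm,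
    integral_Ioi_rpow_of_lt (by linarith) ht, show -(α + 1) + 1 = -α by ring,
    Real.rpow_neg ht.le, neg_div_neg_eq, mul_inv, div_eq_inv_mul]

lemma mul_div_rpow_add_one {α τ : ℝ} (hτ : 0 < τ) (c : ℝ) :
    c * τ / τ ^ (α + 1) = c * τ ^ (-α) := by
  rw [Real.rpow_add hτ, Real.rpow_one, Real.rpow_neg hτ.le]
  field_simp

lemma increment_of_le {f : ℝ → ℝ} {t τ : ℝ} (h : τ ≤ t) :
    increment f t τ = f t - f (t - τ) := by
  rw [increment, max_eq_left (by linarith)]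

lemma increment_of_ge {f : ℝ → ℝ} {t τ : ℝ} (h : t ≤ τ) : increment f t τ = f t - f 0 := by
  rw [increment, max_eq_right (by linarith)]

section HalfLine

variable {α t : ℝ} {f : ℝ → ℝ}

lemma integrableOn_Ioc_increment_iff (ht : 0 ≤ t) :
    IntegrableOn (fun τ => increment f t τ / τ ^ (α + 1)) (Ioc 0 t) ↔ KExists α 0 t f t := by
  rw [KExists, intervalIntegrable_iff_integrableOn_Ioc_of_le ht]
  exact integrableOn_congr_fun (fun τ hτ => by simp only [increment_of_le hτ.2]) measurableSet_Ioc

lemma integrableOn_Ioi_increment (hα : 0 < α) (ht : 0 < t) :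
    IntegrableOn (fun τ => increment f t τ / τ ^ (α + 1)) (Ioi t) :=
  IntegrableOn.congr_fun ((integrableOn_Ioi_inv_rpow hα ht).const_mul (f t - f 0))
    (fun τ hτ => by simp only [increment_of_ge (mem_Ioi.1 hτ).le, div_eq_mul_inv])
    measurableSet_Ioi

lemma integrableOn_increment_iff (hα : 0 < α) (ht : 0 < t) :
    IntegrableOn (fun τ => increment f t τ / τ ^ (α + 1)) (Ioi 0) ↔ KExists α 0 t f t := by
  rw [← Ioc_union_Ioi_eq_Ioi ht.le, integrableOn_union, integrableOn_Ioc_increment_iff ht.le]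
  exact and_iff_left (integrableOn_Ioi_increment hα ht)

lemma caputo_eq_integral_increment (hα : 0 < α) (ht : 0 < t) (hf : KExists α 0 t f t) :
    caputo α f t =
      α / Real.Gamma (1 - α) * ∫ τ in Ioi 0, increment f t τ / τ ^ (α + 1) := by
  have hpast : ∫ τ in Ioc 0 t, increment f t τ / τ ^ (α + 1) =
      ∫ τ in 0..t, (f t - f (t - τ)) / τ ^ (α + 1) := by
    rw [intervalIntegral.integral_of_le ht.le]
    exact setIntegral_congr_fun measurableSet_Ioc fun τ hτ => by simp only [increment_of_le hτ.2]
  have hinitial : ∫ τ in Ioi t, increment f t τ / τ ^ (α + 1) = (f t - f 0) / (α * t ^ α) := by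
    rw [div_eq_mul_inv, ← integral_Ioi_inv_rpow hα ht, ← integral_const_mul]
    exact setIntegral_congr_fun measurableSet_Ioi fun τ hτ => by
      simp only [increment_of_ge (mem_Ioi.1 hτ).le, div_eq_mul_inv]
  rw [← Ioc_union_Ioi_eq_Ioi ht.le, setIntegral_union Ioc_disjoint_Ioi_same measurableSet_Ioi
    ((integrableOn_Ioc_increment_iff ht.le).2 hf) (integrableOn_Ioi_increment hα ht), hpast,
    hinitial, caputo, J, K, mul_add, add_comm]
  congr 1
  rw [div_mul_div_comm, mul_comm (t ^ α), mul_left_comm, mul_div_mul_left _ _ hα.ne']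

lemma integrableOn_min_one_div_rpow (hα : α ∈ Ioo (0 : ℝ) 1) :
    IntegrableOn (fun τ : ℝ => min τ 1 / τ ^ (α + 1)) (Ioi 0) := by
  rw [← Ioc_union_Ioi_eq_Ioi zero_le_one, integrableOn_union]
  constructor
  · refine (integrableOn_Ioc_rpow_neg hα.2 zero_le_one).congr_fun (fun τ hτ => ?_)
      measurableSet_Ioc
    simpa [min_eq_left hτ.2] using (mul_div_rpow_add_one (α := α) hτ.1 1).symm
  · refine (integrableOn_Ioi_inv_rpow hα.1 one_pos).congr_fun (fun τ hτ => ?_) measurableSet_Ioi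
    rw [min_eq_right (mem_Ioi.1 hτ).le, one_div]

lemma caputo_le_of_tendsto_increment (hα : α ∈ Ioo (0 : ℝ) 1) (ht : 0 < t) {d : ℕ → ℝ → ℝ}
    {B C : ℝ} {c : ℕ → ℝ}
    (hd : ∀ᶠ n in atTop, IntegrableOn (fun τ => d n τ / τ ^ (α + 1)) (Ioi 0))
    (hlow : ∀ᶠ n in atTop, ∀ τ > 0, -(B * min τ 1) ≤ d n τ)
    (hlim : ∀ τ > 0, Tendsto (fun n => d n τ) atTop (𝓝 (increment f t τ)))
    (hc : ∀ᶠ n in atTop,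
      α / Real.Gamma (1 - α) * ∫ τ in Ioi 0, d n τ / τ ^ (α + 1) ≤ c n)
    (hcC : Tendsto c atTop (𝓝 C)) :
    KExists α 0 t f t ∧ caputo α f t ≤ C := by
  have hq : 0 < α / Real.Gamma (1 - α) :=
    div_pos hα.1 (Real.Gamma_pos_of_pos (by linarith [hα.2]))
  obtain ⟨hint, hle⟩ := integrable_and_integral_le_of_tendsto (μ := volume.restrict (Ioi 0))
    (g := fun τ => increment f t τ / τ ^ (α + 1))
    (c := fun n => c n / (α / Real.Gamma (1 - α))) hd
    ((integrableOn_min_one_div_rpow hα).const_mul B)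
    (by
      filter_upwards [hlow] with n hn
      refine (ae_restrict_iff' measurableSet_Ioi).2 (Eventually.of_forall fun τ hτ => ?_)
      rw [← mul_div_assoc, ← neg_div]
      exact div_le_div_of_nonneg_right (hn τ hτ) (Real.rpow_nonneg (mem_Ioi.1 hτ).le _))
    ((ae_restrict_iff' measurableSet_Ioi).2
      (Eventually.of_forall fun τ hτ => (hlim τ hτ).div_const _))
    (by
      filter_upwards [hc] with n hn
      exact (le_div_iff₀' hq).2 hn)
    (hcC.div_const _)
  have hf := (integrableOn_increment_iff hα.1 ht).1 hint
  exact ⟨hf, (caputo_eq_integral_increment hα.1 ht hf).trans_le ((le_div_iff₀' hq).1 hle)⟩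

lemma kExists_of_abs_sub_le {C : ℝ} (hα : α < 1) (ht : 0 ≤ t) (hf : ContinuousOn f (Icc 0 t))
    (hC : ∀ τ ∈ Icc 0 t, |f t - f (t - τ)| ≤ C * τ) : KExists α 0 t f t := by
  rw [KExists, intervalIntegrable_iff_integrableOn_Ioc_of_le ht]
  refine Integrable.mono' ((integrableOn_Ioc_rpow_neg hα ht).const_mul C) ?_ ?_
  · refine ContinuousOn.aestronglyMeasurable (ContinuousOn.div ?_ ?_ ?_) measurableSet_Ioc
    · exact continuousOn_const.sub (hf.comp (by fun_prop) fun τ hτ =>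
        ⟨by linarith [hτ.2], by linarith [hτ.1]⟩)
    · exact continuousOn_id.rpow_const fun τ hτ => Or.inl hτ.1.ne'
    · exact fun τ hτ => (Real.rpow_pos_of_pos hτ.1 _).ne'
  · refine (ae_restrict_iff' measurableSet_Ioc).2 (Eventually.of_forall fun τ hτ => ?_)
    rw [Real.norm_eq_abs, abs_div, abs_of_pos (Real.rpow_pos_of_pos hτ.1 _),
      ← mul_div_rpow_add_one hτ.1]
    exact div_le_div_of_nonneg_right (hC τ ⟨hτ.1.le, hτ.2⟩) (Real.rpow_pos_of_pos hτ.1 _).le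

end HalfLine

lemma exists_abs_sub_le_mul {T t : ℝ} (ht : t ∈ Ioc 0 T) {f : ℝ → ℝ}
    (hf : ContinuousOn f (Icc 0 T)) (hf1 : ContDiffOn ℝ 1 f (Ioc 0 T)) :
    ∃ C, 0 ≤ C ∧ ∀ τ ∈ Icc 0 t, |f t - f (t - τ)| ≤ C * τ := by
  obtain ⟨L, s, hs, hL⟩ := (hf1 t ht).exists_lipschitzOnWith (convex_Ioc 0 T)
  obtain ⟨r, hr, hrs⟩ := Metric.mem_nhdsWithin_iff.1 hs
  obtain ⟨M, hM⟩ := isCompact_Icc.exists_bound_of_continuousOn hf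
  have hM0 : 0 ≤ M := (norm_nonneg _).trans (hM t ⟨ht.1.le, ht.2⟩)
  set ρ := min r t
  have hρ0 : 0 < ρ := lt_min hr ht.1
  have hmem : ∀ τ, 0 ≤ τ → τ < ρ → t - τ ∈ s := fun τ h0 h1 => by
    refine hrs ⟨?_, ?_, by linarith [ht.2]⟩
    · rw [Metric.mem_ball, Real.dist_eq, show t - τ - t = -τ by ring, abs_neg, abs_of_nonneg h0]
      exact h1.trans_le (min_le_left _ _)
    · linarith [min_le_right r t]
  refine ⟨L + 2 * M / ρ, by positivity, fun τ hτ => ?_⟩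
  rcases lt_or_ge τ ρ with hnear | hfar
  · have hlip := hL.dist_le_mul t (by simpa using hmem 0 le_rfl hρ0) (t - τ) (hmem τ hτ.1 hnear)
    rw [Real.dist_eq, Real.dist_eq, show t - (t - τ) = τ by ring, abs_of_nonneg hτ.1] at hlip
    have : 0 ≤ 2 * M / ρ * τ := by have := hτ.1; positivity
    linarith
  · have hft := hM t ⟨ht.1.le, ht.2⟩
    have hfs := hM (t - τ) ⟨by linarith [hτ.2], by linarith [hτ.1, ht.2]⟩
    rw [Real.norm_eq_abs] at hft hfs
    have hbound : 2 * M ≤ 2 * M / ρ * τ := by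
      rw [div_mul_eq_mul_div, le_div_iff₀ hρ0]
      exact mul_le_mul_of_nonneg_left hfar (by linarith)
    have : 0 ≤ (L : ℝ) * τ := mul_nonneg L.2 hτ.1
    linarith [abs_sub (f t) (f (t - τ))]

section Gradient

variable {E : Type*} [NormedAddCommGroup E] [InnerProductSpace ℝ E] [CompleteSpace E]
  {f g : E → ℝ} {a b x : E}

lemma gradient_fun_neg (f : E → ℝ) (x : E) : gradient (fun y => -f y) x = -gradient f x := by
  rw [gradient, fderiv_fun_neg, map_neg, gradient]

lemma hasGradientAt_add (hf : HasGradientAt f a x) (hg : HasGradientAt g b x) :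
    HasGradientAt (fun z => f z + g z) (a + b) x := by
  rw [hasGradientAt_iff_hasFDerivAt] at *
  rw [map_add]
  exact hf.add hg

lemma hasGradientAt_const_mul (c : ℝ) (hf : HasGradientAt f a x) :
    HasGradientAt (fun z => c * f z) (c • a) x := by
  rw [hasGradientAt_iff_hasFDerivAt] at *
  rw [map_smul]
  exact hf.const_mul c

lemma hasGradientAt_norm_sub_sq (c x : E) :
    HasGradientAt (fun z => ‖z - c‖ ^ 2) ((2 : ℝ) • (x - c)) x := by
  rw [hasGradientAt_iff_hasFDerivAt]
  refine ((hasFDerivAt_id x).sub_const c).norm_sq.congr_fderiv ?_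
  ext v
  simp

end Gradient

/-! ### Replacing a test function by the solution in the Caputo derivative -/

lemma exists_sub_mul_sq_le {E Y : Type*} [NormedAddCommGroup E] [ProperSpace E]
    [PseudoMetricSpace Y] {S : Set Y} (hS : IsCompact S) {D : E → Y → ℝ} {B η : ℝ} {x₁ : E}
    (hD : ContinuousOn (Function.uncurry D) (univ ×ˢ S)) (hB : ∀ x, ∀ t ∈ S, D x t ≤ B)
    (hη : 0 < η) :
    ∃ A, 0 ≤ A ∧ ∀ x, ∀ t ∈ S, D x t - A * ‖x - x₁‖ ^ 2 ≤ D x₁ t + η := by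
  have hcomp := (isCompact_closedBall x₁ 1).prod hS
  have hD' := hD.mono (prod_mono (subset_univ (Metric.closedBall x₁ 1)) Subset.rfl)
  obtain ⟨r, hr, hrD⟩ := Metric.uniformContinuousOn_iff.1
    (hcomp.uniformContinuousOn_of_continuous hD') η hη
  obtain ⟨M, hM⟩ := hcomp.exists_bound_of_continuousOn hD'
  set ρ := min r 1
  have : 0 < ρ := lt_min hr one_pos
  have hx₁ : x₁ ∈ Metric.closedBall x₁ 1 := Metric.mem_closedBall_self zero_le_one
  refine ⟨(|B| + |M|) / ρ ^ 2, by positivity, fun x t ht => ?_⟩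
  rcases lt_or_ge ‖x - x₁‖ ρ with hnear | hfar
  · have hclose := hrD (x, t) ⟨by
      rw [Metric.mem_closedBall, dist_eq_norm]; exact hnear.le.trans (min_le_right _ _), ht⟩
      (x₁, t) ⟨hx₁, ht⟩ (by
        rw [Prod.dist_eq, dist_self, dist_eq_norm, max_eq_left (norm_nonneg _)]
        exact hnear.trans_le (min_le_left _ _))
    rw [Real.dist_eq] at hclose
    have : 0 ≤ (|B| + |M|) / ρ ^ 2 * ‖x - x₁‖ ^ 2 := by positivity
    linarith [(abs_lt.1 hclose).2, show Function.uncurry D (x, t) = D x t from rfl,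
      show Function.uncurry D (x₁, t) = D x₁ t from rfl]
  · have hpen : |B| + |M| ≤ (|B| + |M|) / ρ ^ 2 * ‖x - x₁‖ ^ 2 := by
      rw [div_mul_eq_mul_div, le_div_iff₀ (by positivity)]
      gcongr
    have hlow : -M ≤ D x₁ t := (abs_le.1 (hM (x₁, t) ⟨hx₁, ht⟩)).1
    linarith [hB x t ht, le_abs_self B, le_abs_self M]

/-- A bounded approximation of the indicator of `s ≠ 0` that vanishes to second order at `0`. -/
noncomputable def notch (η s : ℝ) : ℝ :=
  s ^ 2 / (s ^ 2 + η)

lemma notch_zero (η : ℝ) : notch η 0 = 0 := by simp [notch]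

lemma notch_nonneg {η : ℝ} (hη : 0 ≤ η) (s : ℝ) : 0 ≤ notch η s := by
  unfold notch; positivity

lemma notch_le_one {η : ℝ} (hη : 0 ≤ η) (s : ℝ) : notch η s ≤ 1 :=
  div_le_one_of_le₀ (by linarith) (by positivity)

lemma notch_mul_le {η : ℝ} (hη : 0 < η) (s : ℝ) : notch η s * η ≤ s ^ 2 := by
  rw [notch, div_mul_eq_mul_div, div_le_iff₀ (by positivity)]
  nlinarith [sq_nonneg (s ^ 2)]

lemma contDiff_notch {η : ℝ} (hη : 0 < η) {n : WithTop ℕ∞} : ContDiff ℝ n (notch η) :=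
  (contDiff_id.pow 2).div ((contDiff_id.pow 2).add contDiff_const) fun s => by positivity

lemma tendsto_notch {ι : Type*} {l : Filter ι} {η : ι → ℝ} (hη : Tendsto η l (𝓝 0)) {s : ℝ}
    (hs : s ≠ 0) : Tendsto (fun k => notch (η k) s) l (𝓝 1) := by
  have hlim : Tendsto (fun k => s ^ 2 / (s ^ 2 + η k)) l (𝓝 (s ^ 2 / (s ^ 2 + 0))) :=
    tendsto_const_nhds.div (tendsto_const_nhds.add hη) (by positivity)
  rwa [add_zero, div_self (pow_ne_zero 2 hs)] at hlim

lemma exists_contDiff_approx {T t₁ : ℝ} {f : ℝ → ℝ} (hf : ContinuousOn f (Icc 0 T))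
    (hf₀ : ∀ t ∈ Icc 0 T, f t ≤ 0) :
    ∃ h : ℕ → ℝ → ℝ, (∀ k, ContDiff ℝ 1 (h k)) ∧ (∀ k, h k t₁ = 0) ∧
      (∀ t ∈ Icc 0 T, t ≠ t₁ → Tendsto (fun k => h k t) atTop (𝓝 (f t))) ∧
      ∀ k, (∀ t ∈ Icc 0 T, h k t ≤ 3 * (t - t₁) ^ 2) ∧
        ∃ η > 0, ∀ t ∈ Icc 0 T, min (f t + η) 0 ≤ h k t := by
  set η : ℕ → ℝ := fun k => 1 / ((k : ℝ) + 1)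
  have hη (k : ℕ) : 0 < η k := Nat.one_div_pos_of_nat
  have hη₀ : Tendsto η atTop (𝓝 0) := tendsto_one_div_add_atTop_nhds_zero_nat
  choose p hp using fun k => exists_polynomial_near_of_continuousOn 0 T (fun t => f t + 2 * η k)
    (hf.add continuousOn_const) (η k) (hη k)
  have hlow (k : ℕ) (t : ℝ) (ht : t ∈ Icc 0 T) : f t + η k ≤ (p k).eval t := by
    linarith [(abs_lt.1 (hp k t ht)).1]
  have hup (k : ℕ) (t : ℝ) (ht : t ∈ Icc 0 T) : (p k).eval t ≤ f t + 3 * η k := by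
    linarith [(abs_lt.1 (hp k t ht)).2]
  refine ⟨fun k t => notch (η k) (t - t₁) * (p k).eval t, fun k => ?_, fun k => ?_,
    fun t ht htt => ?_, fun k => ⟨fun t ht => ?_, η k, hη k, fun t ht => ?_⟩⟩
  · exact ((contDiff_notch (hη k)).comp (contDiff_id.sub contDiff_const)).mul
      ((p k).contDiff_aeval 1)
  · simp only [sub_self, notch_zero, zero_mul]
  · have hpt : Tendsto (fun k => (p k).eval t) atTop (𝓝 (f t)) :=
      tendsto_of_tendsto_of_tendsto_of_le_of_le (by simpa using hη₀.const_add (f t))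
        (by simpa using (hη₀.const_mul 3).const_add (f t)) (fun k => hlow k t ht)
        fun k => hup k t ht
    simpa using (tendsto_notch hη₀ (sub_ne_zero.2 htt)).mul hpt
  · calc notch (η k) (t - t₁) * (p k).eval t ≤ notch (η k) (t - t₁) * (3 * η k) := by
          gcongr
          · exact notch_nonneg (hη k).le _
          · linarith [hup k t ht, hf₀ t ht]
      _ ≤ 3 * (t - t₁) ^ 2 := by linarith [notch_mul_le (hη k) (t - t₁)]
  · have hmin : min (f t + η k) 0 ≤ (p k).eval t := (min_le_left _ _).trans (hlow k t ht)
    have hscale := mul_le_mul_of_nonneg_left hmin (notch_nonneg (hη k).le (t - t₁))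
    nlinarith [mul_le_mul_of_nonpos_right (notch_le_one (hη k).le (t - t₁))
      (min_le_right (f t + η k) 0)]

/-- The test function clause of `IsSubsolution`, without semicontinuity and initial condition. -/
def TestsSub {N : ℕ} (α T : ℝ) (F : Space N → Space N → ℝ) (u : Space N → ℝ → ℝ) : Prop :=
  ∀ φ : Space N → ℝ → ℝ, IsTest T φ → ∀ x₁ : Space N, ∀ t₁ ∈ Ioc 0 T,
    (∀ x, ∀ t ∈ Icc 0 T, u x t - φ x t ≤ u x₁ t₁ - φ x₁ t₁) →
      caputo α (φ x₁) t₁ + F x₁ (gradient (fun x => φ x t₁) x₁) ≤ 0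

/-- The test function clause of `IsSupersolution`. -/
def TestsSuper {N : ℕ} (α T : ℝ) (F : Space N → Space N → ℝ) (u : Space N → ℝ → ℝ) : Prop :=
  ∀ φ : Space N → ℝ → ℝ, IsTest T φ → ∀ x₁ : Space N, ∀ t₁ ∈ Ioc 0 T,
    (∀ x, ∀ t ∈ Icc 0 T, u x₁ t₁ - φ x₁ t₁ ≤ u x t - φ x t) →
      0 ≤ caputo α (φ x₁) t₁ + F x₁ (gradient (fun x => φ x t₁) x₁)

section Tests

variable {N : ℕ} {α T : ℝ} {F : Space N → Space N → ℝ} {u : Space N → ℝ → ℝ}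

lemma TestsSuper.neg (hu : TestsSuper α T F u) :
    TestsSub α T (fun x p => -F x (-p)) (fun x t => -u x t) := by
  intro φ hφ x₁ t₁ ht₁ hmax
  have h := hu (fun x t => -φ x t) ⟨hφ.1.neg, hφ.2.neg⟩ x₁ t₁ ht₁
    fun x t ht => by linarith [hmax x t ht]
  rw [caputo_neg, gradient_fun_neg (fun x => φ x t₁)] at h
  linarith

lemma isTest_add {ξ : Space N → ℝ} {γ : ℝ → ℝ} (hξ : ContDiff ℝ 1 ξ)
    (hγ : ContinuousOn γ (Icc 0 T)) (hγ₁ : ContDiffOn ℝ 1 γ (Ioc 0 T)) :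
    IsTest T (fun x t => ξ x + γ t) :=
  ⟨(hξ.comp contDiff_fst).contDiffOn.add (hγ₁.comp contDiff_snd.contDiffOn fun _ hz => hz.2),
    (hξ.continuous.comp continuous_fst).continuousOn.add
      (hγ.comp continuous_snd.continuousOn fun _ hz => hz.2)⟩

lemma caputo_const_add (α c : ℝ) (f : ℝ → ℝ) (t : ℝ) :
    caputo α (fun s => c + f s) t = caputo α f t := by
  simp only [caputo, J, K, add_sub_add_left_eq_sub]

lemma TestsSub.caputo_add_le (hu : TestsSub α T F u)
    (hcont : ContinuousOn (Function.uncurry u) (univ ×ˢ Icc 0 T))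
    {ξ : Space N → ℝ} (hξ : ContDiff ℝ 1 ξ) {γ : ℝ → ℝ} (hγ : ContinuousOn γ (Icc 0 T))
    (hγ₁ : ContDiffOn ℝ 1 γ (Ioc 0 T)) {x₁ : Space N} {t₁ : ℝ} (ht₁ : t₁ ∈ Ioc 0 T)
    (hmax : ∀ x, ∀ t ∈ Icc 0 T, u x t - ξ x - γ t ≤ u x₁ t₁ - ξ x₁ - γ t₁)
    {h : ℝ → ℝ} (hh : ContDiff ℝ 1 h) (hh₁ : h t₁ = 0) {η : ℝ} (hη : 0 < η)
    (hlow : ∀ t ∈ Icc 0 T, min (u x₁ t - ξ x₁ - γ t - (u x₁ t₁ - ξ x₁ - γ t₁) + η) 0 ≤ h t) :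
    caputo α (fun t => γ t + h t) t₁ + F x₁ (gradient ξ x₁) ≤ 0 := by
  obtain ⟨M, hM⟩ := isCompact_Icc.exists_bound_of_continuousOn hγ
  obtain ⟨A, hA, hpen⟩ := exists_sub_mul_sq_le (x₁ := x₁) isCompact_Icc
    (D := fun x t => u x t - ξ x) (B := u x₁ t₁ - ξ x₁ - γ t₁ + M)
    (hcont.sub (hξ.continuous.comp continuous_fst).continuousOn)
    (fun x t ht => by linarith [hmax x t ht, (abs_le.1 (hM t ht)).2]) hη
  have hgrad : gradient (fun x => ξ x + A * ‖x - x₁‖ ^ 2 + (γ t₁ + h t₁)) x₁ =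
      gradient ξ x₁ := by
    simpa using (hasGradientAt_add (hasGradientAt_add
      ((hξ.differentiable one_ne_zero) x₁).hasGradientAt
      (hasGradientAt_const_mul A (hasGradientAt_norm_sub_sq x₁ x₁)))
      (hasGradientAt_const x₁ (γ t₁ + h t₁))).gradient
  have htest := hu (fun x t => ξ x + A * ‖x - x₁‖ ^ 2 + (γ t + h t))
    (isTest_add (hξ.add (contDiff_const.mul ((contDiff_id.sub contDiff_const).norm_sq ℝ)))
      (hγ.add hh.continuous.continuousOn) (hγ₁.add hh.contDiffOn)) x₁ t₁ ht₁ ?_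
  · rwa [caputo_const_add, hgrad] at htest
  · intro x t ht
    have hpos : 0 ≤ A * ‖x - x₁‖ ^ 2 := by positivity
    have hle := (le_min (by linarith [hpen x t ht]) (by linarith [hmax x t ht])).trans (hlow t ht)
      (a := u x t - ξ x - A * ‖x - x₁‖ ^ 2 - γ t - (u x₁ t₁ - ξ x₁ - γ t₁))
    simp only [sub_self, norm_zero, hh₁]
    linarith

lemma neg_mul_min_le_increment {C t τ : ℝ} {f : ℝ → ℝ} (hC : 0 ≤ C)
    (hf : ∀ s ∈ Icc 0 t, -(C * (t - s)) ≤ f t - f s) (hτ : 0 < τ) (ht : 0 ≤ t) :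
    -(C * max 1 t * min τ 1) ≤ increment f t τ := by
  have hlag : t - max (t - τ) 0 ≤ max 1 t * min τ 1 := by
    rcases le_total τ 1 with h | h
    · rw [min_eq_left h]
      nlinarith [le_max_left 1 t, le_max_left (t - τ) 0]
    · rw [min_eq_right h, mul_one]
      linarith [le_max_right 1 t, le_max_right (t - τ) 0]
  have hinc := hf (max (t - τ) 0) ⟨le_max_right _ _, max_le (by linarith) ht⟩
  rw [increment, mul_assoc]
  linarith [mul_le_mul_of_nonneg_left hlag hC]

lemma TestsSub.caputo_le (hu : TestsSub α T F u) (hα : α ∈ Ioo (0 : ℝ) 1)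
    (hcont : ContinuousOn (Function.uncurry u) (univ ×ˢ Icc 0 T))
    {ξ : Space N → ℝ} (hξ : ContDiff ℝ 1 ξ) {γ : ℝ → ℝ} (hγ : ContinuousOn γ (Icc 0 T))
    (hγ₁ : ContDiffOn ℝ 1 γ (Ioc 0 T)) {x₁ : Space N} {t₁ : ℝ} (ht₁ : t₁ ∈ Ioc 0 T)
    (hmax : ∀ x, ∀ t ∈ Icc 0 T, u x t - ξ x - γ t ≤ u x₁ t₁ - ξ x₁ - γ t₁) :
    KExists α 0 t₁ (u x₁) t₁ ∧ caputo α (u x₁) t₁ ≤ -F x₁ (gradient ξ x₁) := by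
  have hux : ContinuousOn (u x₁) (Icc 0 T) :=
    hcont.comp (f := fun t => (x₁, t)) (by fun_prop) fun t ht => ⟨mem_univ _, ht⟩
  obtain ⟨h, hh, hh₁, hlim, hbd⟩ := exists_contDiff_approx (t₁ := t₁)
    (f := fun t => u x₁ t - ξ x₁ - γ t - (u x₁ t₁ - ξ x₁ - γ t₁))
    (((hux.sub continuousOn_const).sub hγ).sub continuousOn_const)
    fun t ht => by linarith [hmax x₁ t ht]
  obtain ⟨C, hC₀, hC⟩ := exists_abs_sub_le_mul ht₁ hγ hγ₁
  have hsub (k : ℕ) : caputo α (fun t => γ t + h k t) t₁ ≤ -F x₁ (gradient ξ x₁) := by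
    obtain ⟨η, hη, hlow⟩ := (hbd k).2
    linarith [hu.caputo_add_le hcont hξ hγ hγ₁ ht₁ hmax (hh k) (hh₁ k) hη hlow]
  have hexists (k : ℕ) : KExists α 0 t₁ (fun t => γ t + h k t) t₁ := by
    have hcont' := hγ.add (hh k).continuous.continuousOn
    obtain ⟨C', -, hC'⟩ := exists_abs_sub_le_mul ht₁ hcont' (hγ₁.add (hh k).contDiffOn)
    exact kExists_of_abs_sub_le hα.2 ht₁.1.le (hcont'.mono (Icc_subset_Icc_right ht₁.2)) hC'
  have hmem (τ : ℝ) (hτ : 0 < τ) : max (t₁ - τ) 0 ∈ Icc 0 T :=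
    ⟨le_max_right _ _, max_le (by linarith [ht₁.2]) (ht₁.1.le.trans ht₁.2)⟩
  refine caputo_le_of_tendsto_increment hα ht₁.1 (d := fun k => increment (fun t => γ t + h k t) t₁)
    (B := (C + 3 * t₁) * max 1 t₁)
    (Eventually.of_forall fun k => (integrableOn_increment_iff hα.1 ht₁.1).2 (hexists k))
    (Eventually.of_forall fun k τ hτ => ?_) (fun τ hτ => ?_)
    (Eventually.of_forall fun k =>
      (caputo_eq_integral_increment hα.1 ht₁.1 (hexists k)).symm.trans_le (hsub k))
    tendsto_const_nhds
  · refine neg_mul_min_le_increment (by linarith [ht₁.1]) (fun s hs => ?_) hτ ht₁.1.le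
    have hγs := (abs_le.1 (hC (t₁ - s) ⟨by linarith [hs.2], by linarith [hs.1]⟩)).1
    have hhs := (hbd k).1 s ⟨hs.1, hs.2.trans ht₁.2⟩
    rw [sub_sub_cancel] at hγs
    nlinarith [hh₁ k, hs.1, hs.2]
  · have hne : max (t₁ - τ) 0 ≠ t₁ := (max_lt (by linarith) ht₁.1).ne
    simp only [increment, hh₁]
    convert (hlim _ (hmem τ hτ) hne).const_sub (γ t₁ - γ (max (t₁ - τ) 0)) using 2 <;> ring

end Tests

/-! ### Doubling of variables -/

lemma exists_isMaxOn_of_superlevel_subset {X : Type*} [TopologicalSpace X] {s S : Set X}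
    {f : X → ℝ} {x₀ : X} (hS : IsCompact S) (hf : ContinuousOn f S) (hx₀ : x₀ ∈ s)
    (h : ∀ x ∈ s, f x₀ ≤ f x → x ∈ S) : ∃ x ∈ S, IsMaxOn f s x := by
  obtain ⟨x, hx, hmax⟩ := hS.exists_isMaxOn ⟨x₀, h x₀ hx₀ le_rfl⟩ hf
  refine ⟨x, hx, isMaxOn_iff.2 fun y hy => ?_⟩
  rcases le_total (f x₀) (f y) with hle | hle
  · exact isMaxOn_iff.1 hmax y (h y hy hle)
  · exact hle.trans (isMaxOn_iff.1 hmax x₀ (h x₀ hx₀ le_rfl))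

/-- Points that almost maximize `A - n B` over a compact set concentrate, as `n → ∞`, at the only
maximum point of `A` on the zero set of `B`. -/
lemma tendsto_of_penalized {X : Type*} [TopologicalSpace X] {S : Set X} (hS : IsCompact S)
    {A B : X → ℝ} (hA : ContinuousOn A S) (hB : ContinuousOn B S) (hB₀ : ∀ ξ ∈ S, 0 ≤ B ξ)
    {ξ₀ : X} (huniq : ∀ ξ ∈ S, B ξ = 0 → A ξ₀ ≤ A ξ → ξ = ξ₀)
    {ξ : ℕ → X} (hξ : ∀ n, ξ n ∈ S) {κ : ℝ}
    (h : ∀ n : ℕ, A ξ₀ - κ * ((n : ℝ) + 1)⁻¹ ≤ A (ξ n) - ((n : ℝ) + 1) * B (ξ n)) :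
    Tendsto ξ atTop (𝓝 ξ₀) := by
  refine hS.tendsto_nhds_of_unique_mapClusterPt (Eventually.of_forall hξ) fun y hy hcl => ?_
  obtain ⟨U, hU, hUy⟩ := mapClusterPt_iff_ultrafilter.1 hcl
  have hUS : Tendsto ξ U (𝓝[S] y) := tendsto_nhdsWithin_iff.2 ⟨hUy, Eventually.of_forall hξ⟩
  have hAy : Tendsto (fun n => A (ξ n)) U (𝓝 (A y)) := (hA y hy).tendsto.comp hUS
  have hBy : Tendsto (fun n => B (ξ n)) U (𝓝 (B y)) := (hB y hy).tendsto.comp hUS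
  have hinv : Tendsto (fun n : ℕ => ((n : ℝ) + 1)⁻¹) U (𝓝 0) :=
    (tendsto_inv_atTop_zero.comp
      (tendsto_natCast_atTop_atTop.atTop_add tendsto_const_nhds)).mono_left hU
  have hAle : A ξ₀ - κ * 0 ≤ A y := by
    refine le_of_tendsto_of_tendsto' (tendsto_const_nhds.sub (hinv.const_mul κ)) hAy fun n => ?_
    have : 0 ≤ ((n : ℝ) + 1) * B (ξ n) := mul_nonneg (by positivity) (hB₀ _ (hξ n))
    linarith [h n]
  have hBle : B y ≤ (A y - A ξ₀ + κ * 0) * 0 := by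
    refine le_of_tendsto_of_tendsto' hBy
      (((hAy.sub_const (A ξ₀)).add (hinv.const_mul κ)).mul hinv) fun n => ?_
    rw [← div_eq_mul_inv, le_div_iff₀ (by positivity)]
    linarith [h n]
  exact huniq y hy (le_antisymm (by simpa using hBle) (hB₀ y hy)) (by simpa using hAle)

lemma exists_isMaxOn_tendsto_of_penalized {X : Type*} [PseudoMetricSpace X] [ProperSpace X]
    {Q : Set X} (hQ : IsClosed Q) {A B : X → ℝ} {Ψ : ℕ → X → ℝ} (hA : ContinuousOn A Q)
    (hB : ContinuousOn B Q) (hΨ : ∀ n, ContinuousOn (Ψ n) Q) (hB₀ : ∀ ξ ∈ Q, 0 ≤ B ξ)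
    {ξ₀ : X} (hξ₀ : ξ₀ ∈ Q) {κ : ℝ} (hκ : 0 ≤ κ)
    (hle : ∀ n : ℕ, ∀ ξ ∈ Q, Ψ n ξ ≤ A ξ - ((n : ℝ) + 1) * B ξ)
    (hlow : ∀ n : ℕ, A ξ₀ - κ * ((n : ℝ) + 1)⁻¹ ≤ Ψ n ξ₀)
    (hbdd : Bornology.IsBounded {ξ ∈ Q | A ξ₀ - κ ≤ A ξ - B ξ})
    (huniq : ∀ ξ ∈ Q, B ξ = 0 → A ξ₀ ≤ A ξ → ξ = ξ₀) :
    ∃ ξ : ℕ → X, (∀ n, ξ n ∈ Q ∧ IsMaxOn (Ψ n) Q (ξ n)) ∧ Tendsto ξ atTop (𝓝 ξ₀) := by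
  set S := {ξ ∈ Q | A ξ₀ - κ ≤ A ξ - B ξ}
  have hSQ : S ⊆ Q := fun ξ hξ => hξ.1
  have hS : IsCompact S := Metric.isCompact_of_isClosed_isBounded
    ((hA.sub hB).preimage_isClosed_of_isClosed hQ isClosed_Ici) hbdd
  have hmemS (n : ℕ) (ξ : X) (hξ : ξ ∈ Q) (h : Ψ n ξ₀ ≤ Ψ n ξ) : ξ ∈ S := by
    have hκn : κ * ((n : ℝ) + 1)⁻¹ ≤ κ :=
      mul_le_of_le_one_right hκ (inv_le_one_of_one_le₀ (by linarith [n.cast_nonneg (α := ℝ)]))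
    have hBn : B ξ ≤ ((n : ℝ) + 1) * B ξ :=
      le_mul_of_one_le_left (hB₀ ξ hξ) (by linarith [n.cast_nonneg (α := ℝ)])
    exact ⟨hξ, by linarith [hle n ξ hξ, hlow n]⟩
  choose ξ hξS hmax using fun n =>
    exists_isMaxOn_of_superlevel_subset hS ((hΨ n).mono hSQ) hξ₀ (hmemS n)
  refine ⟨ξ, fun n => ⟨hSQ (hξS n), hmax n⟩, ?_⟩
  exact tendsto_of_penalized hS (hA.mono hSQ) (hB.mono hSQ) (fun ξ hξ => hB₀ ξ hξ.1)
    (fun ξ hξ => huniq ξ hξ.1) hξS fun n =>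
      (hlow n).trans ((isMaxOn_iff.1 (hmax n) ξ₀ hξ₀).trans (hle n (ξ n) (hSQ (hξS n))))

section Doubling

variable {E : Type*} [NormedAddCommGroup E]

/-- A smooth approximation of the distance to `c`. -/
noncomputable def smoothDist (d : ℝ) (c x : E) : ℝ :=
  √(‖x - c‖ ^ 2 + d ^ 2)

lemma norm_sub_le_smoothDist (d : ℝ) (c x : E) : ‖x - c‖ ≤ smoothDist d c x :=
  Real.le_sqrt_of_sq_le (by linarith [sq_nonneg d])

lemma smoothDist_self {d : ℝ} (hd : 0 ≤ d) (c : E) : smoothDist d c c = d := by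
  simp [smoothDist, Real.sqrt_sq hd]

lemma smoothDist_sub_left (d : ℝ) (c x y : E) :
    smoothDist d (x - c) y = smoothDist d (y + c) x := by
  rw [smoothDist, norm_sub_rev, sub_right_comm, sub_sub, smoothDist]

lemma smoothDist_pos {d : ℝ} (hd : 0 < d) (c x : E) : 0 < smoothDist d c x :=
  Real.sqrt_pos.2 (by positivity)

/-- The function `u(x, t) - w(y, t) - V(x) - κ |x - y - (x₀ - y₀)| - a |x - y|² / 2 - b |y|² / 2
- g(t)` of `(x, y, t)` attains its maximum over `t ∈ [0, T]` at `(x₀, y₀, t₀)` with `t₀ > 0`. The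
term with `κ` is the price of an estimate `κ |x - y - (x₀ - y₀)|` for a term of the original
function that has been frozen at the maximum point. -/
structure IsPenalizedMax (T κ a b : ℝ) (u w : E → ℝ → ℝ) (V : E → ℝ) (g : ℝ → ℝ) (x₀ y₀ : E)
    (t₀ : ℝ) : Prop where
  nonneg : 0 ≤ κ ∧ 0 ≤ a ∧ 0 ≤ b
  continuousOn_left : ContinuousOn (Function.uncurry u) (univ ×ˢ Icc 0 T)
  continuousOn_right : ContinuousOn (Function.uncurry w) (univ ×ˢ Icc 0 T)
  continuous_corrector : Continuous V
  continuousOn_time : ContinuousOn g (Icc 0 T)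
  bounded : ∃ M, ∀ x, ∀ t ∈ Icc 0 T, |u x t| ≤ M ∧ |w x t| ≤ M ∧ |V x| ≤ M
  mem_Ioc : t₀ ∈ Ioc 0 T
  le_max : ∀ x y, ∀ t ∈ Icc 0 T,
    u x t - w y t - V x - κ * ‖x - y - (x₀ - y₀)‖ - a / 2 * ‖x - y‖ ^ 2 - b / 2 * ‖y‖ ^ 2 - g t ≤
      u x₀ t₀ - w y₀ t₀ - V x₀ - a / 2 * ‖x₀ - y₀‖ ^ 2 - b / 2 * ‖y₀‖ ^ 2 - g t₀

/-- The function of `((x, t), (y, s), z)` maximized in the doubling of variables argument for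
`IsPenalizedMax`. It separates `x` from the argument `z` of the corrector and the two times, smooths
the term with `κ` and makes the limiting maximum point `((x₀, t₀), (y₀, t₀), x₀)` unique. -/
noncomputable def doubled (κ a b : ℝ) (u w : E → ℝ → ℝ) (V : E → ℝ) (g : ℝ → ℝ) (x₀ y₀ : E)
    (t₀ n : ℝ) (ξ : (E × ℝ) × (E × ℝ) × E) : ℝ :=
  u ξ.1.1 ξ.1.2 - w ξ.2.1.1 ξ.2.1.2 - V ξ.2.2 - κ * smoothDist n⁻¹ (ξ.2.1.1 + (x₀ - y₀)) ξ.1.1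
    - a / 2 * ‖ξ.1.1 - ξ.2.1.1‖ ^ 2 - b / 2 * ‖ξ.2.1.1‖ ^ 2 - g ξ.1.2
    - n / 2 * ‖ξ.1.1 - ξ.2.2‖ ^ 2 - n / 2 * (ξ.1.2 - ξ.2.1.2) ^ 2
    - (‖ξ.1.1 - x₀‖ ^ 2 + ‖ξ.2.1.1 - y₀‖ ^ 2 + (ξ.1.2 - t₀) ^ 2) / 2

/-- The function of `IsPenalizedMax` with the variables of `doubled`, strictly penalized away from
the maximum point. -/
noncomputable def undoubled (κ a b : ℝ) (u w : E → ℝ → ℝ) (V : E → ℝ) (g : ℝ → ℝ) (x₀ y₀ : E)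
    (t₀ : ℝ) (ξ : (E × ℝ) × (E × ℝ) × E) : ℝ :=
  u ξ.1.1 ξ.1.2 - w ξ.2.1.1 ξ.2.1.2 - V ξ.2.2 - κ * ‖ξ.1.1 - ξ.2.1.1 - (x₀ - y₀)‖
    - a / 2 * ‖ξ.1.1 - ξ.2.1.1‖ ^ 2 - b / 2 * ‖ξ.2.1.1‖ ^ 2 - g ξ.1.2
    - (‖ξ.1.1 - x₀‖ ^ 2 + ‖ξ.2.1.1 - y₀‖ ^ 2 + (ξ.1.2 - t₀) ^ 2) / 2

/-- Vanishes where the variables of `doubled` separated from each other coincide. -/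
noncomputable def separation (ξ : (E × ℝ) × (E × ℝ) × E) : ℝ :=
  (‖ξ.1.1 - ξ.2.2‖ ^ 2 + (ξ.1.2 - ξ.2.1.2) ^ 2) / 2

/-- The domain of `doubled`, in which both times lie in `[0, T]`. -/
def doubledDomain (E : Type*) (T : ℝ) : Set ((E × ℝ) × (E × ℝ) × E) :=
  (univ ×ˢ Icc 0 T) ×ˢ (univ ×ˢ Icc 0 T) ×ˢ univ

variable {T κ a b : ℝ} {u w : E → ℝ → ℝ} {V : E → ℝ} {g : ℝ → ℝ} {x₀ y₀ : E} {t₀ : ℝ}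

lemma separation_nonneg (ξ : (E × ℝ) × (E × ℝ) × E) : 0 ≤ separation ξ := by
  unfold separation; positivity

lemma eq_of_separation_eq_zero {x y z : E} {t s : ℝ} (h : separation ((x, t), (y, s), z) = 0) :
    x = z ∧ t = s := by
  simp only [separation] at h
  have hxz := sq_nonneg ‖x - z‖
  have hts := sq_nonneg (t - s)
  exact ⟨sub_eq_zero.1 (norm_eq_zero.1 (pow_eq_zero_iff two_ne_zero |>.1 (by linarith))),
    sub_eq_zero.1 (pow_eq_zero_iff two_ne_zero |>.1 (by linarith))⟩

lemma doubled_le (hκ : 0 ≤ κ) (n : ℝ) (ξ : (E × ℝ) × (E × ℝ) × E) :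
    doubled κ a b u w V g x₀ y₀ t₀ n ξ ≤
      undoubled κ a b u w V g x₀ y₀ t₀ ξ - n * separation ξ := by
  have hdist := mul_le_mul_of_nonneg_left
    (norm_sub_le_smoothDist n⁻¹ (ξ.2.1.1 + (x₀ - y₀)) ξ.1.1) hκ
  rw [← sub_sub] at hdist
  simp only [doubled, undoubled, separation]
  linarith

lemma doubled_self {n : ℝ} (hn : 0 ≤ n) :
    doubled κ a b u w V g x₀ y₀ t₀ n ((x₀, t₀), (y₀, t₀), x₀) =
      undoubled κ a b u w V g x₀ y₀ t₀ ((x₀, t₀), (y₀, t₀), x₀) - κ * n⁻¹ := by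
  simp only [doubled, undoubled, add_sub_cancel, smoothDist_self (inv_nonneg.2 hn), sub_self,
    norm_zero]
  ring

section IsPenalizedMax

variable (h : IsPenalizedMax T κ a b u w V g x₀ y₀ t₀)
include h

lemma IsPenalizedMax.mem_Icc : t₀ ∈ Icc 0 T :=
  Ioc_subset_Icc_self h.mem_Ioc

lemma IsPenalizedMax.continuousOn_undoubled :
    ContinuousOn (undoubled κ a b u w V g x₀ y₀ t₀) (doubledDomain E T) := by
  have hu : ContinuousOn (fun ξ : (E × ℝ) × (E × ℝ) × E => u ξ.1.1 ξ.1.2) (doubledDomain E T) :=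
    h.continuousOn_left.comp continuous_fst.continuousOn fun ξ hξ => hξ.1
  have hw : ContinuousOn (fun ξ : (E × ℝ) × (E × ℝ) × E => w ξ.2.1.1 ξ.2.1.2)
      (doubledDomain E T) :=
    h.continuousOn_right.comp (f := fun ξ : (E × ℝ) × (E × ℝ) × E => ξ.2.1) (by fun_prop)
      fun ξ hξ => hξ.2.1
  have hg : ContinuousOn (fun ξ : (E × ℝ) × (E × ℝ) × E => g ξ.1.2) (doubledDomain E T) :=
    h.continuousOn_time.comp (by fun_prop) fun ξ hξ => hξ.1.2
  have hV : Continuous fun ξ : (E × ℝ) × (E × ℝ) × E => V ξ.2.2 :=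
    h.continuous_corrector.comp (by fun_prop)
  unfold undoubled
  refine ((((((hu.sub hw).sub hV.continuousOn).sub ?_).sub ?_).sub ?_).sub hg).sub ?_ <;> fun_prop

lemma IsPenalizedMax.continuousOn_doubled (n : ℝ) :
    ContinuousOn (doubled κ a b u w V g x₀ y₀ t₀ n) (doubledDomain E T) := by
  have hdist : Continuous fun ξ : (E × ℝ) × (E × ℝ) × E =>
      κ * ‖ξ.1.1 - ξ.2.1.1 - (x₀ - y₀)‖ - κ * smoothDist n⁻¹ (ξ.2.1.1 + (x₀ - y₀)) ξ.1.1
        - n * separation ξ := by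
    unfold smoothDist separation; fun_prop
  refine (h.continuousOn_undoubled.add hdist.continuousOn).congr fun ξ _ => ?_
  simp only [doubled, undoubled, separation, Pi.add_apply]
  ring

lemma IsPenalizedMax.isBounded_superlevel :
    Bornology.IsBounded {ξ ∈ doubledDomain E T |
      undoubled κ a b u w V g x₀ y₀ t₀ ((x₀, t₀), (y₀, t₀), x₀) - κ ≤
        undoubled κ a b u w V g x₀ y₀ t₀ ξ - separation ξ} := by
  obtain ⟨hκ, ha, hb⟩ := h.nonneg
  obtain ⟨M, hM⟩ := h.bounded
  obtain ⟨Mg, hMg⟩ := isCompact_Icc.exists_bound_of_continuousOn h.continuousOn_time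
  set c := 6 * M + 2 * Mg + κ + a / 2 * ‖x₀ - y₀‖ ^ 2 + b / 2 * ‖y₀‖ ^ 2 with hc
  have hball (r : ℝ) : Bornology.IsBounded ((Metric.closedBall x₀ r ×ˢ Icc 0 T) ×ˢ
      (Metric.closedBall y₀ r ×ˢ Icc 0 T) ×ˢ Metric.closedBall x₀ (r + r)) :=
    (Metric.isBounded_closedBall.prod (Metric.isBounded_Icc _ _)).prod
      ((Metric.isBounded_closedBall.prod (Metric.isBounded_Icc _ _)).prod
        Metric.isBounded_closedBall)
  refine (hball √(2 * c)).subset ?_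
  rintro ⟨⟨x, t⟩, ⟨y, s⟩, z⟩ ⟨⟨⟨-, ht⟩, ⟨-, hs⟩, -⟩, hlevel⟩
  simp only [undoubled, separation, sub_self, norm_zero] at hlevel
  have hsum : ‖x - x₀‖ ^ 2 + ‖y - y₀‖ ^ 2 + ‖x - z‖ ^ 2 ≤ 2 * c := by
    have hu := abs_le.1 (hM x t ht).1
    have hw := abs_le.1 (hM y s hs).2.1
    have hV := abs_le.1 (hM z s hs).2.2
    have hg := abs_le.1 (hMg t ht)
    have hu₀ := abs_le.1 (hM x₀ t₀ h.mem_Icc).1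
    have hV₀ := abs_le.1 (hM x₀ t₀ h.mem_Icc).2.2
    have hw₀ := abs_le.1 (hM y₀ t₀ h.mem_Icc).2.1
    have hg₀ := abs_le.1 (hMg t₀ h.mem_Icc)
    have : 0 ≤ κ * ‖x - y - (x₀ - y₀)‖ + a / 2 * ‖x - y‖ ^ 2 + b / 2 * ‖y‖ ^ 2 := by positivity
    linarith [sq_nonneg (t - s), sq_nonneg (t - t₀)]
  have hx : ‖x - x₀‖ ≤ √(2 * c) := Real.le_sqrt_of_sq_le (by
    linarith [sq_nonneg ‖y - y₀‖, sq_nonneg ‖x - z‖])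
  have hy : ‖y - y₀‖ ≤ √(2 * c) := Real.le_sqrt_of_sq_le (by
    linarith [sq_nonneg ‖x - x₀‖, sq_nonneg ‖x - z‖])
  have hz : ‖z - x‖ ≤ √(2 * c) := Real.le_sqrt_of_sq_le (by
    rw [norm_sub_rev]; linarith [sq_nonneg ‖x - x₀‖, sq_nonneg ‖y - y₀‖])
  refine ⟨⟨?_, ht⟩, ⟨?_, hs⟩, ?_⟩ <;> rw [Metric.mem_closedBall, dist_eq_norm]
  exacts [hx, hy, (norm_sub_le_norm_sub_add_norm_sub z x x₀).trans (add_le_add hz hx)]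

lemma IsPenalizedMax.eq_of_le_undoubled {ξ : (E × ℝ) × (E × ℝ) × E} (hξ : ξ ∈ doubledDomain E T)
    (hsep : separation ξ = 0) (hle : undoubled κ a b u w V g x₀ y₀ t₀ ((x₀, t₀), (y₀, t₀), x₀) ≤
      undoubled κ a b u w V g x₀ y₀ t₀ ξ) : ξ = ((x₀, t₀), (y₀, t₀), x₀) := by
  obtain ⟨⟨x, t⟩, ⟨y, s⟩, z⟩ := ξ
  obtain ⟨rfl, rfl⟩ := eq_of_separation_eq_zero hsep
  have hmax := h.le_max x y t hξ.1.2
  simp only [undoubled, sub_self, norm_zero] at hle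
  have hx := sq_nonneg ‖x - x₀‖
  have hy := sq_nonneg ‖y - y₀‖
  have ht := sq_nonneg (t - t₀)
  obtain rfl : x = x₀ :=
    sub_eq_zero.1 (norm_eq_zero.1 (pow_eq_zero_iff two_ne_zero |>.1 (by linarith)))
  obtain rfl : y = y₀ :=
    sub_eq_zero.1 (norm_eq_zero.1 (pow_eq_zero_iff two_ne_zero |>.1 (by linarith)))
  obtain rfl : t = t₀ := sub_eq_zero.1 (pow_eq_zero_iff two_ne_zero |>.1 (by linarith))
  rfl

lemma IsPenalizedMax.exists_doubled_maxima [ProperSpace E] :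
    ∃ ξ : ℕ → (E × ℝ) × (E × ℝ) × E,
      (∀ n : ℕ, ξ n ∈ doubledDomain E T ∧
        IsMaxOn (doubled κ a b u w V g x₀ y₀ t₀ (n + 1)) (doubledDomain E T) (ξ n)) ∧
      Tendsto ξ atTop (𝓝 ((x₀, t₀), (y₀, t₀), x₀)) := by
  have hsep : Continuous fun ξ : (E × ℝ) × (E × ℝ) × E => separation ξ := by
    unfold separation; fun_prop
  exact exists_isMaxOn_tendsto_of_penalized
    ((isClosed_univ.prod isClosed_Icc).prod ((isClosed_univ.prod isClosed_Icc).prod isClosed_univ))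
    h.continuousOn_undoubled hsep.continuousOn (fun n => h.continuousOn_doubled _)
    (fun ξ _ => separation_nonneg ξ)
    ⟨⟨mem_univ _, h.mem_Icc⟩, ⟨mem_univ _, h.mem_Icc⟩, mem_univ _⟩ h.nonneg.1
    (fun n ξ _ => doubled_le h.nonneg.1 _ ξ) (fun n => (doubled_self (by positivity)).ge)
    h.isBounded_superlevel fun ξ hξ => h.eq_of_le_undoubled hξ

end IsPenalizedMax

end Doubling

section SmoothDist

variable {E : Type*} [NormedAddCommGroup E] [InnerProductSpace ℝ E] {d : ℝ}

lemma contDiff_smoothDist (hd : 0 < d) (c : E) {n : WithTop ℕ∞} : ContDiff ℝ n (smoothDist d c) :=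
  (((contDiff_id.sub contDiff_const).norm_sq ℝ).add contDiff_const).sqrt
    fun x => (by positivity : (0 : ℝ) < ‖x - c‖ ^ 2 + d ^ 2).ne'

lemma norm_inv_smoothDist_smul_le (hd : 0 < d) (c x : E) :
    ‖(smoothDist d c x)⁻¹ • (x - c)‖ ≤ 1 := by
  have h := smoothDist_pos hd c x
  rw [norm_smul, norm_inv, Real.norm_eq_abs, abs_of_pos h, inv_mul_le_one₀ h]
  exact norm_sub_le_smoothDist d c x

lemma contDiff_penalty (hd : 0 < d) (κ a b : ℝ) (c₁ c₂ c₃ c₄ : E) {n : WithTop ℕ∞} :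
    ContDiff ℝ n (fun x => κ * smoothDist d c₁ x + a / 2 * ‖x - c₂‖ ^ 2 + b / 2 * ‖x - c₃‖ ^ 2
      + 1 / 2 * ‖x - c₄‖ ^ 2) := by
  have hsq (c : E) : ContDiff ℝ n (fun x => ‖x - c‖ ^ 2) :=
    (contDiff_id.sub contDiff_const).norm_sq ℝ
  exact (((contDiff_const.mul (contDiff_smoothDist hd c₁)).add (contDiff_const.mul (hsq c₂))).add
    (contDiff_const.mul (hsq c₃))).add (contDiff_const.mul (hsq c₄))

variable [CompleteSpace E]

lemma hasGradientAt_smoothDist (hd : 0 < d) (c x : E) :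
    HasGradientAt (smoothDist d c) ((smoothDist d c x)⁻¹ • (x - c)) x := by
  have hsq := hasGradientAt_norm_sub_sq c x
  rw [hasGradientAt_iff_hasFDerivAt] at *
  refine ((hsq.add_const (d ^ 2)).sqrt
    (by positivity : (0 : ℝ) < ‖x - c‖ ^ 2 + d ^ 2).ne').congr_fderiv ?_
  rw [← map_smul, smul_smul]
  congr 2
  have := (smoothDist_pos hd c x).ne'
  simp only [smoothDist] at this ⊢
  field_simp

lemma gradient_penalty (hd : 0 < d) (κ a b : ℝ) (c₁ c₂ c₃ c₄ x : E) :
    gradient (fun x => κ * smoothDist d c₁ x + a / 2 * ‖x - c₂‖ ^ 2 + b / 2 * ‖x - c₃‖ ^ 2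
      + 1 / 2 * ‖x - c₄‖ ^ 2) x =
    κ • ((smoothDist d c₁ x)⁻¹ • (x - c₁)) + a • (x - c₂) + b • (x - c₃) + (x - c₄) := by
  have hsq (r : ℝ) (c : E) : HasGradientAt (fun x => r / 2 * ‖x - c‖ ^ 2) (r • (x - c)) x := by
    simpa [smul_smul] using hasGradientAt_const_mul (r / 2) (hasGradientAt_norm_sub_sq c x)
  simpa using (hasGradientAt_add (hasGradientAt_add (hasGradientAt_add
    (hasGradientAt_const_mul κ (hasGradientAt_smoothDist hd c₁ x)) (hsq a c₂)) (hsq b c₃))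
    (hsq 1 c₄)).gradient

end SmoothDist

section Limit

variable {X Y : Type*} [TopologicalSpace X] [TopologicalSpace Y] {T : ℝ}

lemma tendsto_increment {f : X → ℝ → ℝ} (hf : ContinuousOn (Function.uncurry f) (univ ×ˢ Icc 0 T))
    {p : ℕ → X × ℝ} {p₀ : X × ℝ} (hp : ∀ n, (p n).2 ∈ Icc 0 T) (hp₀ : p₀.2 ∈ Icc 0 T)
    (hlim : Tendsto p atTop (𝓝 p₀)) {τ : ℝ} (hτ : 0 ≤ τ) :
    Tendsto (fun n => increment (f (p n).1) (p n).2 τ) atTop (𝓝 (increment (f p₀.1) p₀.2 τ)) := by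
  have hcont : ContinuousOn (fun q : X × ℝ => increment (f q.1) q.2 τ) (univ ×ˢ Icc 0 T) :=
    hf.sub (hf.comp (f := fun q : X × ℝ => (q.1, max (q.2 - τ) 0)) (by fun_prop)
      fun q hq => ⟨mem_univ _, le_max_right _ _,
        max_le (by linarith [hq.2.2]) (hq.2.1.trans hq.2.2)⟩)
  exact (hcont p₀ ⟨mem_univ _, hp₀⟩).tendsto.comp
    (tendsto_nhdsWithin_iff.2 ⟨hlim, Eventually.of_forall fun n => ⟨mem_univ _, hp n⟩⟩)

lemma caputo_sub_le_of_tendsto {α B C : ℝ} (hα : α ∈ Ioo (0 : ℝ) 1) {u : X → ℝ → ℝ}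
    {w : Y → ℝ → ℝ} (hu : ContinuousOn (Function.uncurry u) (univ ×ˢ Icc 0 T))
    (hw : ContinuousOn (Function.uncurry w) (univ ×ˢ Icc 0 T)) {p : ℕ → X × ℝ} {q : ℕ → Y × ℝ}
    {x₀ : X} {y₀ : Y} {t₀ : ℝ} (ht₀ : t₀ ∈ Ioc 0 T) (hp : Tendsto p atTop (𝓝 (x₀, t₀)))
    (hq : Tendsto q atTop (𝓝 (y₀, t₀))) (hpT : ∀ n, (p n).2 ∈ Icc 0 T)
    (hqT : ∀ n, (q n).2 ∈ Icc 0 T)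
    (hlow : ∀ n, ∀ τ > 0, -(B * min τ 1) ≤
      increment (u (p n).1) (p n).2 τ - increment (w (q n).1) (q n).2 τ)
    (hKu : ∀ n, 0 < (p n).2 → KExists α 0 (p n).2 (u (p n).1) (p n).2)
    (hKw : ∀ n, 0 < (q n).2 → KExists α 0 (q n).2 (w (q n).1) (q n).2) {c : ℕ → ℝ}
    (hc : ∀ n, 0 < (p n).2 → 0 < (q n).2 →
      caputo α (u (p n).1) (p n).2 - caputo α (w (q n).1) (q n).2 ≤ c n)
    (hcC : Tendsto c atTop (𝓝 C)) :
    KExists α 0 t₀ (fun r => u x₀ r - w y₀ r) t₀ ∧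
      caputo α (fun r => u x₀ r - w y₀ r) t₀ ≤ C := by
  have hp_pos : ∀ᶠ n in atTop, 0 < (p n).2 :=
    ((continuous_snd.tendsto _).comp hp).eventually (lt_mem_nhds ht₀.1)
  have hq_pos : ∀ᶠ n in atTop, 0 < (q n).2 :=
    ((continuous_snd.tendsto _).comp hq).eventually (lt_mem_nhds ht₀.1)
  have hint {f : ℝ → ℝ} {t : ℝ} (ht : 0 < t) (hf : KExists α 0 t f t) :=
    (integrableOn_increment_iff hα.1 ht).2 hf
  refine caputo_le_of_tendsto_increment hα ht₀.1
    (d := fun n τ => increment (u (p n).1) (p n).2 τ - increment (w (q n).1) (q n).2 τ)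
    ?_ (Eventually.of_forall hlow) (fun τ hτ => ?_) ?_ hcC
  · filter_upwards [hp_pos, hq_pos] with n hpn hqn
    simp only [sub_div]
    exact (hint hpn (hKu n hpn)).sub (hint hqn (hKw n hqn))
  · rw [increment_sub]
    exact (tendsto_increment hu hpT (Ioc_subset_Icc_self ht₀) hp hτ.le).sub
      (tendsto_increment hw hqT (Ioc_subset_Icc_self ht₀) hq hτ.le)
  · filter_upwards [hp_pos, hq_pos] with n hpn hqn
    simp only [sub_div]
    rw [integral_sub (hint hpn (hKu n hpn)) (hint hqn (hKw n hqn)), mul_sub,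
      ← caputo_eq_integral_increment hα.1 hpn (hKu n hpn),
      ← caputo_eq_integral_increment hα.1 hqn (hKw n hqn)]
    exact hc n hpn hqn

end Limit

section Maxima

variable {N : ℕ} {α T κ a b : ℝ} {u w : Space N → ℝ → ℝ} {V : Space N → ℝ} {g : ℝ → ℝ}
  {x₀ y₀ : Space N} {t₀ : ℝ} {n : ℝ} {x y z : Space N} {t s : ℝ}

lemma IsPenalizedMax.caputo_left_le (h : IsPenalizedMax T κ a b u w V g x₀ y₀ t₀)
    (hα : α ∈ Ioo (0 : ℝ) 1) (hg : ContDiffOn ℝ 1 g (Ioc 0 T)) {F : Space N → Space N → ℝ}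
    (hsub : TestsSub α T F u) (hn : 0 < n) (ht : t ∈ Ioc 0 T) (hs : s ∈ Icc 0 T)
    (hmax : IsMaxOn (doubled κ a b u w V g x₀ y₀ t₀ n) (doubledDomain (Space N) T)
      ((x, t), (y, s), z)) :
    KExists α 0 t (u x) t ∧ caputo α (u x) t ≤ -F x (n • (x - z) +
      (κ • ((smoothDist n⁻¹ (y + (x₀ - y₀)) x)⁻¹ • (x - (y + (x₀ - y₀)))) + a • (x - y)
        + (x - x₀))) := by
  have hsq (r c : ℝ) : ContDiff ℝ 1 fun t : ℝ => r / 2 * (t - c) ^ 2 := by fun_prop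
  have hcaputo := hsub.caputo_le (x₁ := x) hα h.continuousOn_left
    (contDiff_penalty (inv_pos.2 hn) κ a n (y + (x₀ - y₀)) y z x₀)
    (γ := fun t => g t + n / 2 * (t - s) ^ 2 + 1 / 2 * (t - t₀) ^ 2)
    ((h.continuousOn_time.add (hsq _ _).continuous.continuousOn).add
      (hsq _ _).continuous.continuousOn)
    ((hg.add (hsq _ _).contDiffOn).add (hsq _ _).contDiffOn) ht (fun x' t' ht' => by
      have := isMaxOn_iff.1 hmax ((x', t'), (y, s), z)
        ⟨⟨mem_univ _, ht'⟩, ⟨mem_univ _, hs⟩, mem_univ _⟩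
      simp only [doubled] at this
      linarith)
  rw [gradient_penalty (inv_pos.2 hn)] at hcaputo
  convert hcaputo using 4
  abel

lemma IsPenalizedMax.le_caputo_right (h : IsPenalizedMax T κ a b u w V g x₀ y₀ t₀)
    (hα : α ∈ Ioo (0 : ℝ) 1) {G : Space N → Space N → ℝ}
    (hsup : TestsSuper α T G w) (hn : 0 < n) (ht : t ∈ Icc 0 T) (hs : s ∈ Ioc 0 T)
    (hmax : IsMaxOn (doubled κ a b u w V g x₀ y₀ t₀ n) (doubledDomain (Space N) T)
      ((x, t), (y, s), z)) :
    KExists α 0 s (w y) s ∧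
      -G y (κ • ((smoothDist n⁻¹ (y + (x₀ - y₀)) x)⁻¹ • (x - (y + (x₀ - y₀)))) + a • (x - y)
        - b • y - (y - y₀)) ≤ caputo α (w y) s := by
  have hcaputo := hsup.neg.caputo_le (x₁ := y) hα h.continuousOn_right.neg
    (contDiff_penalty (inv_pos.2 hn) κ a b (x - (x₀ - y₀)) x 0 y₀)
    (γ := fun s => n / 2 * (t - s) ^ 2) (by fun_prop) (ContDiff.contDiffOn (by fun_prop)) hs
    (fun y' s' hs' => by
      have := isMaxOn_iff.1 hmax ((x, t), (y', s'), z)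
        ⟨⟨mem_univ _, ht⟩, ⟨mem_univ _, hs'⟩, mem_univ _⟩
      simp only [doubled, smoothDist_sub_left, norm_sub_rev _ x, sub_zero] at this ⊢
      linarith)
  rw [gradient_penalty (inv_pos.2 hn), caputo_neg, smoothDist_sub_left] at hcaputo
  have hgrad : -(κ • ((smoothDist n⁻¹ (y + (x₀ - y₀)) x)⁻¹ • (y - (x - (x₀ - y₀))))
      + a • (y - x) + b • (y - 0) + (y - y₀)) =
      κ • ((smoothDist n⁻¹ (y + (x₀ - y₀)) x)⁻¹ • (x - (y + (x₀ - y₀)))) + a • (x - y)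
        - b • y - (y - y₀) := by module
  rw [hgrad] at hcaputo
  refine ⟨?_, by linarith [hcaputo.2]⟩
  refine (IntervalIntegrable.neg hcaputo.1).congr fun τ _ => ?_
  simp only [Pi.neg_apply]
  ring

lemma corrector_add_le_of_isMaxOn_doubled (ht : t ∈ Icc 0 T) (hs : s ∈ Icc 0 T)
    (hmax : IsMaxOn (doubled κ a b u w V g x₀ y₀ t₀ n) (doubledDomain (Space N) T)
      ((x, t), (y, s), z)) (z' : Space N) :
    V z + n / 2 * ‖x - z‖ ^ 2 ≤ V z' + n / 2 * ‖x - z'‖ ^ 2 := by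
  have := isMaxOn_iff.1 hmax ((x, t), (y, s), z') ⟨⟨mem_univ _, ht⟩, ⟨mem_univ _, hs⟩, mem_univ _⟩
  simp only [doubled] at this
  linarith

-- Going back in time by `τ` in both variables does not increase `|t - s|`.
lemma neg_mul_min_le_increment_sub_of_isMaxOn_doubled (hg : MonotoneOn g (Icc 0 T)) (hn : 0 ≤ n)
    (ht₀ : t₀ ∈ Icc 0 T) (ht : t ∈ Icc 0 T) (hs : s ∈ Icc 0 T)
    (hmax : IsMaxOn (doubled κ a b u w V g x₀ y₀ t₀ n) (doubledDomain (Space N) T)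
      ((x, t), (y, s), z)) {τ : ℝ} (hτ : 0 < τ) :
    -(T * max 1 T * min τ 1) ≤ increment (u x) t τ - increment (w y) s τ := by
  have hmem {r : ℝ} (hr : r ∈ Icc 0 T) : max (r - τ) 0 ∈ Icc 0 T :=
    ⟨le_max_right _ _, max_le (by linarith [hr.2]) (hr.1.trans hr.2)⟩
  have hle : max (t - τ) 0 ≤ t := max_le (by linarith) ht.1
  have hpast := isMaxOn_iff.1 hmax ((x, max (t - τ) 0), (y, max (s - τ) 0), z)
    ⟨⟨mem_univ _, hmem ht⟩, ⟨mem_univ _, hmem hs⟩, mem_univ _⟩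
  have hgle := hg (hmem ht) ht hle
  have hsep : (max (t - τ) 0 - max (s - τ) 0) ^ 2 ≤ (t - s) ^ 2 := by
    refine sq_le_sq.2 ((abs_max_sub_max_le_abs _ _ _).trans_eq ?_)
    rw [sub_sub_sub_cancel_right]
  have hlag : t - max (t - τ) 0 ≤ max 1 T * min τ 1 := by
    rcases le_total τ 1 with h | h
    · rw [min_eq_left h]
      nlinarith [le_max_left 1 T, le_max_left (t - τ) 0]
    · rw [min_eq_right h, mul_one]
      linarith [le_max_right 1 T, le_max_right (t - τ) 0, ht.2]
  have htime : (max (t - τ) 0 - t₀) ^ 2 - (t - t₀) ^ 2 ≤ 2 * (T * (max 1 T * min τ 1)) := by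
    have := mul_le_mul_of_nonneg_left hlag (ht₀.1.trans ht₀.2)
    nlinarith [(hmem ht).1, ht.1, ht₀.2]
  simp only [doubled] at hpast
  simp only [increment]
  nlinarith [mul_le_mul_of_nonneg_left hsep hn]

lemma norm_penaltyGradient_sub_le {E : Type*} [SeminormedAddCommGroup E] [NormedSpace ℝ E]
    (hκ : 0 ≤ κ) (ha : 0 ≤ a) (hb : 0 ≤ b) {e : E} (he : ‖e‖ ≤ 1) (x y x₀ y₀ : E) :
    ‖κ • e + a • (x - y) + (x - x₀) - a • (x₀ - y₀)‖
      + ‖κ • e + a • (x - y) - b • y - (y - y₀) - (a • (x₀ - y₀) - b • y₀)‖ ≤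
      2 * (κ + a * ‖x - y - (x₀ - y₀)‖) + ‖x - x₀‖ + (b + 1) * ‖y - y₀‖ := by
  have hκe : ‖κ • e‖ ≤ κ := by
    rw [norm_smul_of_nonneg hκ]
    exact mul_le_of_le_one_right hκ he
  have hfst : κ • e + a • (x - y) + (x - x₀) - a • (x₀ - y₀) =
      κ • e + a • (x - y - (x₀ - y₀)) + (x - x₀) := by module
  have hsnd : κ • e + a • (x - y) - b • y - (y - y₀) - (a • (x₀ - y₀) - b • y₀) =
      κ • e + a • (x - y - (x₀ - y₀)) + (b + 1) • (y₀ - y) := by module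
  rw [hfst, hsnd]
  have hfst_le := norm_add₃_le (a := κ • e) (b := a • (x - y - (x₀ - y₀))) (c := x - x₀)
  have hsnd_le := norm_add₃_le (a := κ • e) (b := a • (x - y - (x₀ - y₀)))
    (c := (b + 1) • (y₀ - y))
  rw [norm_smul_of_nonneg ha] at hfst_le hsnd_le
  rw [norm_smul_of_nonneg (add_nonneg hb zero_le_one), norm_sub_rev y₀] at hsnd_le
  linarith

lemma IsPenalizedMax.caputo_sub_le {m B₁ B₂ : ℝ} (h : IsPenalizedMax T κ a b u w V g x₀ y₀ t₀)
    (hα : α ∈ Ioo (0 : ℝ) 1) (hg : ContDiffOn ℝ 1 g (Ioc 0 T)) (hgmono : MonotoneOn g (Icc 0 T))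
    {F G : Space N → Space N → ℝ} (hsub : TestsSub α T F u) (hsup : TestsSuper α T G w)
    (hB₂ : 0 ≤ B₂)
    (hFG : ∀ c > 0, ∀ x y z p q,
      (∀ z', V z + c / 2 * ‖x - z‖ ^ 2 ≤ V z' + c / 2 * ‖x - z'‖ ^ 2) →
      G y q - F x (c • (x - z) + p) ≤ m + B₁ * (‖x - x₀‖ + ‖y - y₀‖ + ‖z - x₀‖)
        + B₂ * (‖p - a • (x₀ - y₀)‖ + ‖q - (a • (x₀ - y₀) - b • y₀)‖)) :
    KExists α 0 t₀ (fun r => u x₀ r - w y₀ r) t₀ ∧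
      caputo α (fun r => u x₀ r - w y₀ r) t₀ ≤ m + 2 * B₂ * κ := by
  obtain ⟨ξ, hξ, hlim⟩ := h.exists_doubled_maxima
  have hn (n : ℕ) : (0 : ℝ) < n + 1 := by positivity
  have ht n : (ξ n).1.2 ∈ Icc 0 T := (hξ n).1.1.2
  have hs n : (ξ n).2.1.2 ∈ Icc 0 T := (hξ n).1.2.1.2
  have hleft n (htn : 0 < (ξ n).1.2) :=
    h.caputo_left_le hα hg hsub (hn n) ⟨htn, (ht n).2⟩ (hs n) (hξ n).2
  have hright n (hsn : 0 < (ξ n).2.1.2) :=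
    h.le_caputo_right hα hsup (hn n) (ht n) ⟨hsn, (hs n).2⟩ (hξ n).2
  let err (η : (Space N × ℝ) × (Space N × ℝ) × Space N) : ℝ :=
    m + B₁ * (‖η.1.1 - x₀‖ + ‖η.2.1.1 - y₀‖ + ‖η.2.2 - x₀‖)
      + B₂ * (2 * (κ + a * ‖η.1.1 - η.2.1.1 - (x₀ - y₀)‖) + ‖η.1.1 - x₀‖
        + (b + 1) * ‖η.2.1.1 - y₀‖)
  have herr : Continuous err := by fun_prop
  refine caputo_sub_le_of_tendsto hα h.continuousOn_left h.continuousOn_right h.mem_Ioc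
    (B := T * max 1 T) (p := fun n => (ξ n).1) (q := fun n => (ξ n).2.1)
    ((continuous_fst.tendsto _).comp hlim)
    (((continuous_fst.comp continuous_snd).tendsto _).comp hlim) ht hs
    (fun n τ hτ => neg_mul_min_le_increment_sub_of_isMaxOn_doubled hgmono (hn n).le h.mem_Icc
      (ht n) (hs n) (hξ n).2 hτ) (fun n htn => (hleft n htn).1) (fun n hsn => (hright n hsn).1)
    (c := fun n => err (ξ n)) (fun n htn hsn => ?_) ?_
  · let e := (smoothDist (n + 1 : ℝ)⁻¹ ((ξ n).2.1.1 + (x₀ - y₀)) (ξ n).1.1)⁻¹ •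
      ((ξ n).1.1 - ((ξ n).2.1.1 + (x₀ - y₀)))
    have hnorm := mul_le_mul_of_nonneg_left
      (norm_penaltyGradient_sub_le h.nonneg.1 h.nonneg.2.1 h.nonneg.2.2
        (norm_inv_smoothDist_smul_le (inv_pos.2 (hn n)) _ _ : ‖e‖ ≤ 1)
        (ξ n).1.1 (ξ n).2.1.1 x₀ y₀) hB₂
    have hHam := hFG _ (hn n) (ξ n).1.1 (ξ n).2.1.1 (ξ n).2.2
      (κ • e + a • ((ξ n).1.1 - (ξ n).2.1.1) + ((ξ n).1.1 - x₀))
      (κ • e + a • ((ξ n).1.1 - (ξ n).2.1.1) - b • (ξ n).2.1.1 - ((ξ n).2.1.1 - y₀))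
      (corrector_add_le_of_isMaxOn_doubled (ht n) (hs n) (hξ n).2)
    linarith [(hleft n htn).2, (hright n hsn).2]
  · have herr₀ : err ((x₀, t₀), (y₀, t₀), x₀) = m + 2 * B₂ * κ := by
      simp only [err, sub_self, norm_zero]
      ring
    exact herr₀ ▸ (herr.tendsto _).comp hlim

end Maxima

/-! ### Comparison for the time-fractional problem -/

lemma penalties_le {r s r₀ s₀ p q M : ℝ} (h : |r| ≤ M ∧ |s| ≤ M) (h₀ : |r₀| ≤ M ∧ |s₀| ≤ M)
    (hp : 0 ≤ p) (hq : 0 ≤ q) (hle : r₀ - s₀ ≤ r - s - p - q) : p ≤ 4 * M ∧ q ≤ 4 * M := by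
  simp only [abs_le] at h h₀
  constructor <;> linarith [h.1.2, h.2.1, h₀.1.1, h₀.2.2]

lemma exists_quadratic_max {E Y : Type*} [NormedAddCommGroup E] [ProperSpace E]
    [TopologicalSpace Y] {S : Set Y} (hS : IsCompact S) (hne : S.Nonempty) {u w : E → Y → ℝ}
    (hu : ContinuousOn (Function.uncurry u) (univ ×ˢ S))
    (hw : ContinuousOn (Function.uncurry w) (univ ×ˢ S)) {M a b : ℝ}
    (hM : ∀ x, ∀ t ∈ S, |u x t| ≤ M ∧ |w x t| ≤ M) (ha : 0 < a) (hb : 0 < b) :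
    ∃ x₀ y₀, ∃ t₀ ∈ S, (∀ x y, ∀ t ∈ S, u x t - w y t - a / 2 * ‖x - y‖ ^ 2 - b / 2 * ‖y‖ ^ 2 ≤
        u x₀ t₀ - w y₀ t₀ - a / 2 * ‖x₀ - y₀‖ ^ 2 - b / 2 * ‖y₀‖ ^ 2) ∧
      a * ‖x₀ - y₀‖ ^ 2 ≤ 8 * M ∧ b * ‖y₀‖ ^ 2 ≤ 8 * M := by
  obtain ⟨t', ht'⟩ := hne
  let f (ξ : E × E × Y) : ℝ :=
    u ξ.1 ξ.2.2 - w ξ.2.1 ξ.2.2 - a / 2 * ‖ξ.1 - ξ.2.1‖ ^ 2 - b / 2 * ‖ξ.2.1‖ ^ 2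
  have hlevel (x y : E) (t : Y) (ht : t ∈ S) (hle : f (0, 0, t') ≤ f (x, y, t)) :
      a * ‖x - y‖ ^ 2 ≤ 8 * M ∧ b * ‖y‖ ^ 2 ≤ 8 * M := by
    simp only [f, sub_zero, norm_zero] at hle
    obtain ⟨hxy, hy⟩ := penalties_le (p := a / 2 * ‖x - y‖ ^ 2) (q := b / 2 * ‖y‖ ^ 2)
      ⟨(hM x t ht).1, (hM y t ht).2⟩ (hM 0 t' ht') (by positivity) (by positivity) (by linarith)
    constructor <;> linarith
  let ρ := √(8 * M / b)
  let Q : Set (E × E × Y) :=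
    Metric.closedBall 0 (√(8 * M / a) + ρ) ×ˢ Metric.closedBall 0 ρ ×ˢ S
  have hQ : IsCompact Q := (isCompact_closedBall _ _).prod ((isCompact_closedBall _ _).prod hS)
  have hf : ContinuousOn f Q :=
    (((hu.comp (f := fun ξ : E × E × Y => (ξ.1, ξ.2.2)) (by fun_prop)
      fun ξ hξ => ⟨mem_univ _, hξ.2.2⟩).sub (hw.comp (by fun_prop)
      fun ξ hξ => ⟨mem_univ _, hξ.2.2⟩)).sub (by fun_prop)).sub (by fun_prop)
  obtain ⟨⟨x₀, y₀, t₀⟩, hmem, hmax⟩ := exists_isMaxOn_of_superlevel_subset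
    (s := {ξ : E × E × Y | ξ.2.2 ∈ S}) (x₀ := (0, 0, t')) hQ hf ht' (by
      rintro ⟨x, y, t⟩ ht hle
      obtain ⟨hxy, hy⟩ := hlevel x y t ht hle
      have hxy := Real.le_sqrt_of_sq_le ((le_div_iff₀' ha).2 hxy)
      have hy := Real.le_sqrt_of_sq_le ((le_div_iff₀' hb).2 hy)
      exact ⟨mem_closedBall_zero_iff.2
        ((norm_le_norm_sub_add x y).trans (add_le_add hxy hy)), mem_closedBall_zero_iff.2 hy, ht⟩)
  have hmax := isMaxOn_iff.1 hmax
  exact ⟨x₀, y₀, t₀, hmem.2.2, fun x y t ht => hmax (x, y, t) ht,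
    hlevel x₀ y₀ t₀ hmem.2.2 (hmax (0, 0, t') ht')⟩

/-- To bound `u - w` it suffices to do so at the maximum points of `u(x, t) - w(y, t)` with a
quadratic penalization of `x - y` and `y`, up to an error that vanishes with the penalization. -/
lemma sub_le_of_forall_quadratic_max {E Y : Type*} [NormedAddCommGroup E] [ProperSpace E]
    [TopologicalSpace Y] {S : Set Y} (hS : IsCompact S) {u w : E → Y → ℝ}
    (hu : ContinuousOn (Function.uncurry u) (univ ×ˢ S))
    (hw : ContinuousOn (Function.uncurry w) (univ ×ˢ S)) {M B D : ℝ}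
    (hM : ∀ x, ∀ t ∈ S, |u x t| ≤ M ∧ |w x t| ≤ M)
    (h : ∀ a > 0, ∀ b > 0, ∀ x₀ y₀, ∀ t₀ ∈ S,
      (∀ x y, ∀ t ∈ S, u x t - w y t - a / 2 * ‖x - y‖ ^ 2 - b / 2 * ‖y‖ ^ 2 ≤
        u x₀ t₀ - w y₀ t₀ - a / 2 * ‖x₀ - y₀‖ ^ 2 - b / 2 * ‖y₀‖ ^ 2) →
      u x₀ t₀ - w y₀ t₀ ≤ D + B * (‖x₀ - y₀‖ + b * ‖y₀‖)) (y : E) {t : Y} (ht : t ∈ S) :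
    u y t - w y t ≤ D := by
  have hk (k : ℕ) : (0 : ℝ) < k + 1 := by positivity
  have hinv : Tendsto (fun k : ℕ => ((k : ℝ) + 1)⁻¹) atTop (𝓝 0) :=
    tendsto_inv_atTop_zero.comp (tendsto_natCast_atTop_atTop.atTop_add tendsto_const_nhds)
  have hroot : Tendsto (fun k : ℕ => √(8 * M * ((k : ℝ) + 1)⁻¹)) atTop (𝓝 0) := by
    simpa using (hinv.const_mul (8 * M)).sqrt
  choose x₀ y₀ t₀ ht₀ hmax hx₀ hy₀ using fun k : ℕ =>
    exists_quadratic_max hS ⟨t, ht⟩ hu hw hM (hk k) (inv_pos.2 (hk k))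
  have hx_lim : Tendsto (fun k => ‖x₀ k - y₀ k‖) atTop (𝓝 0) :=
    squeeze_zero (fun _ => norm_nonneg _) (fun k => Real.le_sqrt_of_sq_le (by
      rw [← div_eq_mul_inv, le_div_iff₀' (hk k)]; exact hx₀ k)) hroot
  have hy_lim : Tendsto (fun k : ℕ => ((k : ℝ) + 1)⁻¹ * ‖y₀ k‖) atTop (𝓝 0) :=
    squeeze_zero (fun k => by positivity) (fun k => Real.le_sqrt_of_sq_le (by
      have := mul_le_mul_of_nonneg_left (hy₀ k) (inv_pos.2 (hk k)).le
      linarith)) hroot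
  have hlim : Tendsto (fun k : ℕ => D + B * (‖x₀ k - y₀ k‖ + ((k : ℝ) + 1)⁻¹ * ‖y₀ k‖)
      + ((k : ℝ) + 1)⁻¹ * (‖y‖ ^ 2 / 2)) atTop (𝓝 D) := by
    simpa using (((hx_lim.add hy_lim).const_mul B).const_add D).add
      (hinv.mul_const (‖y‖ ^ 2 / 2))
  refine ge_of_tendsto' hlim fun k => ?_
  have hpen := hmax k y y t ht
  rw [sub_self, norm_zero] at hpen
  have := h _ (hk k) _ (inv_pos.2 (hk k)) _ _ _ (ht₀ k) (hmax k)
  have : 0 ≤ (k + 1 : ℝ) / 2 * ‖x₀ k - y₀ k‖ ^ 2 := by positivity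
  have : 0 ≤ (k + 1 : ℝ)⁻¹ / 2 * ‖y₀ k‖ ^ 2 := by positivity
  linarith

lemma K_nonneg {α t : ℝ} {f : ℝ → ℝ} (hα : α ∈ Icc (0 : ℝ) 1) (ht : 0 ≤ t)
    (hf : ∀ s ∈ Icc 0 t, f s ≤ f t) : 0 ≤ K α 0 t f t :=
  mul_nonneg (div_nonneg hα.1 (Real.Gamma_nonneg_of_nonneg (by linarith [hα.2])))
    (intervalIntegral.integral_nonneg ht fun τ hτ => div_nonneg
      (sub_nonneg.2 (hf _ ⟨by linarith [hτ.2], by linarith [hτ.1]⟩)) (Real.rpow_nonneg hτ.1 _))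

lemma le_add_mul_of_caputo_le {α t c : ℝ} {f : ℝ → ℝ} (hα : α ∈ Ioo (0 : ℝ) 1) (ht : 0 < t)
    (hf : ∀ s ∈ Icc 0 t, f s ≤ f t) (hc : caputo α f t ≤ c) :
    f t ≤ f 0 + t ^ α * Real.Gamma (1 - α) * c := by
  have hΓ : 0 < Real.Gamma (1 - α) := Real.Gamma_pos_of_pos (by linarith [hα.2])
  have hJ : J α f t ≤ c := by
    have := K_nonneg (Ioo_subset_Icc_self hα) ht.le hf
    unfold caputo at hc
    linarith
  rw [J, div_le_iff₀' (mul_pos (Real.rpow_pos_of_pos ht _) hΓ)] at hJ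
  linarith

section Comparison

variable {N : ℕ} {α T : ℝ} {u w : Space N → ℝ → ℝ} {F G : Space N → Space N → ℝ}

lemma TestsSub.translate (hu : TestsSub α T F u) (h : Space N) :
    TestsSub α T (fun x p => F (x + h) p) (fun x t => u (x + h) t) := by
  intro φ hφ x₁ t₁ ht₁ hmax
  have hshift : Continuous fun ξ : Space N × ℝ => (ξ.1 - h, ξ.2) := by fun_prop
  have hφ' : IsTest T fun x t => φ (x - h) t :=
    ⟨hφ.1.comp (f := fun ξ : Space N × ℝ => (ξ.1 - h, ξ.2)) (ContDiff.contDiffOn (by fun_prop))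
        fun ξ hξ => ⟨mem_univ _, hξ.2⟩,
      hφ.2.comp hshift.continuousOn fun ξ hξ => ⟨mem_univ _, hξ.2⟩⟩
  have := hu _ hφ' (x₁ + h) t₁ ht₁ fun x t ht => by
    simpa using hmax (x - h) t ht
  rwa [gradient, fderiv_comp_sub (f := fun x => φ x t₁), add_sub_cancel_right] at this

lemma caputo_sub_le_of_quadratic_max {M C e a b t₀ : ℝ} {x₀ y₀ : Space N}
    (hα : α ∈ Ioo (0 : ℝ) 1) (hu : ContinuousOn (Function.uncurry u) (univ ×ˢ Icc 0 T))
    (hw : ContinuousOn (Function.uncurry w) (univ ×ˢ Icc 0 T))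
    (hM : ∀ x, ∀ t ∈ Icc 0 T, |u x t| ≤ M ∧ |w x t| ≤ M)
    (hsub : TestsSub α T F u) (hsup : TestsSuper α T G w) (hC : 0 ≤ C)
    (hFG : ∀ x y p q, G y p - F x q ≤ e + C * (‖x - y‖ + ‖p - q‖)) (ha : 0 ≤ a) (hb : 0 ≤ b)
    (ht₀ : t₀ ∈ Ioc 0 T)
    (hmax : ∀ x y, ∀ t ∈ Icc 0 T, u x t - w y t - a / 2 * ‖x - y‖ ^ 2 - b / 2 * ‖y‖ ^ 2 ≤
      u x₀ t₀ - w y₀ t₀ - a / 2 * ‖x₀ - y₀‖ ^ 2 - b / 2 * ‖y₀‖ ^ 2) :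
    caputo α (fun r => u x₀ r - w y₀ r) t₀ ≤ e + C * (‖x₀ - y₀‖ + b * ‖y₀‖) := by
  have hpmax : IsPenalizedMax T 0 a b u w (fun _ => 0) (fun _ => 0) x₀ y₀ t₀ :=
    { nonneg := ⟨le_rfl, ha, hb⟩
      continuousOn_left := hu
      continuousOn_right := hw
      continuous_corrector := continuous_const
      continuousOn_time := continuousOn_const
      bounded := ⟨M, fun x t ht => ⟨(hM x t ht).1, (hM x t ht).2, by
        simpa using (abs_nonneg _).trans (hM x t ht).1⟩⟩
      mem_Ioc := ht₀
      le_max := fun x y t ht => by simpa using hmax x y t ht }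
  have := (hpmax.caputo_sub_le (m := e + C * (‖x₀ - y₀‖ + b * ‖y₀‖)) (B₁ := C) hα
    contDiffOn_const monotoneOn_const hsub hsup hC fun c hc x y z p q hz => ?_).2
  · simpa using this
  obtain rfl : x = z := by
    have hxz := hz x
    simp only [zero_add, sub_self, norm_zero, zero_pow two_ne_zero, mul_zero] at hxz
    have := nonpos_of_mul_nonpos_right hxz (half_pos hc)
    exact sub_eq_zero.1 (norm_eq_zero.1 (pow_eq_zero_iff two_ne_zero |>.1
      (le_antisymm this (sq_nonneg _))))
  rw [sub_self, smul_zero, zero_add]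
  have hxy : ‖x - y‖ ≤ ‖x₀ - y₀‖ + ‖x - x₀‖ + ‖y - y₀‖ := by
    rw [show x - y = (x₀ - y₀) + (x - x₀) + (y₀ - y) by abel, norm_sub_rev y]
    exact norm_add₃_le
  have hqp : ‖q - p‖ ≤
      ‖p - a • (x₀ - y₀)‖ + ‖q - (a • (x₀ - y₀) - b • y₀)‖ + b * ‖y₀‖ := by
    rw [show q - p = (a • (x₀ - y₀) - p) + (q - (a • (x₀ - y₀) - b • y₀)) + -(b • y₀) by abel,
      norm_sub_rev p, ← norm_smul_of_nonneg hb, ← norm_neg (b • y₀)]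
    exact norm_add₃_le
  have hnonneg := mul_nonneg hC (norm_nonneg (x - x₀))
  linarith [hFG x y q p, mul_le_mul_of_nonneg_left (add_le_add hxy hqp) hC]

lemma sub_le_of_testsSub_testsSuper {M C L d e : ℝ} (hα : α ∈ Ioo (0 : ℝ) 1)
    (hu : ContinuousOn (Function.uncurry u) (univ ×ˢ Icc 0 T))
    (hw : ContinuousOn (Function.uncurry w) (univ ×ˢ Icc 0 T))
    (hM : ∀ x, ∀ t ∈ Icc 0 T, |u x t| ≤ M ∧ |w x t| ≤ M)
    (hsub : TestsSub α T F u) (hsup : TestsSuper α T G w) (hC : 0 ≤ C) (hL : 0 ≤ L) (he : 0 ≤ e)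
    (hFG : ∀ x y p q, G y p - F x q ≤ e + C * (‖x - y‖ + ‖p - q‖))
    (h₀ : ∀ x y, u x 0 - w y 0 ≤ d + L * ‖x - y‖) (y : Space N) {t : ℝ} (ht : t ∈ Icc 0 T) :
    u y t - w y t ≤ d + T ^ α * Real.Gamma (1 - α) * e := by
  set A := T ^ α * Real.Gamma (1 - α)
  have hΓ : 0 ≤ Real.Gamma (1 - α) := Real.Gamma_nonneg_of_nonneg (by linarith [hα.2])
  have hA : 0 ≤ A := mul_nonneg (Real.rpow_nonneg (ht.1.trans ht.2) _) hΓ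
  refine sub_le_of_forall_quadratic_max isCompact_Icc hu hw hM (B := L + A * C)
    (fun a ha b hb x₀ y₀ t₀ ht₀ hmax => ?_) y ht
  have hLx : L * ‖x₀ - y₀‖ ≤ L * (‖x₀ - y₀‖ + b * ‖y₀‖) :=
    mul_le_mul_of_nonneg_left (by linarith [mul_nonneg hb.le (norm_nonneg y₀)]) hL
  rcases ht₀.1.eq_or_lt with rfl | hpos
  · have : 0 ≤ A * (e + C * (‖x₀ - y₀‖ + b * ‖y₀‖)) := by positivity
    linarith [h₀ x₀ y₀]
  · have hcaputo := caputo_sub_le_of_quadratic_max hα hu hw hM hsub hsup hC hFG ha.le hb.le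
      ⟨hpos, ht₀.2⟩ hmax
    have hle := le_add_mul_of_caputo_le hα hpos (fun s hs => by
      linarith [hmax x₀ y₀ s ⟨hs.1, hs.2.trans ht₀.2⟩]) hcaputo
    have hAt : t₀ ^ α * Real.Gamma (1 - α) ≤ A :=
      mul_le_mul_of_nonneg_right (Real.rpow_le_rpow ht₀.1 ht₀.2 hα.1.le) hΓ
    have := mul_le_mul_of_nonneg_right hAt
      (by positivity : 0 ≤ e + C * (‖x₀ - y₀‖ + b * ‖y₀‖))
    linarith [h₀ x₀ y₀]

end Comparison

lemma gradient_eq_zero_of_isLocalExtr {E : Type*} [NormedAddCommGroup E] [InnerProductSpace ℝ E]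
    [CompleteSpace E] {f : E → ℝ} {x : E} (h : IsLocalExtr f x) : gradient f x = 0 := by
  rw [gradient, h.fderiv_eq_zero, map_zero]

lemma caputo_nonneg {α t : ℝ} {f : ℝ → ℝ} (hα : α ∈ Icc (0 : ℝ) 1) (ht : 0 ≤ t)
    (hf : ∀ s ∈ Icc 0 t, f s ≤ f t) : 0 ≤ caputo α f t :=
  add_nonneg (div_nonneg (sub_nonneg.2 (hf 0 ⟨le_rfl, ht⟩)) (mul_nonneg (Real.rpow_nonneg ht _)
    (Real.Gamma_nonneg_of_nonneg (by linarith [hα.2])))) (K_nonneg hα ht hf)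

section APriori

variable {N : ℕ} {α T : ℝ} {F : Space N → Space N → ℝ} {u₀ : Space N → ℝ} {u : Space N → ℝ → ℝ}

lemma testsSuper_const (hα : α ∈ Icc (0 : ℝ) 1) (hF : ∀ x, 0 ≤ F x 0) (c : ℝ) :
    TestsSuper α T F fun _ _ => c := by
  intro φ _ x₁ t₁ ht₁ hmin
  have hle (x : Space N) (t : ℝ) (ht : t ∈ Icc 0 T) : φ x t ≤ φ x₁ t₁ := by
    linarith [hmin x t ht]
  have hgrad : gradient (fun x => φ x t₁) x₁ = 0 := gradient_eq_zero_of_isLocalExtr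
    (Or.inr (Eventually.of_forall fun x => hle x t₁ (Ioc_subset_Icc_self ht₁)))
  rw [hgrad]
  exact add_nonneg (caputo_nonneg hα ht₁.1.le fun s hs => hle x₁ s ⟨hs.1, hs.2.trans ht₁.2⟩)
    (hF x₁)

lemma testsSub_const (hα : α ∈ Icc (0 : ℝ) 1) (hF : ∀ x, F x 0 ≤ 0) (c : ℝ) :
    TestsSub α T F fun _ _ => c := by
  simpa using (testsSuper_const (T := T) hα (F := fun x p => -F x (-p))
    (fun x => by simpa using hF x) (-c)).neg

lemma IsSolution.initial (hu : IsSolution α T F u₀ u) (x : Space N) : u x 0 = u₀ x :=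
  le_antisymm (hu.2.2.1.2.1 x) (hu.2.2.2.2.1 x)

lemma IsSolution.abs_apply_le {C S M₀ : ℝ} (hα : α ∈ Ioo (0 : ℝ) 1) (hu : IsSolution α T F u₀ u)
    (hC : 0 ≤ C) (hF : ∀ x y p q, |F x p - F y q| ≤ C * (‖x - y‖ + ‖p - q‖))
    (hS : ∀ x, |F x 0| ≤ S) (hM₀ : ∀ x, |u₀ x| ≤ M₀) (x : Space N) {t : ℝ} (ht : t ∈ Icc 0 T) :
    |u x t| ≤ M₀ + T ^ α * Real.Gamma (1 - α) * S := by
  obtain ⟨hcont, ⟨M, hM⟩, hsub, hsup⟩ := hu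
  have hα' := Ioo_subset_Icc_self hα
  have hS₀ : 0 ≤ S := (abs_nonneg _).trans (hS 0)
  have hM' (x : Space N) (t : ℝ) (ht : t ∈ Icc 0 T) : |(0 : ℝ)| ≤ M := by
    simpa using (abs_nonneg _).trans (hM x t ht)
  have hzero : ContinuousOn (Function.uncurry fun (_ : Space N) (_ : ℝ) => (0 : ℝ))
      (univ ×ˢ Icc 0 T) := continuousOn_const
  have hupper := sub_le_of_testsSub_testsSuper (G := fun x p => F x p - F x 0) (L := 0) (d := M₀)
    hα hcont hzero (fun x t ht => ⟨hM x t ht, hM' x t ht⟩) hsub.2.2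
    (testsSuper_const hα' (fun x => by simp) 0) hC le_rfl hS₀
    (fun x y p q => by
      have := (abs_le.1 (hF y x p q)).2
      rw [norm_sub_rev] at this
      linarith [(abs_le.1 (hS y)).1])
    (fun x _ => by linarith [(abs_le.1 (hM₀ x)).2, hsub.2.1 x]) x ht
  have hlower := sub_le_of_testsSub_testsSuper (F := fun x p => F x p - F x 0) (L := 0) (d := M₀)
    hα hzero hcont (fun x t ht => ⟨hM' x t ht, hM x t ht⟩)
    (testsSub_const hα' (fun x => by simp) 0) hsup.2.2 hC le_rfl hS₀
    (fun x y p q => by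
      have := (abs_le.1 (hF y x p q)).2
      rw [norm_sub_rev] at this
      linarith [(abs_le.1 (hS x)).2])
    (fun _ y => by linarith [(abs_le.1 (hM₀ y)).1, hsup.2.1 y]) x ht
  exact abs_le.2 ⟨by linarith, by linarith⟩

lemma IsSolution.sub_le_mul_norm {C L : ℝ} {G : Space N → ℝ} (hα : α ∈ Ioo (0 : ℝ) 1)
    (hu : IsSolution α T (fun _ p => G p) u₀ u) (hC : 0 ≤ C)
    (hG : ∀ p q, |G p - G q| ≤ C * ‖p - q‖) (hL : 0 ≤ L)
    (hu₀ : ∀ x y, |u₀ x - u₀ y| ≤ L * ‖x - y‖) (x y : Space N) {t : ℝ} (ht : t ∈ Icc 0 T) :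
    u x t - u y t ≤ L * ‖x - y‖ := by
  have hinit := hu.initial
  obtain ⟨hcont, ⟨M, hM⟩, hsub, hsup⟩ := hu
  have hshift : Continuous fun ξ : Space N × ℝ => (ξ.1 + (x - y), ξ.2) := by fun_prop
  simpa using sub_le_of_testsSub_testsSuper (u := fun z s => u (z + (x - y)) s) (e := 0)
    (d := L * ‖x - y‖) hα (hcont.comp hshift.continuousOn fun ξ hξ => ⟨mem_univ _, hξ.2⟩) hcont
    (fun z s hs => ⟨hM _ s hs, hM z s hs⟩) (TestsSub.translate hsub.2.2 (x - y)) hsup.2.2 hC hL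
    le_rfl
    (fun z z' p q => by
      have := (le_abs_self _).trans (hG p q)
      have := mul_nonneg hC (norm_nonneg (z - z'))
      linarith)
    (fun z z' => by
      rw [hinit, hinit]
      have := (le_abs_self _).trans (hu₀ (z + (x - y)) z')
      rw [show z + (x - y) - z' = (x - y) + (z - z') by abel] at this
      linarith [mul_le_mul_of_nonneg_left (norm_add_le (x - y) (z - z')) hL]) y ht

end APriori

/-! ### Stationary problems -/

section Stationary

variable {N : ℕ} {G : Space N → ℝ → Space N → ℝ} {F : Space N → Space N → ℝ} {v w : Space N → ℝ}

/-- The test-function condition for viscosity subsolutions of `G(y, v(y), Dv(y)) = 0`. -/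
def StationarySub (G : Space N → ℝ → Space N → ℝ) (v : Space N → ℝ) : Prop :=
  ∀ φ : Space N → ℝ, ContDiff ℝ 1 φ → ∀ y, IsLocalMax (fun z => v z - φ z) y →
    G y (v y) (gradient φ y) ≤ 0

/-- The test-function condition for viscosity supersolutions of `G(y, v(y), Dv(y)) = 0`. -/
def StationarySuper (G : Space N → ℝ → Space N → ℝ) (v : Space N → ℝ) : Prop :=
  ∀ φ : Space N → ℝ, ContDiff ℝ 1 φ → ∀ y, IsLocalMin (fun z => v z - φ z) y →
    0 ≤ G y (v y) (gradient φ y)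

lemma IsStationarySolution.stationarySub (hv : IsStationarySolution G v) : StationarySub G v :=
  hv.2.1

lemma IsStationarySolution.stationarySuper (hv : IsStationarySolution G v) :
    StationarySuper G v :=
  hv.2.2

lemma StationarySub.neg (hv : StationarySub G v) :
    StationarySuper (fun y r q => -G y (-r) (-q)) fun y => -v y := by
  intro φ hφ y hy
  have := hv (fun z => -φ z) hφ.neg y (by
    filter_upwards [hy] with z hz
    linarith)
  rw [gradient_fun_neg] at this
  simpa using this

lemma StationarySuper.neg (hv : StationarySuper G v) :
    StationarySub (fun y r q => -G y (-r) (-q)) fun y => -v y := by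
  intro φ hφ y hy
  have := hv (fun z => -φ z) hφ.neg y (by
    filter_upwards [hy] with z hz
    linarith)
  rw [gradient_fun_neg] at this
  simpa using this

lemma StationarySub.add_const (hv : StationarySub G v) (k : ℝ) :
    StationarySub (fun y r q => G y (r - k) q) fun y => v y + k := by
  intro φ hφ y hy
  have := hv φ hφ y (by
    filter_upwards [hy] with z hz
    linarith)
  simpa using this

lemma StationarySuper.add_const (hv : StationarySuper G v) (k : ℝ) :
    StationarySuper (fun y r q => G y (r - k) q) fun y => v y + k := by
  intro φ hφ y hy
  have := hv φ hφ y (by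
    filter_upwards [hy] with z hz
    linarith)
  simpa using this

lemma StationarySuper.nonneg_of_forall_le (hv : StationarySuper G v) {z : Space N}
    (hz : ∀ y, v z ≤ v y) : 0 ≤ G z (v z) 0 := by
  have hgrad : gradient (fun _ : Space N => (0 : ℝ)) z = 0 :=
    gradient_eq_zero_of_isLocalExtr (Or.inl (Eventually.of_forall fun _ => le_rfl))
  have := hv (fun _ => 0) contDiff_const z (Eventually.of_forall fun y => by simpa using hz y)
  rwa [hgrad] at this

lemma IsStationarySolution.translate (hv : IsStationarySolution G v) (h : Space N) :
    IsStationarySolution (fun y => G (y + h)) fun y => v (y + h) := by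
  have htest (φ : Space N → ℝ) (hφ : ContDiff ℝ 1 φ) : ContDiff ℝ 1 fun z => φ (z - h) := by
    fun_prop
  have hgrad (φ : Space N → ℝ) (y : Space N) :
      gradient (fun z => φ (z - h)) (y + h) = gradient φ y := by
    rw [gradient, fderiv_comp_sub, add_sub_cancel_right, gradient]
  have hlim (y : Space N) : Tendsto (fun z => z - h) (𝓝 (y + h)) (𝓝 y) := by
    simpa using (continuous_sub_right h).tendsto (y + h)
  refine ⟨by have := hv.1; fun_prop, fun φ hφ y hy => ?_, fun φ hφ y hy => ?_⟩
  · rw [← hgrad]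
    refine hv.2.1 _ (htest φ hφ) _ ?_
    filter_upwards [hlim y hy] with z hz
    simpa using hz
  · rw [← hgrad]
    refine hv.2.2 _ (htest φ hφ) _ ?_
    filter_upwards [hlim y hy] with z hz
    simpa using hz

lemma StationarySub.le_of_quadratic_max (hv : StationarySub G v) {a : ℝ} {x₀ y₀ : Space N}
    (hmax : ∀ x, v x - a / 2 * ‖x - y₀‖ ^ 2 ≤ v x₀ - a / 2 * ‖x₀ - y₀‖ ^ 2) :
    G x₀ (v x₀) (a • (x₀ - y₀)) ≤ 0 := by
  have hgrad := hasGradientAt_const_mul (a / 2) (hasGradientAt_norm_sub_sq y₀ x₀)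
  rw [smul_smul, div_mul_cancel₀ a two_ne_zero] at hgrad
  rw [← hgrad.gradient]
  exact hv _ (contDiff_const.mul ((contDiff_id.sub contDiff_const).norm_sq ℝ)) x₀
    (Eventually.of_forall hmax)

lemma StationarySuper.le_of_quadratic_min (hw : StationarySuper G w) {a b : ℝ} {x₀ y₀ : Space N}
    (hmin : ∀ y, w y₀ + a / 2 * ‖x₀ - y₀‖ ^ 2 + b / 2 * ‖y₀‖ ^ 2 ≤
      w y + a / 2 * ‖x₀ - y‖ ^ 2 + b / 2 * ‖y‖ ^ 2) :
    0 ≤ G y₀ (w y₀) (a • (x₀ - y₀) - b • y₀) := by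
  have hgrad := hasGradientAt_add
    (hasGradientAt_const_mul (-(a / 2)) (hasGradientAt_norm_sub_sq x₀ y₀))
    (hasGradientAt_const_mul (-(b / 2)) (hasGradientAt_norm_sub_sq 0 y₀))
  have hsmooth (c : Space N) : ContDiff ℝ 1 fun y => ‖y - c‖ ^ 2 :=
    (contDiff_id.sub contDiff_const).norm_sq ℝ
  rw [show a • (x₀ - y₀) - b • y₀ =
    -(a / 2) • (2 : ℝ) • (y₀ - x₀) + -(b / 2) • (2 : ℝ) • (y₀ - 0) by module, ← hgrad.gradient]
  refine hw _ ((contDiff_const.mul (hsmooth _)).add (contDiff_const.mul (hsmooth _))) y₀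
    (Eventually.of_forall fun y => ?_)
  simp only [sub_zero, norm_sub_rev _ x₀]
  linarith [hmin y]

lemma mul_sub_le_of_stationarySub_stationarySuper {l C d : ℝ} {F' : Space N → Space N → ℝ}
    (hl : 0 < l) (hv : Continuous v) (hvM : ∃ M, ∀ y, |v y| ≤ M) (hw : Continuous w)
    (hwM : ∃ M, ∀ y, |w y| ≤ M) (hsub : StationarySub (fun y r q => l * r + F y q) v)
    (hsup : StationarySuper (fun y r q => l * r + F' y q) w)
    (hF : ∀ x y p q, F' y p - F x q ≤ d + C * (‖x - y‖ + ‖p - q‖)) (y : Space N) :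
    l * (v y - w y) ≤ d := by
  obtain ⟨M, hM⟩ := hvM
  obtain ⟨M', hM'⟩ := hwM
  rw [← le_div_iff₀' hl]
  refine sub_le_of_forall_quadratic_max (Y := Unit) (S := univ) isCompact_univ
    (u := fun x _ => v x) (w := fun x _ => w x) (M := max M M') (B := C / l)
    (hv.comp continuous_fst).continuousOn (hw.comp continuous_fst).continuousOn
    (fun x _ _ => ⟨(hM x).trans (le_max_left _ _), (hM' x).trans (le_max_right _ _)⟩)
    (fun a _ b hb x₀ y₀ _ _ hmax => ?_) y (mem_univ ())
  have hle := hsub.le_of_quadratic_max (a := a) (x₀ := x₀) (y₀ := y₀) fun x => by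
    linarith [hmax x y₀ () (mem_univ _)]
  have hge := hsup.le_of_quadratic_min (a := a) (b := b) (x₀ := x₀) (y₀ := y₀) fun y => by
    linarith [hmax x₀ y () (mem_univ _)]
  have hFF := hF x₀ y₀ (a • (x₀ - y₀) - b • y₀) (a • (x₀ - y₀))
  rw [sub_sub_cancel_left, norm_neg, norm_smul_of_nonneg hb.le] at hFF
  rw [div_mul_eq_mul_div, ← add_div, le_div_iff₀' hl]
  linarith

section Corrector

variable {l C c O : ℝ} (hl : 0 < l)
  (hF : ∀ x y p q, |F x p - F y q| ≤ C * (‖x - y‖ + ‖p - q‖)) (hv : Continuous v)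
  (hvM : ∃ M, ∀ y, |v y| ≤ M) (hw : Continuous w) (hwM : ∃ M, ∀ y, |w y| ≤ M)
  (hO : ∀ x y, w x - w y ≤ O)
include hl hF hv hvM hw hwM hO

lemma mul_add_le_of_stationarySuper (hsub : StationarySub (fun y r q => l * r + F y q) v)
    (hsup : StationarySuper (fun y _ q => F y q - c) w) (y : Space N) : l * v y + c ≤ l * O := by
  -- The constant is chosen so that `w + k ≥ -c / l` everywhere.
  let k := O - w y - c / l
  have hsup' : StationarySuper (fun y r q => l * r + F y q) fun y => w y + k := by
    intro φ hφ z hz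
    have := hsup.add_const k φ hφ z hz
    have hwz := mul_le_mul_of_nonneg_left (hO y z) hl.le
    have : l * (c / l) = c := mul_div_cancel₀ c hl.ne'
    linarith
  obtain ⟨M, hM⟩ := hwM
  have hle := mul_sub_le_of_stationarySub_stationarySuper (w := fun z => w z + k) (d := 0) hl hv
    hvM (hw.add continuous_const) ⟨M + |k|, fun z => (abs_add_le _ _).trans (by linarith [hM z])⟩
    hsub hsup' (fun x z p q => by
      have := (le_abs_self _).trans (hF z x p q)
      rw [norm_sub_rev] at this
      linarith) y
  have : l * (c / l) = c := mul_div_cancel₀ c hl.ne'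
  linarith

lemma neg_mul_le_mul_add_of_stationarySub
    (hsup : StationarySuper (fun y r q => l * r + F y q) v)
    (hsub : StationarySub (fun y _ q => F y q - c) w) (y : Space N) :
    -(l * O) ≤ l * v y + c := by
  have hbdd {f : Space N → ℝ} (hf : ∃ M, ∀ y, |f y| ≤ M) : ∃ M, ∀ y, |-f y| ≤ M := by
    simpa only [abs_neg] using hf
  have := mul_add_le_of_stationarySuper (F := fun y q => -F y (-q)) (c := -c) (O := O)
    (v := fun y => -v y) (w := fun y => -w y) hl
    (fun x z p q => by
      have := hF x z (-p) (-q)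
      rwa [← neg_sub', norm_neg, abs_sub_comm, ← neg_sub_neg] at this)
    hv.neg (hbdd hvM) hw.neg (hbdd hwM) (fun x z => by linarith [hO z x])
    (fun φ hφ z hz => by
      have := hsup.neg φ hφ z hz
      simp only at this ⊢
      linarith)
    (fun φ hφ z hz => by
      have := hsub.neg φ hφ z hz
      simp only at this ⊢
      linarith) y
  linarith

end Corrector

end Stationary

section LipschitzBound

lemma smoothDist_le_add {E : Type*} [NormedAddCommGroup E] {d : ℝ} (hd : 0 ≤ d) (c x : E) :
    smoothDist d c x ≤ ‖x - c‖ + d :=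
  Real.sqrt_le_iff.2 ⟨by positivity, by
    linarith [mul_nonneg (norm_nonneg (x - c)) hd, add_sq ‖x - c‖ d]⟩

variable {E : Type*} [NormedAddCommGroup E] [InnerProductSpace ℝ E] [ProperSpace E] {v : E → ℝ}

lemma exists_forall_sub_smoothDist_le {A M d : ℝ} (hA : 0 < A) (hd : 0 < d) (hv : Continuous v)
    (hM : ∀ x, |v x| ≤ M) (y : E) :
    ∃ z, ∀ x, v x - A * smoothDist d y x ≤ v z - A * smoothDist d y z := by
  have hcont : Continuous fun x => v x - A * smoothDist d y x :=
    hv.sub (continuous_const.mul (contDiff_smoothDist hd y (n := 1)).continuous)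
  obtain ⟨z, -, hz⟩ := exists_isMaxOn_of_superlevel_subset (s := univ) (x₀ := y)
    (isCompact_closedBall y (2 * M / A + d)) hcont.continuousOn (mem_univ y)
    fun x _ hx => by
      rw [smoothDist_self hd.le] at hx
      rw [Metric.mem_closedBall, dist_eq_norm, div_add' _ _ _ hA.ne', le_div_iff₀' hA]
      linarith [(abs_le.1 (hM x)).2, (abs_le.1 (hM y)).1,
        mul_le_mul_of_nonneg_left (norm_sub_le_smoothDist d y x) hA.le]
  exact ⟨z, fun x => isMaxOn_iff.1 hz x (mem_univ x)⟩

lemma exists_norm_sub_le_and_le_add {A L M d : ℝ} (hA : 0 < A) (hL : 0 ≤ L) (hLA : L < A)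
    (hd : 0 < d) (hv : Continuous v) (hM : ∀ x, |v x| ≤ M)
    (h : ∀ φ : E → ℝ, ContDiff ℝ 1 φ → ∀ y, IsLocalMax (fun z => v z - φ z) y →
      ‖gradient φ y‖ ≤ L) (x y : E) :
    ∃ z, ‖z - y‖ ≤ L / (A - L) * d ∧ v x ≤ v z + A * (‖x - y‖ + d) := by
  obtain ⟨z, hz⟩ := exists_forall_sub_smoothDist_le hA hd hv hM y
  have hs := smoothDist_pos hd y z
  refine ⟨z, ?_, ?_⟩
  · have hgrad := h _ (contDiff_const.mul (contDiff_smoothDist hd y)) z (Eventually.of_forall hz)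
    rw [(hasGradientAt_const_mul A (hasGradientAt_smoothDist hd y z)).gradient,
      norm_smul_of_nonneg hA.le, norm_smul_of_nonneg (inv_pos.2 hs).le, mul_left_comm,
      inv_mul_le_iff₀ hs] at hgrad
    rw [div_mul_eq_mul_div, le_div_iff₀ (sub_pos.2 hLA)]
    linarith [mul_le_mul_of_nonneg_right (smoothDist_le_add hd.le y z) hL]
  · linarith [hz x, mul_pos hA hs, mul_le_mul_of_nonneg_left (smoothDist_le_add hd.le y x) hA.le]

/-- A bounded continuous function whose test functions from above have bounded gradients is
Lipschitz continuous: its maxima relative to a cone steeper than the bound are at the vertex. -/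
lemma sub_le_mul_norm_of_gradient_le {L M : ℝ} (hL : 0 ≤ L) (hv : Continuous v)
    (hM : ∀ x, |v x| ≤ M)
    (h : ∀ φ : E → ℝ, ContDiff ℝ 1 φ → ∀ y, IsLocalMax (fun z => v z - φ z) y →
      ‖gradient φ y‖ ≤ L) (x y : E) : v x - v y ≤ L * ‖x - y‖ := by
  have hsteep (A : ℝ) (hA : L < A) : v x - v y ≤ A * ‖x - y‖ := by
    have hd : Tendsto (fun k : ℕ => ((k : ℝ) + 1)⁻¹) atTop (𝓝 0) :=
      tendsto_inv_atTop_zero.comp (tendsto_natCast_atTop_atTop.atTop_add tendsto_const_nhds)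
    choose z hz hvz using fun k : ℕ => exists_norm_sub_le_and_le_add (hL.trans_lt hA) hL hA
      (by positivity : 0 < ((k : ℝ) + 1)⁻¹) hv hM h x y
    have hzy : Tendsto z atTop (𝓝 y) := tendsto_iff_norm_sub_tendsto_zero.2
      (squeeze_zero (fun _ => norm_nonneg _) hz (by simpa using hd.const_mul (L / (A - L))))
    have := ge_of_tendsto' (((hv.tendsto y).comp hzy).add ((hd.const_add ‖x - y‖).const_mul A)) hvz
    rw [add_zero] at this
    linarith
  refine ge_of_tendsto (((continuous_mul_const ‖x - y‖).tendsto L).mono_left nhdsWithin_le_nhds)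
    (?_ : ∀ᶠ A in 𝓝[>] L, _)
  filter_upwards [self_mem_nhdsWithin] with A hA using hsteep A hA

end LipschitzBound

section Stability

variable {ι : Type*} {Λ : ℝ} {l : Filter ι}

lemma tendsto_apply_of_forall_abs_sub_le {E : Type*} [SeminormedAddCommGroup E] {f : ι → E → ℝ}
    {g : E → ℝ} {y : ι → E} {z : E} (hf : ∀ i x y, |f i x - f i y| ≤ Λ * ‖x - y‖)
    (hlim : Tendsto (fun i => f i z) l (𝓝 (g z))) (hy : Tendsto y l (𝓝 z)) :
    Tendsto (fun i => f i (y i)) l (𝓝 (g z)) := by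
  have hdiff : Tendsto (fun i => f i (y i) - f i z) l (𝓝 0) :=
    squeeze_zero_norm (fun i => hf i _ _)
      (by simpa using (tendsto_iff_norm_sub_tendsto_zero.1 hy).const_mul Λ)
  simpa using hdiff.add hlim

lemma continuous_of_forall_abs_sub_le {E : Type*} [SeminormedAddCommGroup E] {f : E → ℝ}
    (hf : ∀ x y, |f x - f y| ≤ Λ * ‖x - y‖) : Continuous f :=
  (LipschitzWith.of_dist_le_mul (K := Λ.toNNReal) fun x y => by
    rw [Real.dist_eq, dist_eq_norm]
    exact (hf x y).trans
      (mul_le_mul_of_nonneg_right (Real.le_coe_toNNReal Λ) (norm_nonneg _))).continuous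

lemma exists_tendsto_isLocalMax {E : Type*} [NormedAddCommGroup E] [ProperSpace E]
    {f : ι → E → ℝ} {g φ : E → ℝ} (hf : ∀ i x y, |f i x - f i y| ≤ Λ * ‖x - y‖)
    (hlim : ∀ y, Tendsto (fun i => f i y) l (𝓝 (g y))) (hφ : Continuous φ) {y : E}
    (hy : IsLocalMax (fun z => g z - φ z) y) :
    ∃ y' : ι → E, Tendsto y' l (𝓝 y) ∧
      ∀ᶠ i in l, IsLocalMax (fun z => f i z - (φ z + ‖z - y‖ ^ 2)) (y' i) := by
  obtain ⟨r, hr, hball⟩ := Metric.eventually_nhds_iff_ball.1 hy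
  have hcomp := isCompact_closedBall y (r / 2)
  have hymem : y ∈ Metric.closedBall y (r / 2) := Metric.mem_closedBall_self (half_pos hr).le
  have hmax (i : ι) : ∃ z ∈ Metric.closedBall y (r / 2),
      IsMaxOn (fun z => f i z - (φ z + ‖z - y‖ ^ 2)) (Metric.closedBall y (r / 2)) z := by
    have := continuous_of_forall_abs_sub_le (hf i)
    exact hcomp.exists_isMaxOn ⟨y, hymem⟩ (by fun_prop)
  choose y' hmem hmax using hmax
  have hyy' : Tendsto y' l (𝓝 y) := by
    refine hcomp.tendsto_nhds_of_unique_mapClusterPt (Eventually.of_forall hmem)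
      fun z hz hcluster => ?_
    obtain ⟨U, hU, hUz⟩ := mapClusterPt_iff_ultrafilter.1 hcluster
    have hle : g y - φ y ≤ g z - (φ z + ‖z - y‖ ^ 2) :=
      le_of_tendsto_of_tendsto' (((hlim y).mono_left hU).sub_const (φ y))
        ((tendsto_apply_of_forall_abs_sub_le hf ((hlim z).mono_left hU) hUz).sub
          (((hφ.tendsto z).comp hUz).add ((hUz.sub_const y).norm.pow 2)))
        fun i => by simpa using isMaxOn_iff.1 (hmax i) y hymem
    have hgz := hball z (Metric.closedBall_subset_ball (half_lt_self hr) hz)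
    have : ‖z - y‖ ^ 2 = 0 := le_antisymm (by linarith) (sq_nonneg _)
    exact sub_eq_zero.1 (norm_eq_zero.1 (pow_eq_zero_iff two_ne_zero |>.1 this))
  refine ⟨y', hyy', ?_⟩
  filter_upwards [hyy'.eventually (Metric.ball_mem_nhds y (half_pos hr))] with i hi
  exact (hmax i).isLocalMax (mem_of_superset (Metric.isOpen_ball.mem_nhds hi)
    Metric.ball_subset_closedBall)

variable {N : ℕ} {G : Space N → ℝ → Space N → ℝ} {G' : ι → Space N → ℝ → Space N → ℝ}
  {v : Space N → ℝ} {v' : ι → Space N → ℝ}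

lemma StationarySub.of_tendsto [l.NeBot] (hsub : ∀ i, StationarySub (G' i) (v' i))
    (hv' : ∀ i x y, |v' i x - v' i y| ≤ Λ * ‖x - y‖)
    (hv : ∀ y, Tendsto (fun i => v' i y) l (𝓝 (v y)))
    (hG : ∀ y r q, Tendsto (fun ξ : ι × Space N × ℝ × Space N => G' ξ.1 ξ.2.1 ξ.2.2.1 ξ.2.2.2)
      (l ×ˢ 𝓝 (y, r, q)) (𝓝 (G y r q))) : StationarySub G v := by
  intro φ hφ y hy
  obtain ⟨y', hy', hmax⟩ := exists_tendsto_isLocalMax hv' hv hφ.continuous hy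
  have hgrad (z : Space N) : gradient (fun z => φ z + ‖z - y‖ ^ 2) z =
      gradient φ z + (2 : ℝ) • (z - y) :=
    (hasGradientAt_add (hφ.differentiable one_ne_zero z).hasGradientAt
      (hasGradientAt_norm_sub_sq y z)).gradient
  have hcont : Continuous fun z => gradient φ z + (2 : ℝ) • (z - y) :=
    (((InnerProductSpace.toDual ℝ (Space N)).symm.continuous.comp
      (hφ.continuous_fderiv one_ne_zero))).add (by fun_prop)
  have hq : Tendsto (fun i => gradient φ (y' i) + (2 : ℝ) • (y' i - y)) l (𝓝 (gradient φ y)) := by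
    simpa [Function.comp_def] using (hcont.tendsto y).comp hy'
  refine le_of_tendsto ((hG y (v y) (gradient φ y)).comp (tendsto_id.prodMk (hy'.prodMk_nhds
    ((tendsto_apply_of_forall_abs_sub_le hv' (hv y) hy').prodMk_nhds hq)))) ?_
  filter_upwards [hmax] with i hi
  have hsmooth : ContDiff ℝ 1 fun z => φ z + ‖z - y‖ ^ 2 :=
    hφ.add ((contDiff_id.sub contDiff_const).norm_sq ℝ)
  have := hsub i _ hsmooth (y' i) hi
  rwa [hgrad] at this

lemma StationarySuper.of_tendsto [l.NeBot] (hsup : ∀ i, StationarySuper (G' i) (v' i))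
    (hv' : ∀ i x y, |v' i x - v' i y| ≤ Λ * ‖x - y‖)
    (hv : ∀ y, Tendsto (fun i => v' i y) l (𝓝 (v y)))
    (hG : ∀ y r q, Tendsto (fun ξ : ι × Space N × ℝ × Space N => G' ξ.1 ξ.2.1 ξ.2.2.1 ξ.2.2.2)
      (l ×ˢ 𝓝 (y, r, q)) (𝓝 (G y r q))) : StationarySuper G v := by
  have hneg := StationarySub.of_tendsto (l := l) (fun i => (hsup i).neg)
    (fun i x y => by rw [neg_sub_neg, abs_sub_comm]; exact hv' i x y) (fun y => (hv y).neg)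
    (G := fun y r q => -G y (-r) (-q)) fun y r q => ((hG y (-r) (-q)).comp
      (tendsto_fst.prodMk (((by fun_prop : Continuous fun ξ : Space N × ℝ × Space N =>
        (ξ.1, -ξ.2.1, -ξ.2.2)).tendsto (y, r, q)).comp tendsto_snd))).neg
  simpa using hneg.neg

end Stability

lemma exists_tendsto_of_abs_le {ι : Type*} (U : Ultrafilter ι) {a : ι → ℝ} {B : ℝ}
    (ha : ∀ i, |a i| ≤ B) : ∃ b, Tendsto a U (𝓝 b) := by
  obtain ⟨b, -, hb⟩ := (isCompact_Icc (a := -B) (b := B)).ultrafilter_le_nhds (U.map a)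
    (tendsto_principal.2 (Eventually.of_forall fun i => abs_le.1 (ha i)))
  exact ⟨b, hb⟩

section Periodic

variable {N : ℕ} {v : Space N → ℝ}

lemma exists_norm_add_latticeVec_le (y : Space N) :
    ∃ k : Fin N → ℤ, ‖y + latticeVec k‖ ≤ √N := by
  refine ⟨fun i => -⌊y i⌋, (EuclideanSpace.norm_eq _).trans_le (Real.sqrt_le_sqrt ?_)⟩
  have hfract (i : Fin N) : (y + latticeVec fun i => -⌊y i⌋) i = Int.fract (y i) := by
    simp [latticeVec, Int.fract, sub_eq_add_neg]
  calc ∑ i, ‖(y + latticeVec fun i => -⌊y i⌋) i‖ ^ 2 ≤ ∑ _i : Fin N, (1 : ℝ) := by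
        refine Finset.sum_le_sum fun i _ => ?_
        rw [hfract, Real.norm_of_nonneg (Int.fract_nonneg _)]
        exact pow_le_one₀ (Int.fract_nonneg _) (Int.fract_lt_one _).le
    _ = N := by simp

lemma exists_forall_le_of_periodic (hv : Continuous v)
    (hper : ∀ y (k : Fin N → ℤ), v (y + latticeVec k) = v y) : ∃ z, ∀ y, v z ≤ v y := by
  obtain ⟨z, -, hz⟩ := (isCompact_closedBall (0 : Space N) √N).exists_isMinOn
    ⟨0, Metric.mem_closedBall_self (Real.sqrt_nonneg _)⟩ hv.continuousOn
  refine ⟨z, fun y => ?_⟩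
  obtain ⟨k, hk⟩ := exists_norm_add_latticeVec_le y
  rw [← hper y k]
  exact isMinOn_iff.1 hz _ (mem_closedBall_zero_iff.2 hk)

lemma exists_abs_le_of_periodic (hv : Continuous v)
    (hper : ∀ y (k : Fin N → ℤ), v (y + latticeVec k) = v y) : ∃ M, ∀ y, |v y| ≤ M := by
  obtain ⟨z, hz⟩ := exists_forall_le_of_periodic (v := fun y => -|v y|) hv.abs.neg
    fun y k => by rw [hper]
  exact ⟨|v z|, fun y => neg_le_neg_iff.1 (hz y)⟩

lemma sub_le_of_periodic {Λ : ℝ} (hΛ : 0 ≤ Λ)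
    (hper : ∀ y (k : Fin N → ℤ), v (y + latticeVec k) = v y)
    (hv : ∀ x y, v x - v y ≤ Λ * ‖x - y‖) (x y : Space N) : v x - v y ≤ Λ * (2 * √N) := by
  obtain ⟨k, hk⟩ := exists_norm_add_latticeVec_le x
  obtain ⟨j, hj⟩ := exists_norm_add_latticeVec_le y
  rw [← hper x k, ← hper y j]
  refine (hv _ _).trans (mul_le_mul_of_nonneg_left ?_ hΛ)
  linarith [norm_sub_le (x + latticeVec k) (y + latticeVec j)]

end Periodic

/-! ### The discounted and the cell problem -/

/-- The quantitative content of the assumptions on a Hamiltonian: a Lipschitz constant `C`, a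
constant `c₀` for the linear growth from below, and a bound `S` on `H(·, 0)`, which exists by
periodicity. -/
structure HamiltonianBounds {N : ℕ} (H : Space N → Space N → ℝ) (C c₀ S : ℝ) : Prop where
  C_nonneg : 0 ≤ C
  c₀_pos : 0 < c₀
  lipschitz : ∀ x y p q, |H x p - H y q| ≤ C * (‖x - y‖ + ‖p - q‖)
  growth : ∀ x p, c₀⁻¹ * ‖p‖ - c₀ ≤ H x p
  abs_zero_le : ∀ x, |H x 0| ≤ S
  periodic : ∀ (y p : Space N) (k : Fin N → ℤ), H (y + latticeVec k) p = H y p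

lemma Assumptions.exists_bounds {N : ℕ} {H : Space N → Space N → ℝ} {u₀ : Space N → ℝ}
    (hA : Assumptions H u₀) : ∃ C c₀ S, HamiltonianBounds H C c₀ S := by
  obtain ⟨C, hC, hlip⟩ := hA.lipschitz
  obtain ⟨c₀, hc₀, hgrowth⟩ := hA.linear_growth
  obtain ⟨S, hS⟩ := exists_abs_le_of_periodic (v := fun y => H y 0)
    (hA.continuous.comp (Continuous.prodMk_left 0)) fun y k => hA.periodic y 0 k
  exact ⟨C, c₀, S, hC.le, hc₀, hlip, hgrowth, hS, hA.periodic⟩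

/-- With `HamiltonianBounds H C c₀ S`, the solutions of the discounted and of the cell problem at
`P` have the Lipschitz constant `lipConst C c₀ S * (1 + ‖P‖)`. -/
def lipConst (C c₀ S : ℝ) : ℝ := c₀ * (c₀ + S + C) + 1

namespace HamiltonianBounds

variable {N : ℕ} {H : Space N → Space N → ℝ} {C c₀ S l c d : ℝ} {P Q : Space N}
  {v w : Space N → ℝ}

lemma S_nonneg (hH : HamiltonianBounds H C c₀ S) : 0 ≤ S :=
  (abs_nonneg _).trans (hH.abs_zero_le 0)

lemma lipConst_nonneg (hH : HamiltonianBounds H C c₀ S) : 0 ≤ lipConst C c₀ S := by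
  have := hH.C_nonneg
  have := hH.c₀_pos
  have := hH.S_nonneg
  unfold lipConst
  positivity

lemma abs_apply_le (hH : HamiltonianBounds H C c₀ S) (y p : Space N) :
    |H y p| ≤ S + C * ‖p‖ := by
  have := hH.lipschitz y y p 0
  rw [sub_self, norm_zero, zero_add, sub_zero] at this
  linarith [abs_sub_abs_le_abs_sub (H y p) (H y 0), hH.abs_zero_le y]

lemma lipschitz_add (hH : HamiltonianBounds H C c₀ S) (P x y p q : Space N) :
    |H x (P + p) - H y (P + q)| ≤ C * (‖x - y‖ + ‖p - q‖) := by
  simpa using hH.lipschitz x y (P + p) (P + q)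

lemma continuous_add (hH : HamiltonianBounds H C c₀ S) (P : Space N) :
    Continuous fun ξ : Space N × ℝ × Space N => H ξ.1 (P + ξ.2.2) := by
  have hcont : Continuous (Function.uncurry H) := continuous_of_forall_abs_sub_le fun ξ η => by
    have hξ := mul_le_mul_of_nonneg_left (add_le_add (norm_fst_le (ξ - η)) (norm_snd_le (ξ - η)))
      hH.C_nonneg
    rw [← two_mul, ← mul_assoc] at hξ
    exact (hH.lipschitz _ _ _ _).trans hξ
  exact hcont.comp (by fun_prop : Continuous fun ξ : Space N × ℝ × Space N => (ξ.1, P + ξ.2.2))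

lemma norm_le_of_le (hH : HamiltonianBounds H C c₀ S) {y q : Space N}
    (h : H y (P + q) ≤ S + C * ‖P‖) : ‖q‖ ≤ lipConst C c₀ S * (1 + ‖P‖) := by
  have hsum : ‖P + q‖ ≤ c₀ * (c₀ + S + C * ‖P‖) := by
    rw [← inv_mul_le_iff₀ hH.c₀_pos]
    linarith [hH.growth y (P + q)]
  have hq := norm_sub_le (P + q) P
  rw [add_sub_cancel_left] at hq
  have := mul_nonneg hH.c₀_pos.le hH.C_nonneg
  have := mul_nonneg (mul_nonneg hH.c₀_pos.le (add_nonneg hH.c₀_pos.le hH.S_nonneg))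
    (norm_nonneg P)
  unfold lipConst
  linarith

lemma mul_discounted_sub_le (hH : HamiltonianBounds H C c₀ S) (hl : 0 < l)
    (hv : IsDiscountedSolution H l P v) (hw : IsDiscountedSolution H l Q w) (y : Space N) :
    l * (v y - w y) ≤ C * ‖P - Q‖ := by
  refine mul_sub_le_of_stationarySub_stationarySuper (C := C) hl hv.2.1 hv.1 hw.2.1 hw.1
    hv.2.stationarySub hw.2.stationarySuper
    (fun x z p q => ?_) y
  have hle := (le_abs_self _).trans (hH.lipschitz z x (Q + p) (P + q))
  have hnorm : ‖Q + p - (P + q)‖ ≤ ‖P - Q‖ + ‖p - q‖ := by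
    rw [add_sub_add_comm, norm_sub_rev P Q]
    exact norm_add_le _ _
  rw [norm_sub_rev z x] at hle
  linarith [mul_le_mul_of_nonneg_left hnorm hH.C_nonneg]

lemma discounted_periodic (hH : HamiltonianBounds H C c₀ S) (hl : 0 < l)
    (hv : IsDiscountedSolution H l P v) (y : Space N) (k : Fin N → ℤ) :
    v (y + latticeVec k) = v y := by
  have htranslate : IsDiscountedSolution H l P fun y => v (y + latticeVec k) := by
    have := hv.2.translate (latticeVec k)
    simp only [hH.periodic] at this
    exact ⟨hv.1.imp fun M hM y => hM _, this⟩
  have hle := hH.mul_discounted_sub_le hl htranslate hv y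
  have hge := hH.mul_discounted_sub_le hl hv htranslate y
  rw [sub_self, norm_zero, mul_zero] at hle hge
  exact le_antisymm (sub_nonpos.1 (nonpos_of_mul_nonpos_right hle hl))
    (sub_nonpos.1 (nonpos_of_mul_nonpos_right hge hl))

lemma abs_mul_discounted_le (hH : HamiltonianBounds H C c₀ S) (hl : 0 < l)
    (hv : IsDiscountedSolution H l P v) (y : Space N) : |l * v y| ≤ S + C * ‖P‖ := by
  have hgrad (φ : Space N → ℝ) (z : Space N)
      (h : IsLocalExtr (fun z => 0 - φ z) z) : gradient φ z = 0 :=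
    gradient_eq_zero_of_isLocalExtr (by simpa using h.neg)
  have hzero : ∃ M, ∀ _ : Space N, |(0 : ℝ)| ≤ M := ⟨0, fun _ => abs_zero.le⟩
  have hle := mul_add_le_of_stationarySuper (w := fun _ => 0) (c := -(S + C * ‖P‖)) (O := 0) hl
    (hH.lipschitz_add P) hv.2.1 hv.1 continuous_const hzero (fun _ _ => (sub_zero 0).le)
    hv.2.stationarySub
    (fun φ _ z hz => by
      simp only [hgrad φ z (Or.inl hz), add_zero]
      linarith [(abs_le.1 (hH.abs_apply_le z P)).1]) y
  have hge := neg_mul_le_mul_add_of_stationarySub (w := fun _ => 0) (c := S + C * ‖P‖) (O := 0)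
    hl (hH.lipschitz_add P) hv.2.1 hv.1 continuous_const hzero (fun _ _ => (sub_zero 0).le)
    hv.2.stationarySuper
    (fun φ _ z hz => by
      simp only [hgrad φ z (Or.inr hz), add_zero]
      linarith [(abs_le.1 (hH.abs_apply_le z P)).2]) y
  exact abs_le.2 ⟨by linarith, by linarith⟩

lemma discounted_sub_le (hH : HamiltonianBounds H C c₀ S) (hl : 0 < l)
    (hv : IsDiscountedSolution H l P v) (x y : Space N) :
    v x - v y ≤ lipConst C c₀ S * (1 + ‖P‖) * ‖x - y‖ := by
  obtain ⟨M, hM⟩ := hv.1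
  refine sub_le_mul_norm_of_gradient_le
    (mul_nonneg hH.lipConst_nonneg (by positivity)) hv.2.1 hM (fun φ hφ z hz => ?_) x y
  have := hv.2.2.1 φ hφ z hz
  exact hH.norm_le_of_le (y := z) (by linarith [(abs_le.1 (hH.abs_mul_discounted_le hl hv z)).1])

lemma corrector_sub_le (hH : HamiltonianBounds H C c₀ S)
    (hper : ∀ y (k : Fin N → ℤ), w (y + latticeVec k) = w y)
    (hw : IsStationarySolution (fun y _ q => H y (P + q) - c) w) (x y : Space N) :
    w x - w y ≤ lipConst C c₀ S * (1 + ‖P‖) * (2 * √N) := by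
  have hΛ : 0 ≤ lipConst C c₀ S * (1 + ‖P‖) := mul_nonneg hH.lipConst_nonneg (by positivity)
  obtain ⟨M, hM⟩ := exists_abs_le_of_periodic hw.1 hper
  obtain ⟨z, hz⟩ := exists_forall_le_of_periodic hw.1 hper
  have hc : c ≤ S + C * ‖P‖ := by
    have := hw.stationarySuper.nonneg_of_forall_le hz
    rw [add_zero] at this
    linarith [(abs_le.1 (hH.abs_apply_le z P)).2]
  refine sub_le_of_periodic hΛ hper
    (sub_le_mul_norm_of_gradient_le hΛ hw.1 hM fun φ hφ z hz => ?_) x y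
  exact hH.norm_le_of_le (y := z) (by linarith [hw.2.1 φ hφ z hz])

lemma abs_discounted_add_le (hH : HamiltonianBounds H C c₀ S) (hl : 0 < l)
    (hv : IsDiscountedSolution H l P v) (hc : CellSolvable H P c) (y : Space N) :
    |l * v y + c| ≤ l * (lipConst C c₀ S * (1 + ‖P‖) * (2 * √N)) := by
  obtain ⟨w, hper, hw⟩ := hc
  have hwM := exists_abs_le_of_periodic hw.1 hper
  have hO := hH.corrector_sub_le hper hw
  exact abs_le.2
    ⟨neg_mul_le_mul_add_of_stationarySub hl (hH.lipschitz_add P) hv.2.1 hv.1 hw.1 hwM hO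
      hv.2.stationarySuper hw.stationarySub y,
      mul_add_le_of_stationarySuper hl (hH.lipschitz_add P) hv.2.1 hv.1 hw.1 hwM hO
        hv.2.stationarySub hw.stationarySuper y⟩

/-- The discounted solutions, normalized at `0`, converge along an ultrafilter to a corrector. -/
lemma exists_cellSolvable (hH : HamiltonianBounds H C c₀ S) {v : ℝ → Space N → ℝ}
    (hv : ∀ l > 0, IsDiscountedSolution H l P (v l)) : ∃ c, CellSolvable H P c := by
  let U : Ultrafilter ℕ := hyperfilter ℕ
  let l (n : ℕ) : ℝ := ((n : ℝ) + 1)⁻¹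
  have hl (n : ℕ) : 0 < l n := by positivity
  have hlim : Tendsto l U (𝓝 0) := (tendsto_inv_atTop_zero.comp
    (tendsto_natCast_atTop_atTop.atTop_add tendsto_const_nhds)).mono_left Nat.hyperfilter_le_atTop
  let v' (n : ℕ) (y : Space N) : ℝ := v (l n) y + -v (l n) 0
  have hlip (n : ℕ) (x y : Space N) :
      |v' n x - v' n y| ≤ lipConst C c₀ S * (1 + ‖P‖) * ‖x - y‖ := by
    rw [add_sub_add_right_eq_sub, abs_sub_le_iff]
    refine ⟨hH.discounted_sub_le (hl n) (hv _ (hl n)) x y, ?_⟩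
    rw [norm_sub_rev]
    exact hH.discounted_sub_le (hl n) (hv _ (hl n)) y x
  choose w hw using fun y => exists_tendsto_of_abs_le U (a := fun n => v' n y) fun n => by
    have := hlip n y 0
    rwa [show v' n 0 = 0 from add_neg_cancel _, sub_zero] at this
  obtain ⟨b, hb⟩ := exists_tendsto_of_abs_le U
    fun n => hH.abs_mul_discounted_le (hl n) (hv _ (hl n)) 0
  have hlimG (y : Space N) (r : ℝ) (q : Space N) :
      Tendsto (fun ξ : ℕ × Space N × ℝ × Space N =>
        l ξ.1 * (ξ.2.2.1 - -v (l ξ.1) 0) + H ξ.2.1 (P + ξ.2.2.2))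
      (U ×ˢ 𝓝 (y, r, q)) (𝓝 (H y (P + q) - -b)) := by
    have hr : Tendsto (fun ξ : ℕ × Space N × ℝ × Space N => ξ.2.2.1) (U ×ˢ 𝓝 (y, r, q)) (𝓝 r) :=
      ((by fun_prop : Continuous fun ξ : Space N × ℝ × Space N => ξ.2.1).tendsto _).comp
        tendsto_snd
    have hHlim := (hH.continuous_add P).tendsto (y, r, q) |>.comp
      (tendsto_snd (f := (U : Filter ℕ)))
    have := (((hlim.comp tendsto_fst).mul hr).add (hb.comp tendsto_fst)).add hHlim
    rw [zero_mul, zero_add, add_comm b, ← sub_neg_eq_add] at this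
    refine this.congr fun ξ => ?_
    simp only [Function.comp_apply]
    ring
  refine ⟨-b, w, fun y k => tendsto_nhds_unique (hw _) ((hw y).congr fun n => ?_),
    continuous_of_forall_abs_sub_le fun x y => le_of_tendsto' ((hw x).sub (hw y)).abs
      fun n => hlip n x y,
    StationarySub.of_tendsto (fun n => (hv _ (hl n)).2.stationarySub.add_const _) hlip hw hlimG,
    StationarySuper.of_tendsto (fun n => (hv _ (hl n)).2.stationarySuper.add_const _) hlip hw
      hlimG⟩
  exact congrArg (· + -v (l n) 0) (hH.discounted_periodic (hl n) (hv _ (hl n)) y k).symm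

lemma abs_cell_sub_le (hH : HamiltonianBounds H C c₀ S) {v : ℝ → Space N → Space N → ℝ}
    (hv : ∀ l > 0, ∀ P, IsDiscountedSolution H l P fun y => v l y P) (hc : CellSolvable H P c)
    (hd : CellSolvable H Q d) : |c - d| ≤ C * ‖P - Q‖ := by
  let E (P : Space N) := lipConst C c₀ S * (1 + ‖P‖) * (2 * √N)
  have happrox (l : ℝ) (hl : 0 < l) : |c - d| ≤ l * (E P + E Q) + C * ‖P - Q‖ := by
    have hP := abs_le.1 (hH.abs_discounted_add_le hl (hv l hl P) hc 0)
    have hQ := abs_le.1 (hH.abs_discounted_add_le hl (hv l hl Q) hd 0)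
    have hPQ := hH.mul_discounted_sub_le hl (hv l hl P) (hv l hl Q) 0
    have hQP := hH.mul_discounted_sub_le hl (hv l hl Q) (hv l hl P) 0
    rw [norm_sub_rev] at hQP
    rw [abs_sub_le_iff]
    constructor <;> linarith [hP.1, hP.2, hQ.1, hQ.2]
  have hlim : Tendsto (fun l => l * (E P + E Q) + C * ‖P - Q‖) (𝓝[>] 0) (𝓝 (C * ‖P - Q‖)) := by
    have : Continuous fun l : ℝ => l * (E P + E Q) + C * ‖P - Q‖ := by fun_prop
    simpa using (this.tendsto 0).mono_left nhdsWithin_le_nhds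
  refine ge_of_tendsto hlim ?_
  filter_upwards [self_mem_nhdsWithin] with l hl using happrox l hl

end HamiltonianBounds

/-! ### The maximum point of `Φ` -/

lemma norm_smul_sub_sub_smul_le {E : Type*} [NormedAddCommGroup E] [InnerProductSpace ℝ E]
    {a b Λ : ℝ} {x y : E} (hΛ : 0 ≤ Λ)
    (h : ∀ z, a / 2 * ‖x - y‖ ^ 2 + b / 2 * ‖y‖ ^ 2 ≤
      a / 2 * ‖x - z‖ ^ 2 + b / 2 * ‖z‖ ^ 2 + Λ * ‖z - y‖) :
    ‖a • (x - y) - b • y‖ ≤ Λ := by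
  set G := a • (x - y) - b • y with hG
  have hinner : ‖G‖ ^ 2 = a * inner ℝ (x - y) G - b * inner ℝ y G := by
    rw [← real_inner_self_eq_norm_sq]
    nth_rewrite 1 [hG]
    rw [inner_sub_left, real_inner_smul_left, real_inner_smul_left]
  have hvar (s : ℝ) (hs : 0 < s) : ‖G‖ ^ 2 ≤ Λ * ‖G‖ + (a + b) / 2 * ‖G‖ ^ 2 * s := by
    have hz := h (y + s • G)
    rw [← sub_sub, norm_sub_sq_real (x - y), norm_add_sq_real, add_sub_cancel_left,
      real_inner_smul_right, real_inner_smul_right, norm_smul, Real.norm_of_nonneg hs.le,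
      mul_pow] at hz
    refine le_of_mul_le_mul_left ?_ hs
    linear_combination hz + s * hinner
  have hlim : Tendsto (fun s => Λ * ‖G‖ + (a + b) / 2 * ‖G‖ ^ 2 * s) (𝓝[>] 0) (𝓝 (Λ * ‖G‖)) := by
    have : Continuous fun s => Λ * ‖G‖ + (a + b) / 2 * ‖G‖ ^ 2 * s := by fun_prop
    simpa using (this.tendsto 0).mono_left nhdsWithin_le_nhds
  have hsq : ‖G‖ ^ 2 ≤ Λ * ‖G‖ :=
    ge_of_tendsto hlim (eventually_mem_nhdsWithin.mono hvar)
  rcases (norm_nonneg G).eq_or_lt with hzero | hpos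
  · rwa [← hzero]
  · exact le_of_mul_le_mul_right (by rwa [← sq]) hpos

section Penalized

variable {E : Type*} [NormedAddCommGroup E] {T κ a b : ℝ} {u w : E → ℝ → ℝ} {V : E → ℝ}
  {g : ℝ → ℝ} {x₀ y₀ : E} {t₀ : ℝ}

lemma IsPenalizedMax.norm_smul_sub_le [InnerProductSpace ℝ E]
    (h : IsPenalizedMax T κ a b u w V g x₀ y₀ t₀) {L : ℝ}
    (hL : 0 ≤ L) (hw : ∀ x y, w x t₀ - w y t₀ ≤ L * ‖x - y‖) :
    ‖a • (x₀ - y₀)‖ ≤ L + κ + b * ‖y₀‖ := by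
  have hfirst : ‖a • (x₀ - y₀) - b • y₀‖ ≤ L + κ :=
    norm_smul_sub_sub_smul_le (add_nonneg hL h.nonneg.1) fun z => by
      have hz := h.le_max x₀ z t₀ h.mem_Icc
      rw [sub_sub_sub_cancel_left, norm_sub_rev y₀] at hz
      linarith [hw z y₀]
  have := norm_add_le (a • (x₀ - y₀) - b • y₀) (b • y₀)
  rw [sub_add_cancel, norm_smul b, Real.norm_of_nonneg h.nonneg.2.2] at this
  linarith

lemma IsPenalizedMax.mul_norm_sq_le (h : IsPenalizedMax T κ a b u w V g x₀ y₀ t₀) {M A B : ℝ}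
    (ha : 0 < a) (hM : u x₀ t₀ - w y₀ t₀ - (u 0 t₀ - w 0 t₀) ≤ M)
    (hV : V 0 - V x₀ ≤ A + B * ‖x₀ - y₀‖) :
    b * ‖y₀‖ ^ 2 ≤ 2 * M + 2 * A + (B + κ) ^ 2 / a := by
  have hzero := h.le_max 0 0 t₀ h.mem_Icc
  rw [sub_self, zero_sub, norm_neg, norm_zero] at hzero
  have hyoung : 2 * ((B + κ) * ‖x₀ - y₀‖) ≤ a * ‖x₀ - y₀‖ ^ 2 + (B + κ) ^ 2 / a := by
    have := div_nonneg (sq_nonneg (a * ‖x₀ - y₀‖ - (B + κ))) ha.le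
    rw [show (a * ‖x₀ - y₀‖ - (B + κ)) ^ 2 / a = a * ‖x₀ - y₀‖ ^ 2 + (B + κ) ^ 2 / a
      - 2 * ((B + κ) * ‖x₀ - y₀‖) by field_simp; ring] at this
    linarith
  linarith

end Penalized

lemma IsDiscountedSolution.nonneg_of_min {N : ℕ} {H : Space N → Space N → ℝ} {l ε c : ℝ}
    (hε : 0 < ε) {P x z : Space N} {v : Space N → ℝ} (hv : IsDiscountedSolution H l P v)
    (hz : ∀ z', ε * v (ε⁻¹ • z) + c / 2 * ‖x - z‖ ^ 2 ≤
      ε * v (ε⁻¹ • z') + c / 2 * ‖x - z'‖ ^ 2) :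
    0 ≤ l * v (ε⁻¹ • z) + H (ε⁻¹ • z) (P + c • (x - z)) := by
  have hscale (ζ : Space N) : ‖x - ε • ζ‖ ^ 2 = ε ^ 2 * ‖ε⁻¹ • x - ζ‖ ^ 2 := by
    rw [← mul_pow, ← norm_smul_of_nonneg hε.le, smul_sub, smul_inv_smul₀ hε.ne']
  have hmin := hv.2.stationarySuper.le_of_quadratic_min (a := c * ε) (b := 0) (x₀ := ε⁻¹ • x)
    (y₀ := ε⁻¹ • z) fun ζ => by
      have hζ := hz (ε • ζ)
      have hscale_z := hscale (ε⁻¹ • z)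
      rw [smul_inv_smul₀ hε.ne'] at hscale_z
      rw [inv_smul_smul₀ hε.ne', hscale, hscale_z] at hζ
      refine le_of_mul_le_mul_left ?_ hε
      linarith
  rwa [← smul_sub, smul_smul, mul_inv_cancel_right₀ hε.ne', zero_smul, sub_zero] at hmin

namespace HamiltonianBounds

variable {N : ℕ} {H : Space N → Space N → ℝ} {C c₀ S : ℝ}
  {v : ℝ → Space N → Space N → ℝ}

lemma cellSolvable_effectiveHamiltonian (hH : HamiltonianBounds H C c₀ S)
    (hv : ∀ l > 0, ∀ P, IsDiscountedSolution H l P fun y => v l y P) (P : Space N) :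
    CellSolvable H P (effectiveHamiltonian H P) :=
  Classical.epsilon_spec (hH.exists_cellSolvable (v := fun l y => v l y P) fun l hl => hv l hl P)

lemma abs_effectiveHamiltonian_sub_le (hH : HamiltonianBounds H C c₀ S)
    (hv : ∀ l > 0, ∀ P, IsDiscountedSolution H l P fun y => v l y P) (P Q : Space N) :
    |effectiveHamiltonian H P - effectiveHamiltonian H Q| ≤ C * ‖P - Q‖ :=
  hH.abs_cell_sub_le hv (hH.cellSolvable_effectiveHamiltonian hv P)
    (hH.cellSolvable_effectiveHamiltonian hv Q)

lemma abs_rescaled_sub_le (hH : HamiltonianBounds H C c₀ S) {ε : ℝ} (hε : 0 < ε)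
    (x y p q : Space N) :
    |H (ε⁻¹ • x) p - H (ε⁻¹ • y) q| ≤ C * (ε⁻¹ * ‖x - y‖ + ‖p - q‖) := by
  rw [← norm_smul_of_nonneg (inv_pos.2 hε).le, smul_sub]
  exact hH.lipschitz _ _ _ _

lemma effectiveHamiltonian_sub_le (hH : HamiltonianBounds H C c₀ S)
    (hv : ∀ l > 0, ∀ P, IsDiscountedSolution H l P fun y => v l y P) {ε l c : ℝ} (hε : 0 < ε)
    (hl : 0 < l) {P x z : Space N} (p q : Space N)
    (hz : ∀ z', ε * v l (ε⁻¹ • z) P + c / 2 * ‖x - z‖ ^ 2 ≤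
      ε * v l (ε⁻¹ • z') P + c / 2 * ‖x - z'‖ ^ 2) :
    effectiveHamiltonian H q - H (ε⁻¹ • x) (c • (x - z) + p) ≤
      l * (lipConst C c₀ S * (1 + ‖P‖) * (2 * √N))
        + C * (ε⁻¹ * ‖z - x‖ + ‖p - P‖ + ‖q - P‖) := by
  have hmin := IsDiscountedSolution.nonneg_of_min hε (hv l hl P) hz
  have hcell := hH.abs_discounted_add_le hl (hv l hl P)
    (hH.cellSolvable_effectiveHamiltonian hv P) (ε⁻¹ • z)
  have hq := hH.abs_effectiveHamiltonian_sub_le hv q P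
  have hxz := hH.abs_rescaled_sub_le hε z x (P + c • (x - z)) (c • (x - z) + p)
  rw [add_comm P, add_sub_add_left_eq_sub, norm_sub_rev P, add_comm _ P] at hxz
  linarith [(abs_le.1 hcell).2, (abs_le.1 hq).2, (abs_le.1 hxz).2]

section Maximum

variable {α T ε l κ a q δ : ℝ}
  {w ubar : Space N → ℝ → ℝ} {x₁ y₁ : Space N} {t₁ : ℝ} {g : ℝ → ℝ}

/-- The value of the corrector at the slope `(x - y) / ε ^ β` is compared with the one at the slope
at the maximum point; the price is linear in `|x - y - (x₁ - y₁)|`. -/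
lemma isPenalizedMax_of_forall_Phi_le (hH : HamiltonianBounds H C c₀ S)
    {v : Space N → Space N → ℝ} (hv : ∀ P, IsDiscountedSolution H l P fun y => v y P)
    (hα : 0 ≤ α) (hε : 0 < ε) (hl : 0 < l) (hδ : 0 ≤ δ) {β R Mw Mu : ℝ}
    (hw : ContinuousOn (Function.uncurry w) (univ ×ˢ Icc 0 T))
    (hwM : ∀ x, ∀ t ∈ Icc 0 T, |w x t| ≤ Mw)
    (hubar : ContinuousOn (Function.uncurry ubar) (univ ×ˢ Icc 0 T))
    (hubarM : ∀ x, ∀ t ∈ Icc 0 T, |ubar x t| ≤ Mu) (ht₁ : t₁ ∈ Ioc 0 T)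
    (hmax : ∀ x y, ∀ t ∈ Icc 0 T,
      Phi α ε β δ R w ubar v x y t ≤ Phi α ε β δ R w ubar v x₁ y₁ t₁) :
    IsPenalizedMax T (C * (ε / (l * ε ^ β))) (ε ^ β)⁻¹ δ w ubar
      (fun x => ε * v (ε⁻¹ • x) ((ε ^ β)⁻¹ • (x₁ - y₁)))
      (fun t => R * t ^ α / Real.Gamma (1 + α)) x₁ y₁ t₁ := by
  have hq : 0 < ε ^ β := Real.rpow_pos_of_pos hε β
  have hC := hH.C_nonneg
  obtain ⟨Mv, hMv⟩ := (hv ((ε ^ β)⁻¹ • (x₁ - y₁))).1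
  refine ⟨⟨by positivity, by positivity, hδ⟩, hw, hubar,
    continuous_const.mul ((hv _).2.1.comp (continuous_const_smul ε⁻¹)),
    (continuousOn_const.mul (continuousOn_id.rpow_const fun t _ => Or.inr hα)).div_const _,
    ⟨max (max Mw Mu) (ε * Mv), fun x t ht => ⟨?_, ?_, ?_⟩⟩, ht₁, fun x y t ht => ?_⟩
  · exact (hwM x t ht).trans ((le_max_left _ _).trans (le_max_left _ _))
  · exact (hubarM x t ht).trans ((le_max_right _ _).trans (le_max_left _ _))
  · rw [abs_mul, abs_of_pos hε]
    exact (mul_le_mul_of_nonneg_left (hMv _) hε.le).trans (le_max_right _ _)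
  · have hslope := hH.mul_discounted_sub_le hl (hv ((ε ^ β)⁻¹ • (x - y)))
      (hv ((ε ^ β)⁻¹ • (x₁ - y₁))) (ε⁻¹ • x)
    rw [← smul_sub, norm_smul_of_nonneg (inv_pos.2 hq).le] at hslope
    have hcorr := mul_le_mul_of_nonneg_left hslope (div_pos hε hl).le
    rw [← mul_assoc, div_mul_cancel₀ _ hl.ne', show ε / l * (C * ((ε ^ β)⁻¹ *
      ‖x - y - (x₁ - y₁)‖)) = C * (ε / (l * ε ^ β)) * ‖x - y - (x₁ - y₁)‖ by field_simp] at hcorr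
    have hsq (r : ℝ) : r / (2 * ε ^ β) = (ε ^ β)⁻¹ / 2 * r := by field_simp
    have := hmax x y t ht
    simp only [Phi, hsq] at this
    linarith

lemma caputo_sub_le_of_isPenalizedMax (hH : HamiltonianBounds H C c₀ S)
    (hv : ∀ l > 0, ∀ P, IsDiscountedSolution H l P fun y => v l y P)
    (hα : α ∈ Ioo (0 : ℝ) 1) (hε : 0 < ε) (hl : 0 < l)
    (hsub : TestsSub α T (fun x p => H (ε⁻¹ • x) p) w)
    (hsup : TestsSuper α T (fun _ p => effectiveHamiltonian H p) ubar)
    (h : IsPenalizedMax T κ a δ w ubar (fun x => ε * v l (ε⁻¹ • x) (a • (x₁ - y₁))) g x₁ y₁ t₁)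
    (hg : ContDiffOn ℝ 1 g (Ioc 0 T)) (hgmono : MonotoneOn g (Icc 0 T)) :
    KExists α 0 t₁ (fun s => w x₁ s - ubar y₁ s) t₁ ∧
      caputo α (fun s => w x₁ s - ubar y₁ s) t₁ ≤
        l * (lipConst C c₀ S * (1 + ‖a • (x₁ - y₁)‖) * (2 * √N)) + C * (δ * ‖y₁‖)
          + 2 * C * κ := by
  refine h.caputo_sub_le (B₁ := C * ε⁻¹) hα hg hgmono hsub hsup hH.C_nonneg
    fun c _ x y z p q hz => ?_
  set P := a • (x₁ - y₁)
  have hcell := hH.effectiveHamiltonian_sub_le hv hε hl p q hz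
  have hq : ‖q - P‖ ≤ ‖q - (P - δ • y₁)‖ + δ * ‖y₁‖ := by
    have := norm_sub_le (q - (P - δ • y₁)) (δ • y₁)
    rwa [sub_sub, sub_add_cancel, norm_smul_of_nonneg h.nonneg.2.2] at this
  have hzx : ‖z - x‖ ≤ ‖x - x₁‖ + ‖y - y₁‖ + ‖z - x₁‖ := by
    have := norm_sub_le_norm_sub_add_norm_sub z x₁ x
    rw [norm_sub_rev x₁ x] at this
    linarith [norm_nonneg (y - y₁)]
  have hεzx := mul_le_mul_of_nonneg_left hzx (inv_pos.2 hε).le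
  have := mul_le_mul_of_nonneg_left (add_le_add hεzx hq) hH.C_nonneg
  linarith

lemma mul_sub_discounted_le (hH : HamiltonianBounds H C c₀ S) {P : Space N} {v : Space N → ℝ}
    (hε : 0 ≤ ε) (hl : 0 < l) (hεl : ε ≤ l) (hv : IsDiscountedSolution H l P v) (y z : Space N) :
    ε * v y - ε * v z ≤ 2 * S + 2 * (C * (ε / l) * ‖P‖) := by
  have hdiff : l * (v y - v z) ≤ 2 * (S + C * ‖P‖) := by
    linarith [(abs_le.1 (hH.abs_mul_discounted_le hl hv y)).2,
      (abs_le.1 (hH.abs_mul_discounted_le hl hv z)).1]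
  have hscaled := mul_le_mul_of_nonneg_left hdiff (div_nonneg hε hl.le)
  rw [← mul_assoc, div_mul_cancel₀ _ hl.ne'] at hscaled
  linarith [mul_le_of_le_one_left hH.S_nonneg ((div_le_one hl).2 hεl)]

lemma mul_norm_le_of_isPenalizedMax (hH : HamiltonianBounds H C c₀ S) {v : Space N → ℝ}
    (hε : 0 < ε) (hl : 0 < l) (hq : 0 < q) (hεl : ε ≤ l) (hl₁ : l ≤ 1) (hq₁ : q ≤ 1)
    (hδ : δ ≤ l ^ 2) (hv : IsDiscountedSolution H l (q⁻¹ • (x₁ - y₁)) v)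
    (h : IsPenalizedMax T (C * (ε / (l * q))) q⁻¹ δ w ubar (fun x => ε * v (ε⁻¹ • x)) g x₁ y₁ t₁)
    {M : ℝ} (hM : |w x₁ t₁ - ubar y₁ t₁ - (w 0 t₁ - ubar 0 t₁)| ≤ M) :
    δ * ‖y₁‖ ≤ √(2 * M + 4 * S) * l + 3 * (C * (ε / (l * q))) := by
  have hM₀ : 0 ≤ 2 * M + 4 * S := by linarith [(abs_nonneg _).trans hM, hH.S_nonneg]
  have hδ₀ := h.nonneg.2.2
  have hκ := h.nonneg.1
  set κ := C * (ε / (l * q)) with hκ_def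
  have hcorr : ε * v (ε⁻¹ • 0) - ε * v (ε⁻¹ • x₁) ≤ 2 * S + 2 * κ * ‖x₁ - y₁‖ := by
    have := hH.mul_sub_discounted_le hε.le hl hεl hv (ε⁻¹ • 0) (ε⁻¹ • x₁)
    rwa [norm_smul_of_nonneg (inv_pos.2 hq).le, show 2 * (C * (ε / l) * (q⁻¹ * ‖x₁ - y₁‖)) =
      2 * κ * ‖x₁ - y₁‖ by rw [hκ_def]; field_simp] at this
  have hy : δ * ‖y₁‖ ^ 2 ≤ 2 * M + 4 * S + (3 * κ) ^ 2 := by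
    have hquad := h.mul_norm_sq_le (inv_pos.2 hq) ((le_abs_self _).trans hM) hcorr
    rw [div_inv_eq_mul] at hquad
    linarith [mul_le_of_le_one_right (sq_nonneg (2 * κ + κ)) hq₁]
  refine (sq_le_sq₀ (by positivity) (by positivity)).1 ?_
  calc (δ * ‖y₁‖) ^ 2 = δ * (δ * ‖y₁‖ ^ 2) := by ring
    _ ≤ l ^ 2 * (2 * M + 4 * S + (3 * κ) ^ 2) := by gcongr
    _ ≤ (√(2 * M + 4 * S) * l) ^ 2 + (3 * κ) ^ 2 := by
      rw [mul_pow √(2 * M + 4 * S), Real.sq_sqrt hM₀, mul_add, mul_comm (l ^ 2) (2 * M + 4 * S)]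
      gcongr
      exact mul_le_of_le_one_left (sq_nonneg _) (pow_le_one₀ hl.le hl₁)
    _ ≤ (√(2 * M + 4 * S) * l + 3 * κ) ^ 2 := by
      have : 0 ≤ √(2 * M + 4 * S) * l * (3 * κ) := by positivity
      linarith

/-- The constant in the final estimate, for a Lipschitz constant `L` of the solution of the
effective problem, and `D` such that `D λ` is the leading part of the bound of `δ |y₁|`. -/
noncomputable def rateConst (N : ℕ) (C c₀ S L D : ℝ) : ℝ :=
  lipConst C c₀ S * (2 * √N) * (1 + L + D + 4 * C) + C * D + 5 * C ^ 2

lemma rateConst_nonneg (hH : HamiltonianBounds H C c₀ S) {L D : ℝ} (hL : 0 ≤ L) (hD : 0 ≤ D) :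
    0 ≤ rateConst N C c₀ S L D := by
  have := hH.C_nonneg
  have := hH.lipConst_nonneg
  unfold rateConst
  positivity

lemma le_rateConst_mul (hH : HamiltonianBounds H C c₀ S) {L D Y p d : ℝ} (hl : 0 ≤ l)
    (hl₁ : l ≤ 1) (hL : 0 ≤ L) (hD : 0 ≤ D) (hY : 0 ≤ Y) (hp : p ≤ L + C * Y + d)
    (hd : d ≤ D * l + 3 * (C * Y)) :
    l * (lipConst C c₀ S * (1 + p) * (2 * √N)) + C * d + 2 * C * (C * Y) ≤
      rateConst N C c₀ S L D * (l + Y) := by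
  have hC := hH.C_nonneg
  have hlip := hH.lipConst_nonneg
  have hslope : 1 + p ≤ 1 + L + D * l + 4 * (C * Y) := by linarith
  calc l * (lipConst C c₀ S * (1 + p) * (2 * √N)) + C * d + 2 * C * (C * Y)
      ≤ l * (lipConst C c₀ S * (1 + L + D * l + 4 * (C * Y)) * (2 * √N))
        + C * (D * l + 3 * (C * Y)) + 2 * C * (C * Y) := by gcongr
    _ ≤ rateConst N C c₀ S L D * (l + Y) := by
      rw [rateConst]
      set E := lipConst C c₀ S * (2 * √N) with hE
      have : 0 ≤ E := by positivity
      have hll : E * D * l * l ≤ E * D * l := mul_le_of_le_one_right (by positivity) hl₁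
      have hlY : 4 * E * C * Y * l ≤ 4 * E * C * Y := mul_le_of_le_one_right (by positivity) hl₁
      have hYrest : 0 ≤ (E * (1 + L + D) + C * D) * Y := by positivity
      have hlrest : 0 ≤ (4 * E * C + 5 * C ^ 2) * l := by positivity
      linear_combination hll + hlY + hYrest + hlrest
        + l * (1 + L + D * l + 4 * (C * Y)) * hE

lemma caputo_sub_le_of_forall_Phi_le (hH : HamiltonianBounds H C c₀ S)
    (hv : ∀ l > 0, ∀ P, IsDiscountedSolution H l P fun y => v l y P) (hα : α ∈ Ioo (0 : ℝ) 1)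
    (hε : 0 < ε) (hl : 0 < l) (hεl : ε ≤ l) (hl₁ : l ≤ 1) (hδ : δ ∈ Icc 0 (l ^ 2)) {β R : ℝ}
    (hβ : ε ^ β ≤ 1) (hR : 0 ≤ R) {u₀ : Space N → ℝ} {L Mw Mu : ℝ} (hL : 0 ≤ L)
    (hw : IsSolution α T (fun x p => H (ε⁻¹ • x) p) u₀ w)
    (hwM : ∀ x, ∀ t ∈ Icc 0 T, |w x t| ≤ Mw)
    (hubar : IsSolution α T (fun _ p => effectiveHamiltonian H p) u₀ ubar)
    (hubarM : ∀ x, ∀ t ∈ Icc 0 T, |ubar x t| ≤ Mu)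
    (hubarL : ∀ x y, ∀ t ∈ Icc 0 T, ubar x t - ubar y t ≤ L * ‖x - y‖) (ht₁ : t₁ ∈ Ioc 0 T)
    (hmax : ∀ x y, ∀ t ∈ Icc 0 T,
      Phi α ε β δ R w ubar (v l) x y t ≤ Phi α ε β δ R w ubar (v l) x₁ y₁ t₁) :
    KExists α 0 t₁ (fun s => w x₁ s - ubar y₁ s) t₁ ∧
      caputo α (fun s => w x₁ s - ubar y₁ s) t₁ ≤
        rateConst N C c₀ S L √(4 * (Mw + Mu + S)) * (l + ε / (l * ε ^ β)) := by
  have hq : 0 < ε ^ β := Real.rpow_pos_of_pos hε β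
  have hΓ : 0 < Real.Gamma (1 + α) := Real.Gamma_pos_of_pos (by linarith [hα.1])
  have h := hH.isPenalizedMax_of_forall_Phi_le (hv l hl) hα.1.le hε hl hδ.1 hw.1 hwM hubar.1
    hubarM ht₁ hmax
  have ht := h.mem_Icc
  have hy := hH.mul_norm_le_of_isPenalizedMax hε hl hq hεl hl₁ hβ hδ.2 (hv l hl _) h
    (M := 2 * (Mw + Mu)) (abs_le.2 ⟨by
      linarith [(abs_le.1 (hwM x₁ t₁ ht)).1, (abs_le.1 (hwM 0 t₁ ht)).2,
        (abs_le.1 (hubarM y₁ t₁ ht)).2, (abs_le.1 (hubarM 0 t₁ ht)).1], by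
      linarith [(abs_le.1 (hwM x₁ t₁ ht)).2, (abs_le.1 (hwM 0 t₁ ht)).1,
        (abs_le.1 (hubarM y₁ t₁ ht)).1, (abs_le.1 (hubarM 0 t₁ ht)).2]⟩)
  rw [← mul_assoc, show (2 : ℝ) * 2 = 4 by norm_num, ← mul_add] at hy
  obtain ⟨hK, hle⟩ := hH.caputo_sub_le_of_isPenalizedMax hv hα hε hl hw.2.2.1.2.2
    hubar.2.2.2.2.2 h
    ((contDiffOn_const.mul fun t ht =>
      (Real.contDiffAt_rpow_const_of_ne ht.1.ne').contDiffWithinAt).div_const _)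
    fun s hs t _ hst => div_le_div_of_nonneg_right
      (mul_le_mul_of_nonneg_left (Real.rpow_le_rpow hs.1 hst hα.1.le) hR) hΓ.le
  exact ⟨hK, hle.trans (hH.le_rateConst_mul hl.le hl₁ hL (Real.sqrt_nonneg _) (by positivity)
    (h.norm_smul_sub_le hL fun x y => hubarL x y t₁ ht) hy)⟩

lemma abs_solution_le (hH : HamiltonianBounds H C c₀ S) (hα : α ∈ Ioo (0 : ℝ) 1) (hε : 0 < ε)
    {u₀ : Space N → ℝ} {M₀ : ℝ} (hM₀ : ∀ x, |u₀ x| ≤ M₀)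
    (hw : IsSolution α T (fun x p => H (ε⁻¹ • x) p) u₀ w) (x : Space N) {t : ℝ}
    (ht : t ∈ Icc 0 T) : |w x t| ≤ M₀ + T ^ α * Real.Gamma (1 - α) * S := by
  have hC := hH.C_nonneg
  refine hw.abs_apply_le hα (C := C * (ε⁻¹ + 1)) (by positivity) (fun x y p q => ?_)
    (fun x => hH.abs_zero_le _) hM₀ x ht
  refine (hH.abs_rescaled_sub_le hε x y p q).trans ?_
  rw [mul_assoc]
  refine mul_le_mul_of_nonneg_left ?_ hC
  have : 0 ≤ ε⁻¹ * ‖p - q‖ := by positivity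
  linarith [norm_nonneg (x - y)]

end Maximum

end HamiltonianBounds

lemma rpow_le_rpow_sub_mul_div {ε θ β ν : ℝ} (hε : ε ∈ Ioc (0 : ℝ) 1) (hβ : 0 ≤ β) (hν : ν ≤ 1) :
    ε ^ θ ≤ ε ^ (θ - β * (1 - ν) / (2 - ν)) :=
  Real.rpow_le_rpow_of_exponent_ge hε.1 hε.2
    (sub_le_self _ (div_nonneg (mul_nonneg hβ (by linarith)) (by linarith)))

end TFHJ

theorem lemma5p2_general {N : ℕ} {α T : ℝ} (hα : α ∈ Set.Ioo (0 : ℝ) 1)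
    {H : TFHJ.Space N → TFHJ.Space N → ℝ} {u₀ : TFHJ.Space N → ℝ}
    (hA : TFHJ.Assumptions H u₀) {u : ℝ → TFHJ.Space N → ℝ → ℝ}
    (hu : ∀ ε > 0, TFHJ.IsSolution α T (fun x p => H (ε⁻¹ • x) p) u₀ (u ε))
    {ubar : TFHJ.Space N → ℝ → ℝ}
    (hubar : TFHJ.IsSolution α T (fun _ p => TFHJ.effectiveHamiltonian H p) u₀ ubar)
    {v : ℝ → TFHJ.Space N → TFHJ.Space N → ℝ}
    (hv : ∀ l > 0, ∀ P, TFHJ.IsDiscountedSolution H l P (fun y => v l y P))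
    {θ β : ℝ} (hθ : θ ∈ Set.Icc (0 : ℝ) 1) (hβ : 0 ≤ β) :
    ∃ C > 0, ∀ ε ∈ Set.Ioc (0 : ℝ) 1, ∀ δ ≥ 0, ∀ R ≥ 0, δ ^ (1 / 2 : ℝ) ≤ ε ^ θ →
      ∀ (x₁ y₁ : TFHJ.Space N), ∀ t₁ ∈ Set.Ioc 0 T,
        (∀ (x y : TFHJ.Space N), ∀ t ∈ Set.Icc 0 T,
          TFHJ.Phi α ε β δ R (u ε) ubar (v (ε ^ θ)) x y t ≤
            TFHJ.Phi α ε β δ R (u ε) ubar (v (ε ^ θ)) x₁ y₁ t₁) →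
        TFHJ.KExists α 0 t₁ (fun s => u ε x₁ s - ubar y₁ s) t₁ ∧
        TFHJ.J α (u ε x₁) t₁ - TFHJ.J α (ubar y₁) t₁
            + TFHJ.K α 0 t₁ (fun s => u ε x₁ s - ubar y₁ s) t₁
          ≤ C * (ε ^ θ + ε ^ (1 - θ - β)) := by
  obtain ⟨C, c₀, S, hH⟩ := hA.exists_bounds
  obtain ⟨M₀, hM₀⟩ := hA.initial_bounded
  obtain ⟨L, hL⟩ := hA.initial_lipschitz
  obtain ⟨Mu, hMu⟩ := hubar.2.1
  have hubarL (x y : TFHJ.Space N) (t : ℝ) (ht : t ∈ Icc 0 T) := hubar.sub_le_mul_norm hα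
    hH.C_nonneg (hH.abs_effectiveHamiltonian_sub_le hv) L.coe_nonneg
    (fun x y => by simpa only [dist_eq_norm, Real.norm_eq_abs] using hL.dist_le_mul x y) x y ht
  set D := √(4 * (M₀ + T ^ α * Real.Gamma (1 - α) * S + Mu + S))
  have hrate := hH.rateConst_nonneg L.coe_nonneg (Real.sqrt_nonneg _ : 0 ≤ D)
  refine ⟨TFHJ.HamiltonianBounds.rateConst N C c₀ S L D + 1, by positivity,
    fun ε hε δ hδ R hR hδε x₁ y₁ t₁ ht₁ hmax => ?_⟩
  have hδl : δ ≤ (ε ^ θ) ^ 2 := by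
    rw [← Real.sqrt_eq_rpow] at hδε
    exact (Real.sqrt_le_left (Real.rpow_nonneg hε.1.le θ)).1 hδε
  have hεl : ε ≤ ε ^ θ := by
    simpa using Real.rpow_le_rpow_of_exponent_ge hε.1 hε.2 hθ.2
  obtain ⟨hK, hle⟩ := hH.caputo_sub_le_of_forall_Phi_le hv hα hε.1 (Real.rpow_pos_of_pos hε.1 θ)
    hεl (Real.rpow_le_one hε.1.le hε.2 hθ.1) ⟨hδ, hδl⟩ (Real.rpow_le_one hε.1.le hε.2 hβ) hR
    L.coe_nonneg (hu ε hε.1) (fun x t => hH.abs_solution_le hα hε.1 hM₀ (hu ε hε.1) x) hubar hMu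
    hubarL ht₁ hmax
  have hpow : ε / (ε ^ θ * ε ^ β) = ε ^ (1 - θ - β) := by
    rw [sub_sub, Real.rpow_sub hε.1, Real.rpow_one, Real.rpow_add hε.1]
  rw [TFHJ.caputo, TFHJ.J_sub, hpow] at hle
  have : 0 ≤ ε ^ θ + ε ^ (1 - θ - β) :=
    add_nonneg (Real.rpow_nonneg hε.1.le _) (Real.rpow_nonneg hε.1.le _)
  exact ⟨hK, by linarith⟩

theorem lemma5p2 {N : ℕ} (α T : ℝ) (hα : α ∈ Set.Ioo (0 : ℝ) 1) (hT : 0 < T)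
    (H : TFHJ.Space N → TFHJ.Space N → ℝ) (u₀ : TFHJ.Space N → ℝ)
    (hA : TFHJ.Assumptions H u₀)
    (u : ℝ → TFHJ.Space N → ℝ → ℝ)
    (hu : ∀ ε > 0, TFHJ.IsSolution α T (fun x p => H (ε⁻¹ • x) p) u₀ (u ε))
    (ubar : TFHJ.Space N → ℝ → ℝ)
    (hubar : TFHJ.IsSolution α T (fun _ p => TFHJ.effectiveHamiltonian H p) u₀ ubar)
    (v : ℝ → TFHJ.Space N → TFHJ.Space N → ℝ)
    (hv : ∀ l > 0, ∀ P, TFHJ.IsDiscountedSolution H l P (fun y => v l y P))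
    (θ β : ℝ) (hθ : θ ∈ Set.Ioo (0 : ℝ) 1) (hβ : β ∈ Set.Ioo (0 : ℝ) 1) :
    ∃ ε₀ ∈ Set.Ioo (0 : ℝ) 1, ∀ ν ∈ Set.Ioo (0 : ℝ) 1, ∃ C > 0,
      ∀ ε ∈ Set.Ioo (0 : ℝ) ε₀, ∀ δ ∈ Set.Ioo (0 : ℝ) 1, ∀ R > 0,
        δ ^ (1 / 2 : ℝ) < ε ^ θ →
        ∀ (x₁ y₁ : TFHJ.Space N), ∀ t₁ ∈ Set.Ioc 0 T,
          (∀ (x y : TFHJ.Space N), ∀ t ∈ Set.Icc 0 T,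
            TFHJ.Phi α ε β δ R (u ε) ubar (v (ε ^ θ)) x y t ≤
              TFHJ.Phi α ε β δ R (u ε) ubar (v (ε ^ θ)) x₁ y₁ t₁) →
          TFHJ.KExists α 0 t₁ (fun s => u ε x₁ s - ubar y₁ s) t₁ ∧
          TFHJ.J α (u ε x₁) t₁ - TFHJ.J α (ubar y₁) t₁
              + TFHJ.K α 0 t₁ (fun s => u ε x₁ s - ubar y₁ s) t₁
            ≤ C * (ε ^ (θ - β * (1 - ν) / (2 - ν)) + ε ^ (1 - θ - β)) ∧
          (TFHJ.KExists α 0 t₁ (u ε x₁) t₁ → TFHJ.KExists α 0 t₁ (ubar y₁) t₁ →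
            TFHJ.J α (u ε x₁) t₁ - TFHJ.J α (ubar y₁) t₁
                + TFHJ.K α 0 t₁ (u ε x₁) t₁ - TFHJ.K α 0 t₁ (ubar y₁) t₁
              ≤ C * (ε ^ (θ - β * (1 - ν) / (2 - ν)) + ε ^ (1 - θ - β))) := by
  obtain ⟨C, hC, h⟩ := lemma5p2_general hα hA hu hubar hv (Ioo_subset_Icc_self hθ) hβ.1.le
  refine ⟨1 / 2, by norm_num, fun ν hν => ⟨C, hC,
    fun ε hε δ hδ R hR hδε x₁ y₁ t₁ ht₁ hmax => ?_⟩⟩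
  have hε₁ : ε ≤ 1 := by linarith [hε.2]
  obtain ⟨hK, hle⟩ := h ε ⟨hε.1, hε₁⟩ δ hδ.1.le R hR.le hδε.le x₁ y₁ t₁ ht₁ hmax
  have hrate := TFHJ.rpow_le_rpow_sub_mul_div (θ := θ) ⟨hε.1, hε₁⟩ hβ.1.le hν.2.le
  have hbound := hle.trans (mul_le_mul_of_nonneg_left (add_le_add_left hrate _) hC.le)
  exact ⟨hK, hbound, fun hKu hKubar => by linarith [TFHJ.K_sub hKu hKubar]⟩
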